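/- Let $n\ge 2$, let $\mathcal M$ be the manifold of positive definite complex $n\times n$ matrices, an open subset of the real vector space $\mathcal M_h$ of hermitian $n\times n$ matrices. All tangent spaces $T_\rho\mathcal M$ are identified with $\mathcal M_h$, and $\mathcal X,\mathcal Y,\dots$ denote the constant vector fields with values $X,Y,\dots\in\mathcal M_h$. Let $G$ be the set of operator convex functions $g:(0,\infty)\to\mathbb R$ with $g(1)=0$ and $g''(1)=1$; put $\hat g(u)=u\,g(u^{-1})$. For $g\in G$ and $\rho,\sigma\in\mathcal M$ let $$H_g(\rho,\sigma)=\operatorname{Tr}\rho^{1/2}\,g(L_\sigma/R_\rho)(\rho^{1/2}),$$ where $L_\sigma/R_\rho$ is the operator $X\mapsto\sigma X\rho^{-1}$. Define a Riemannian metric $\lambda=\lambda^g$ and a connection $\nabla^{(g)}$ on $\mathcal M$ by $$\lambda_\rho(X,Y)=-\frac{\partial^2}{\partial s\,\partial t}H_g(\rho+sX,\rho+tY)\Big|_{s=t=0},\qquad \lambda_\rho(\nabla^{(g)}_{\mathcal X}\mathcal Y,\mathcal Z)=-\frac{\partial^3}{\partial s\,\partial t\,\partial u}H_g(\rho+sX+tY,\rho+uZ)\Big|_{s=t=u=0}.$$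 Let $\bar\nabla$ be the metric (Levi-Civita) connection of $\lambda$, let $D(\mathcal X,\mathcal Y)=\nabla^{(g)}_{\mathcal X}\mathcal Y-\nabla^{(\hat g)}_{\mathcal X}\mathcal Y$, and for $p\in\mathbb R$ let $\nabla^{(p)}_{\mathcal X}\mathcal Y=\bar\nabla_{\mathcal X}\mathcal Y-\frac{1-2p}{2}D(\mathcal X,\mathcal Y)$, with Riemannian curvature tensor $R^p$. The statistical manifold $(\mathcal M,g)$, that is $\mathcal M$ with the metric $\lambda$ and the skewness $\lambda(D(\mathcal X,\mathcal Y),\mathcal Z)$, is called conjugate symmetric if $R^p=R^{1-p}$ for all $p\in\mathbb R$. **Theorem.** Let $g\in G$ with $g\neq\hat g$, and let $\bar g=g+\hat g$, $g_r=\hat g-g$. If $(\mathcal M,g)$ is conjugate symmetric, then $$-\alpha\,\bar g(u)=2u\,g_r'(u)-g_r(u)+2au+2a\qquad\text{for all }u>0,$$ where $a=g'(1)$ and $\alpha=2g'''(1)+3$. -/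

import Mathlib

open scoped Matrix Kronecker ComplexOrder

noncomputable section

namespace QIG

/-- Operator convexity of `g` on `(0, ∞)`: for positive definite matrices of every size,
`g((1 - t) A + t B) ≤ (1 - t) g(A) + t g(B)` in the Loewner order. Only the values of `g` on
`(0, ∞)` matter, as `(0, ∞)` contains the spectra of all the matrices involved. -/
def OperatorConvex (g : ℝ → ℝ) : Prop :=
  ∀ (m : ℕ) (A B : Matrix (Fin m) (Fin m) ℂ), A.PosDef → B.PosDef →
    ∀ t : ℝ, 0 ≤ t → t ≤ 1 →
      (((1 - t) • cfc g A + t • cfc g B) - cfc g ((1 - t) • A + t • B)).PosSemidef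

/-- The set `G` of operator convex functions on `(0, ∞)` with `g(1) = 0` and `g''(1) = 1`. -/
structure InG (g : ℝ → ℝ) : Prop where
  operatorConvex : OperatorConvex g
  map_one : g 1 = 0
  second_deriv_one : iteratedDeriv 2 g 1 = 1

/-- The function `ĝ(u) = u g(u⁻¹)`. -/
def hat (g : ℝ → ℝ) : ℝ → ℝ := fun u => u * g u⁻¹

variable {n : ℕ}

/-- The matrix, with respect to the orthonormal basis of matrix units `e_{ij}`, of the operator
`L_σ / R_ρ = L_σ R_ρ⁻¹`, that is `X ↦ σ X ρ⁻¹`, on complex `n × n` matrices. -/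
def relModular (σ ρ : Matrix (Fin n) (Fin n) ℂ) :
    Matrix (Fin n × Fin n) (Fin n × Fin n) ℂ :=
  σ ⊗ₖ (ρ⁻¹)ᵀ

/-- The action on `n × n` matrices of an operator given by its matrix in the basis `e_{ij}`. -/
def applyOp (T : Matrix (Fin n × Fin n) (Fin n × Fin n) ℂ) (X : Matrix (Fin n) (Fin n) ℂ) :
    Matrix (Fin n) (Fin n) ℂ :=
  Matrix.of fun i j => (T *ᵥ fun p => X p.1 p.2) (i, j)

theorem applyOp_relModular (σ ρ X : Matrix (Fin n) (Fin n) ℂ) :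
    applyOp (relModular σ ρ) X = σ * X * ρ⁻¹ := by
  ext i j
  simp only [applyOp, relModular, Matrix.of_apply, Matrix.mulVec, dotProduct,
    Fintype.sum_prod_type, Matrix.kroneckerMap_apply, Matrix.transpose_apply, Matrix.mul_apply,
    Finset.sum_mul]
  rw [Finset.sum_comm]
  refine Finset.sum_congr rfl fun l _ => Finset.sum_congr rfl fun k _ => ?_
  ring

/-- The relative `g`-entropy `H_g(ρ, σ) = Tr ρ^{1/2} g(L_σ / R_ρ)(ρ^{1/2})` of positive definite
`ρ`, `σ`. This trace is real. -/
def relEntropy (g : ℝ → ℝ) (ρ σ : Matrix (Fin n) (Fin n) ℂ) : ℝ :=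
  (Matrix.trace (cfc Real.sqrt ρ * applyOp (cfc g (relModular σ ρ)) (cfc Real.sqrt ρ))).re

/-! The manifold is the open set of positive definite matrices in the real vector space of
hermitian matrices. All tangent spaces are identified with the hermitian matrices, a vector
field is a hermitian matrix valued function on the manifold, and a fixed hermitian matrix stands
for the corresponding constant vector field. Constant vector fields commute. -/

/-- The metric `λ^g_ρ(X, Y) = - ∂²/∂s∂t H_g(ρ + sX, ρ + tY)` at `s = t = 0`. -/
def metric (g : ℝ → ℝ) (ρ X Y : Matrix (Fin n) (Fin n) ℂ) : ℝ :=
  -deriv (fun s : ℝ => deriv (fun t : ℝ => relEntropy g (ρ + s • X) (ρ + t • Y)) 0) 0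

/-- The derivative `𝒳 f (ρ)` of a real function along a constant vector field. -/
def derivAlong (f : Matrix (Fin n) (Fin n) ℂ → ℝ) (ρ X : Matrix (Fin n) (Fin n) ℂ) : ℝ :=
  deriv (fun s : ℝ => f (ρ + s • X)) 0

/-- The (unique) hermitian matrix `W` such that `λ^g_ρ(W, Z) = ℓ(Z)` for all hermitian `Z`. -/
def metricDual (g : ℝ → ℝ) (ρ : Matrix (Fin n) (Fin n) ℂ)
    (l : Matrix (Fin n) (Fin n) ℂ → ℝ) : Matrix (Fin n) (Fin n) ℂ :=
  Classical.epsilon fun W : Matrix (Fin n) (Fin n) ℂ =>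
    W.IsHermitian ∧ ∀ Z : Matrix (Fin n) (Fin n) ℂ, Z.IsHermitian → metric g ρ W Z = l Z

/-- The connection `∇^(g)` on constant vector fields, at the point `ρ`:
`λ_ρ(∇^(g)_𝒳 𝒴, 𝒵) = - ∂³/∂s∂t∂u H_g(ρ + sX + tY, ρ + uZ)` at `s = t = u = 0`. -/
def entropyConn (g : ℝ → ℝ) (ρ X Y : Matrix (Fin n) (Fin n) ℂ) : Matrix (Fin n) (Fin n) ℂ :=
  metricDual g ρ fun Z =>
    -deriv (fun s : ℝ => deriv (fun t : ℝ => deriv (fun u : ℝ =>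
      relEntropy g (ρ + s • X + t • Y) (ρ + u • Z)) 0) 0) 0

/-- The metric (Levi-Civita) connection of `λ^g` on constant vector fields, at the point `ρ`;
as constant vector fields commute, it is given by
`λ(∇_𝒳 𝒴, 𝒵) = (𝒳 λ(𝒴, 𝒵) + 𝒴 λ(𝒳, 𝒵) - 𝒵 λ(𝒳, 𝒴)) / 2`. -/
def metricConn (g : ℝ → ℝ) (ρ X Y : Matrix (Fin n) (Fin n) ℂ) : Matrix (Fin n) (Fin n) ℂ :=
  metricDual g ρ fun Z =>
    (derivAlong (fun τ => metric g τ Y Z) ρ X + derivAlong (fun τ => metric g τ X Z) ρ Y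
      - derivAlong (fun τ => metric g τ X Y) ρ Z) / 2

/-- The tensor `D(𝒳, 𝒴) = ∇^(g)_𝒳 𝒴 - ∇^(ĝ)_𝒳 𝒴`; the skewness is `λ(D(𝒳, 𝒴), 𝒵)`. -/
def skewTensor (g : ℝ → ℝ) (ρ X Y : Matrix (Fin n) (Fin n) ℂ) : Matrix (Fin n) (Fin n) ℂ :=
  entropyConn g ρ X Y - entropyConn (hat g) ρ X Y

/-- The connections `∇^(p) = ∇̄ - ((1 - 2p) / 2) D` of the statistical manifold, on constant
vector fields. -/
def pConn (g : ℝ → ℝ) (p : ℝ) (ρ X Y : Matrix (Fin n) (Fin n) ℂ) : Matrix (Fin n) (Fin n) ℂ :=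
  metricConn g ρ X Y - ((1 - 2 * p) / 2) • skewTensor g ρ X Y

/-- The covariant derivative `∇_𝒳 V` of an arbitrary vector field `V` along a constant vector
field, for the connection whose values on constant vector fields are `Γ`: the entrywise
derivative of `V` along `X`, plus `Γ(X, V)`. -/
def covDeriv (Γ : Matrix (Fin n) (Fin n) ℂ → Matrix (Fin n) (Fin n) ℂ →
      Matrix (Fin n) (Fin n) ℂ → Matrix (Fin n) (Fin n) ℂ)
    (X : Matrix (Fin n) (Fin n) ℂ) (V : Matrix (Fin n) (Fin n) ℂ → Matrix (Fin n) (Fin n) ℂ)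
    (ρ : Matrix (Fin n) (Fin n) ℂ) : Matrix (Fin n) (Fin n) ℂ :=
  (Matrix.of fun i j => deriv (fun s : ℝ => V (ρ + s • X) i j) 0) + Γ ρ X (V ρ)

/-- The Riemannian curvature `R^p(𝒳, 𝒴, 𝒵, 𝒲) = λ(∇_𝒳 ∇_𝒴 𝒵 - ∇_𝒴 ∇_𝒳 𝒵, 𝒲)` of `∇ = ∇^(p)`,
on constant vector fields (for which `[𝒳, 𝒴] = 0`). -/
def curvature (g : ℝ → ℝ) (p : ℝ) (ρ X Y Z W : Matrix (Fin n) (Fin n) ℂ) : ℝ :=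
  metric g ρ
    (covDeriv (pConn g p) X (covDeriv (pConn g p) Y fun _ => Z) ρ
      - covDeriv (pConn g p) Y (covDeriv (pConn g p) X fun _ => Z) ρ) W

/-- Conjugate symmetry of the statistical manifold of positive definite `n × n` matrices
defined by `g`: `R^p = R^{1-p}` for all `p`. -/
def ConjugateSymmetric (n : ℕ) (g : ℝ → ℝ) : Prop :=
  ∀ (p : ℝ) (ρ X Y Z W : Matrix (Fin n) (Fin n) ℂ), ρ.PosDef →
    X.IsHermitian → Y.IsHermitian → Z.IsHermitian → W.IsHermitian →
      curvature g p ρ X Y Z W = curvature g (1 - p) ρ X Y Z W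

end QIG

end

/-! The base point `x` of the cone of positive definite matrices is itself a tangent vector, and
curvature in planes containing `x` is accessible because `H_g` is homogeneous of degree one. Let `H`
be the divergence, `T` its third derivative and `τ` the trace. The function `H` and its first
derivative are known on proportional pairs `(x, u x)`. Together with Euler's identities this
determines what is needed of the metric, the metric connection and the skewness when suitable
arguments equal `x`: `λ(x, W) = τ(W)`, `∇̄_x Y = -Y/2`, and the skewness of `(x, x, W)` is `-α
τ(W)`. For `∇̄ - q D` it follows that the curvature of `(x, Y, x, Y)` is `q² S - (q/2)(α λ(Y, Y) +
λ(D(x, Y), Y))` with `S` independent of `q` (`riem_self`). Comparing `p = 0` with `p = 1`, that is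
`q = 1/2` with `q = -1/2`, isolates the odd part: `λ(D(x, Y), Y) = -α λ(Y, Y)`
(`skew_eq_of_riem_eq`).

By `skew_diag` the left side is the difference of the derivatives at `u = 1` of the second
derivatives of `H` in the moving argument, at `(u x, x)` and at `(x, u x)`. Take `x` diagonal and
`Y` the velocity of its rotation in one coordinate plane. The entropy of `x` relative to `u` times
the rotated `x` is exactly `C + K(u) sin² t` (`exists_relEntropy_rotation`), so every term is a
value or a derivative of `K` at `1`, for `g` and for `ĝ`. With eigenvalues `1` and `v`, `K(1)` is
`ḡ(v)`, and the identity becomes the stated equation.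

The analytic burden is the smoothness of `H` and the nondegeneracy of the metric. Operator convexity
is inherited by `-(f(t + c) - f(c))/t`, so the differences of `f` of order at least two alternate in
sign. Bernstein's argument then expands `f` in a power series about a point `c` that converges down
to any `ε > 0`, and the functional calculus is locally a convergent power series in the matrix
(`OperatorConvex.exists_contDiffAt_eq_cfc`). Since `H_g` is monotone in `g`, comparison with tangent
lines gives the first derivatives on rays, and comparison with parabolas the positivity of the
metric. -/

namespace QIG

open Matrix Polynomial

/-! ### Functional calculus of hermitian matrices through interpolating polynomials -/

section FunctionalCalculus

variable {p q : Type*} [Fintype p] [DecidableEq p] [Fintype q] [DecidableEq q]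

theorem exists_polynomial_eval_eq (f : ℝ → ℝ) (s : Finset ℝ) :
    ∃ P : ℝ[X], ∀ x ∈ s, P.eval x = f x :=
  ⟨Lagrange.interpolate s id f, fun _ hx =>
    Lagrange.eval_interpolate_at_node f (Set.injOn_id _) hx⟩

theorem continuousOn_spectrum (f : ℝ → ℝ) (A : Matrix p p ℂ) : ContinuousOn f (spectrum ℝ A) :=
  (Matrix.finite_real_spectrum (A := A)).continuousOn f

theorem cfc_eq_aeval {A : Matrix p p ℂ} (hA : A.IsHermitian) {f : ℝ → ℝ} {P : ℝ[X]}
    (h : ∀ x ∈ spectrum ℝ A, P.eval x = f x) : cfc f A = aeval A P := by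
  rw [← cfc_polynomial P A hA]
  exact cfc_congr fun x hx => (h x hx).symm

theorem aeval_intertwine {Y : Matrix p p ℂ} {Z : Matrix q q ℂ} {W : Matrix p q ℂ}
    (h : Y * W = W * Z) (P : ℝ[X]) : aeval Y P * W = W * aeval Z P := by
  induction P using Polynomial.induction_on' with
  | add P Q hP hQ => simp [Matrix.add_mul, Matrix.mul_add, hP, hQ]
  | monomial k a =>
    have hk : ∀ k : ℕ, Y ^ k * W = W * Z ^ k := by
      intro k
      induction k with
      | zero => simp
      | succ k ih => rw [pow_succ, pow_succ, Matrix.mul_assoc, h, ← Matrix.mul_assoc, ih,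
          Matrix.mul_assoc]
    rw [← Polynomial.smul_X_eq_monomial]
    simp [hk]

/-- The functional calculus respects operators that intertwine two hermitian matrices. -/
theorem cfc_intertwine {Y : Matrix p p ℂ} {Z : Matrix q q ℂ} {W : Matrix p q ℂ}
    (hY : Y.IsHermitian) (hZ : Z.IsHermitian) (h : Y * W = W * Z) (f : ℝ → ℝ) :
    cfc f Y * W = W * cfc f Z := by
  -- A single polynomial interpolates `f` on both spectra, so the polynomial case applies to both
  -- sides at once.
  obtain ⟨P, hP⟩ := exists_polynomial_eval_eq f
    ((Matrix.finite_real_spectrum (A := Y)).toFinset ∪ (Matrix.finite_real_spectrum (A := Z)).toFinset)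
  rw [cfc_eq_aeval hY (P := P) fun x hx => hP x (by simp [hx]),
    cfc_eq_aeval hZ (P := P) fun x hx => hP x (by simp [hx])]
  exact aeval_intertwine h P

theorem isHermitian_diagonal_ofReal {ι : Type*} [DecidableEq ι] (d : ι → ℝ) :
    (diagonal fun i => (d i : ℂ)).IsHermitian := by
  rw [Matrix.IsHermitian, diagonal_conjTranspose]
  congr 1
  ext i
  simp

theorem cfc_real_smul_one (f : ℝ → ℝ) (r : ℝ) :
    cfc f ((r : ℂ) • (1 : Matrix p p ℂ)) = (f r : ℂ) • (1 : Matrix p p ℂ) := by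
  have h := cfc_algebraMap (A := Matrix p p ℂ) r f
  have e : ∀ r : ℝ, algebraMap ℝ (Matrix p p ℂ) r = (r : ℂ) • 1 := by
    intro r
    rw [Algebra.algebraMap_eq_smul_one]
    ext i j
    simp
  rwa [e, e] at h

/-- The `j`-th basis vector, as a one-column matrix, intertwines the diagonal matrix with the scalar
`d j`; `cfc_intertwine` then gives the result column by column. -/
theorem cfc_diagonal (f : ℝ → ℝ) (d : p → ℝ) :
    cfc f (diagonal fun i => (d i : ℂ)) = diagonal fun i => (f (d i) : ℂ) := by
  ext i j
  have h := cfc_intertwine (q := Unit) (Y := diagonal fun i => (d i : ℂ)) (Z := (d j : ℂ) • 1)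
    (W := replicateCol Unit (Pi.single j 1)) (isHermitian_diagonal_ofReal d) ?_ ?_ f
  · rw [cfc_real_smul_one] at h
    have h' := congrFun (congrFun h i) ()
    simp only [Matrix.mul_apply, replicateCol_apply, Pi.single_apply] at h'
    simp only [mul_ite, mul_one, mul_zero, Finset.sum_ite_eq', Finset.mem_univ, ite_true] at h'
    rw [h']
    by_cases hij : i = j
    · subst hij; simp
    · simp [hij]
  · have := isHermitian_diagonal_ofReal (fun _ : Unit => d j)
    convert this using 1
    ext; simp
  · ext i u
    simp only [Matrix.mul_apply, replicateCol_apply, Pi.single_apply, diagonal_apply]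
    by_cases hij : i = j
    · subst hij; simp
    · simp [hij]

theorem isHermitian_cfc (f : ℝ → ℝ) (A : Matrix p p ℂ) : (cfc f A).IsHermitian :=
  cfc_predicate f A

theorem spectrum_pos {A : Matrix p p ℂ} (hA : A.PosDef) {x : ℝ} (hx : x ∈ spectrum ℝ A) : 0 < x := by
  rw [hA.isHermitian.spectrum_real_eq_range_eigenvalues] at hx
  obtain ⟨i, rfl⟩ := hx
  exact hA.eigenvalues_pos i

/-- Operator convexity holds for matrices with an arbitrary finite index type. -/
theorem OperatorConvex.of_fintype {f : ℝ → ℝ} (hf : OperatorConvex f) {A B : Matrix p p ℂ}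
    (hA : A.PosDef) (hB : B.PosDef) {t : ℝ} (h0 : 0 ≤ t) (h1 : t ≤ 1) :
    (((1 - t) • cfc f A + t • cfc f B) - cfc f ((1 - t) • A + t • B)).PosSemidef := by
  let e : p ≃ Fin (Fintype.card p) := Fintype.equivFin p
  have key : ∀ M : Matrix p p ℂ, M.IsHermitian →
      cfc f (M.submatrix e.symm e.symm) = (cfc f M).submatrix e.symm e.symm := by
    intro M hM
    -- The intertwiner is the permutation matrix of `e`.
    have h := cfc_intertwine (Y := M.submatrix e.symm e.symm) (Z := M)
      (W := (1 : Matrix p p ℂ).submatrix e.symm id) (hM.submatrix _) hM ?_ f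
    · have h2 := congrArg (fun N => N * (1 : Matrix p p ℂ).submatrix id e.symm) h
      simp only [Matrix.mul_assoc] at h2
      have e1 : (1 : Matrix p p ℂ).submatrix e.symm id * (1 : Matrix p p ℂ).submatrix id e.symm
          = 1 := by
        ext i j
        simp [Matrix.mul_apply, Matrix.one_apply]
      rw [e1, Matrix.mul_one] at h2
      rw [h2]
      ext i j
      simp [Matrix.mul_apply, Matrix.one_apply]
    · ext i j
      simp only [Matrix.mul_apply, Matrix.submatrix_apply, Matrix.one_apply, id]
      rw [Finset.sum_eq_single (e j) (by rintro b - hb; simp [Equiv.symm_apply_eq, hb]) (by simp)]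
      simp
  have h := hf _ (A.submatrix e.symm e.symm) (B.submatrix e.symm e.symm)
    (hA.submatrix e.symm.injective) (hB.submatrix e.symm.injective) t h0 h1
  have e2 : (1 - t) • A.submatrix e.symm e.symm + t • B.submatrix e.symm e.symm
      = ((1 - t) • A + t • B).submatrix e.symm e.symm := rfl
  have hC : ((1 - t) • A + t • B).IsHermitian := by
    have hA := hA.isHermitian
    have hB := hB.isHermitian
    rw [Matrix.IsHermitian] at *
    simp [conjTranspose_smul, hA, hB]
  rw [e2, key _ hA.isHermitian, key _ hB.isHermitian, key _ hC] at h
  exact (Matrix.posSemidef_submatrix_equiv e.symm).1 h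

end FunctionalCalculus

end QIG

namespace QIG

open Matrix Polynomial

/-! ### Positivity, limits and block matrices in the functional calculus -/

section FunctionalCalculusPositivity

variable {p q : Type*} [Fintype p] [DecidableEq p] [Fintype q] [DecidableEq q]

theorem cfc_mul_cfc (f g : ℝ → ℝ) (A : Matrix p p ℂ) :
    cfc f A * cfc g A = cfc (fun x => f x * g x) A :=
  (cfc_mul f g A (continuousOn_spectrum _ _) (continuousOn_spectrum _ _)).symm

theorem cfc_cfc (f g : ℝ → ℝ) {A : Matrix p p ℂ} (hA : A.IsHermitian) :
    cfc g (cfc f A) = cfc (fun x => g (f x)) A :=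
  (cfc_comp' g f A (((Matrix.finite_real_spectrum (A := A)).image f).continuousOn g)
    (continuousOn_spectrum _ _) hA).symm

theorem cfc_sub_cfc (f g : ℝ → ℝ) (A : Matrix p p ℂ) :
    cfc f A - cfc g A = cfc (fun x => f x - g x) A :=
  (cfc_sub f g (a := A) (continuousOn_spectrum _ _) (continuousOn_spectrum _ _)).symm

theorem cfc_id_of_isHermitian {A : Matrix p p ℂ} (hA : A.IsHermitian) :
    cfc (fun x : ℝ => x) A = A :=
  cfc_id' ℝ A hA

theorem cfc_const_mul_of_isHermitian (r : ℝ) {A : Matrix p p ℂ} (hA : A.IsHermitian) :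
    cfc (fun x : ℝ => r * x) A = r • A :=
  cfc_const_mul_id r A hA

theorem cfc_add_const_of_isHermitian (f : ℝ → ℝ) (r : ℝ) {A : Matrix p p ℂ}
    (hA : A.IsHermitian) : cfc (fun x => f x + r) A = cfc f A + (r : ℂ) • 1 := by
  refine (cfc_add_const r f A (continuousOn_spectrum _ _) hA).trans ?_
  rw [Algebra.algebraMap_eq_smul_one]
  congr 1

theorem cfc_one_of_isHermitian {A : Matrix p p ℂ} (hA : A.IsHermitian) :
    cfc (fun _ : ℝ => 1) A = 1 :=
  cfc_const_one ℝ A hA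

theorem exists_eq_conjTranspose_mul_self {A : Matrix p p ℂ} (hA : A.PosSemidef) :
    ∃ R : Matrix p p ℂ, A = Rᴴ * R := by
  refine ⟨cfc (fun x => √x) A, ?_⟩
  rw [(isHermitian_cfc _ A).eq, cfc_mul_cfc]
  conv_lhs => rw [← cfc_id_of_isHermitian hA.1]
  refine cfc_congr fun x hx => (Real.mul_self_sqrt ?_).symm
  rw [hA.1.spectrum_real_eq_range_eigenvalues] at hx
  obtain ⟨i, rfl⟩ := hx
  exact hA.eigenvalues_nonneg i

theorem posSemidef_cfc {f : ℝ → ℝ} {A : Matrix p p ℂ} (h : ∀ x ∈ spectrum ℝ A, 0 ≤ f x) :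
    (cfc f A).PosSemidef := by
  have : cfc f A = (cfc (fun x => √(f x)) A)ᴴ * cfc (fun x => √(f x)) A := by
    rw [(isHermitian_cfc _ A).eq, cfc_mul_cfc]
    exact cfc_congr fun x hx => (Real.mul_self_sqrt (h x hx)).symm
  rw [this]
  exact posSemidef_conjTranspose_mul_self _

theorem posDef_cfc {f : ℝ → ℝ} {A : Matrix p p ℂ} (hA : A.IsHermitian)
    (h : ∀ x ∈ spectrum ℝ A, 0 < f x) : (cfc f A).PosDef := by
  have : cfc f A = (cfc (fun x => √(f x)) A)ᴴ * cfc (fun x => √(f x)) A := by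
    rw [(isHermitian_cfc _ A).eq, cfc_mul_cfc]
    exact cfc_congr fun x hx => (Real.mul_self_sqrt (h x hx).le).symm
  rw [this]
  refine PosDef.conjTranspose_mul_self _ ?_
  have hinv : cfc (fun x => (√(f x))⁻¹) A * cfc (fun x => √(f x)) A = 1 := by
    rw [cfc_mul_cfc, ← cfc_one_of_isHermitian hA]
    exact cfc_congr fun x hx => inv_mul_cancel₀ (Real.sqrt_pos.2 (h x hx)).ne'
  intro v w hvw
  have := congrArg (cfc (fun x => (√(f x))⁻¹) A *ᵥ ·) hvw
  simpa [Matrix.mulVec_mulVec, hinv] using this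

/-- The spectral projections on the right do not depend on `f`. Hence pointwise convergence on the
spectrum already gives convergence of the functional calculus. -/
theorem cfc_eq_sum (f : ℝ → ℝ) (A : Matrix p p ℂ) :
    cfc f A = ∑ r ∈ (Matrix.finite_real_spectrum (A := A)).toFinset,
      f r • cfc (Pi.single r 1 : ℝ → ℝ) A := by
  have h1 : ∀ r : ℝ, f r • cfc (Pi.single r 1 : ℝ → ℝ) A
      = cfc (fun x => f r * (Pi.single r 1 : ℝ → ℝ) x) A := fun r =>
    (cfc_const_mul (f r) _ A (continuousOn_spectrum _ _)).symm
  simp only [h1]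
  rw [← cfc_sum _ _ _ fun _ _ => continuousOn_spectrum _ _]
  refine cfc_congr fun x hx => ?_
  simp only [Finset.sum_apply, Pi.single_apply, mul_ite, mul_one, mul_zero]
  rw [Finset.sum_ite_eq]
  simp [hx]

theorem tendsto_cfc_of_forall_tendsto {ι : Type*} {l : Filter ι} {F : ι → ℝ → ℝ} {f : ℝ → ℝ}
    {A : Matrix p p ℂ} (h : ∀ x ∈ spectrum ℝ A, Filter.Tendsto (fun i => F i x) l (nhds (f x))) :
    Filter.Tendsto (fun i => cfc (F i) A) l (nhds (cfc f A)) := by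
  rw [cfc_eq_sum f A, show (fun i => cfc (F i) A) = _ from funext fun i => cfc_eq_sum (F i) A]
  refine tendsto_finsetSum _ fun r hr => ?_
  exact (h r (by simpa using hr)).smul_const _

theorem posSemidef_of_tendsto {ι : Type*} {l : Filter ι} [l.NeBot] {M : ι → Matrix p p ℂ}
    {N : Matrix p p ℂ} (hN : N.IsHermitian) (h : Filter.Tendsto M l (nhds N))
    (hM : ∀ᶠ i in l, (M i).PosSemidef) : N.PosSemidef := by
  refine PosSemidef.of_dotProduct_mulVec_nonneg hN fun x => ?_
  have hc : Continuous fun A : Matrix p p ℂ => star x ⬝ᵥ A *ᵥ x := by fun_prop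
  refine ge_of_tendsto ((hc.tendsto N).comp h) ?_
  filter_upwards [hM] with i hi
  exact hi.dotProduct_mulVec_nonneg x

theorem isHermitian_fromBlocks_zero {A : Matrix p p ℂ} {D : Matrix q q ℂ} (hA : A.IsHermitian)
    (hD : D.IsHermitian) : (fromBlocks A 0 0 D).IsHermitian := by
  rw [Matrix.IsHermitian, fromBlocks_conjTranspose]
  simp [hA.eq, hD.eq]

/-- The two coordinate inclusions intertwine the block matrix with its blocks, and together they
form the identity matrix. -/
theorem cfc_fromBlocks_zero (f : ℝ → ℝ) {A : Matrix p p ℂ} {D : Matrix q q ℂ}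
    (hA : A.IsHermitian) (hD : D.IsHermitian) :
    cfc f (fromBlocks A 0 0 D) = fromBlocks (cfc f A) 0 0 (cfc f D) := by
  have h1 := cfc_intertwine (isHermitian_fromBlocks_zero hA hD) hA
    (W := fromRows 1 0) (by rw [fromBlocks_mul_fromRows, fromRows_mul]; simp) f
  have h2 := cfc_intertwine (isHermitian_fromBlocks_zero hA hD) hD
    (W := fromRows 0 1) (by rw [fromBlocks_mul_fromRows, fromRows_mul]; simp) f
  rw [fromRows_mul] at h1 h2
  simp only [Matrix.one_mul, Matrix.zero_mul] at h1 h2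
  have e : fromCols (fromRows 1 0 : Matrix (p ⊕ q) p ℂ) (fromRows 0 1 : Matrix (p ⊕ q) q ℂ) = 1 := by
    rw [← fromBlocks_one]
    ext (i | i) (j | j) <;> rfl
  calc cfc f (fromBlocks A 0 0 D)
      = cfc f (fromBlocks A 0 0 D) * fromCols (fromRows 1 0) (fromRows 0 1) := by
        rw [e, Matrix.mul_one]
    _ = fromCols (fromRows (cfc f A) 0) (fromRows 0 (cfc f D)) := by
        rw [mul_fromCols, h1, h2]
    _ = _ := by ext (i | i) (j | j) <;> rfl

theorem posDef_fromBlocks_zero {A : Matrix p p ℂ} {D : Matrix q q ℂ}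
    (hA : A.PosDef) (hD : D.PosDef) : (fromBlocks A 0 0 D).PosDef := by
  refine PosDef.of_dotProduct_mulVec_pos (isHermitian_fromBlocks_zero hA.1 hD.1) fun x hx => ?_
  have e : star x ⬝ᵥ fromBlocks A 0 0 D *ᵥ x
      = star (x ∘ Sum.inl) ⬝ᵥ A *ᵥ (x ∘ Sum.inl) + star (x ∘ Sum.inr) ⬝ᵥ D *ᵥ (x ∘ Sum.inr) := by
    rw [fromBlocks_mulVec]
    simp [dotProduct, Fintype.sum_sum_type]
  rw [e]
  by_cases h1 : x ∘ Sum.inl = 0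
  · have h2 : x ∘ Sum.inr ≠ 0 := by
      intro h2
      apply hx
      ext (i | i)
      · exact congrFun h1 i
      · exact congrFun h2 i
    exact add_pos_of_nonneg_of_pos (hA.posSemidef.dotProduct_mulVec_nonneg _)
      (hD.dotProduct_mulVec_pos h2)
  · exact add_pos_of_pos_of_nonneg (hA.dotProduct_mulVec_pos h1)
      (hD.posSemidef.dotProduct_mulVec_nonneg _)

end FunctionalCalculusPositivity

/-! ### Jensen's operator inequality -/

section OperatorConvexity

variable {p q : Type*} [Fintype p] [DecidableEq p] [Fintype q] [DecidableEq q]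

/-- Jensen's operator inequality for compressions. -/
theorem OperatorConvex.compression {f : ℝ → ℝ} (hf : OperatorConvex f) {X : Matrix p p ℂ}
    (hX : X.PosDef) {W : Matrix p q ℂ} (hW : Wᴴ * W = 1) :
    (Wᴴ * cfc f X * W - cfc f (Wᴴ * X * W)).PosSemidef := by
  -- `S` is the reflection fixing the range of the isometry `W`. The average of `X` and `S X S` is
  -- block diagonal for that range, so midpoint convexity, compressed by `W`, is the claim.
  set S : Matrix p p ℂ := (2 : ℂ) • (W * Wᴴ) - 1 with hS
  have hSH : Sᴴ = S := by
    simp [hS, conjTranspose_sub, conjTranspose_smul, conjTranspose_mul]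
  have hSW : S * W = W := by
    rw [hS, Matrix.sub_mul, Matrix.smul_mul, Matrix.mul_assoc, hW, two_smul]
    simp
  have hWS : Wᴴ * S = Wᴴ := by
    rw [← hSH, ← conjTranspose_mul, hSW]
  have hSS : S * S = 1 := by
    have : S * (W * Wᴴ) = W * Wᴴ := by rw [← Matrix.mul_assoc, hSW]
    nth_rewrite 2 [hS]
    rw [Matrix.mul_sub, Matrix.mul_smul, this, Matrix.mul_one, hS]
    abel
  have hB : (S * X * S).PosDef := by
    have := hX.conjTranspose_mul_mul_same (B := S) fun v w hvw => by
      have := congrArg (S *ᵥ ·) hvw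
      simpa [Matrix.mulVec_mulVec, hSS] using this
    rwa [hSH] at this
  have hcB : cfc f (S * X * S) = S * cfc f X * S := by
    have h := cfc_intertwine hB.1 hX.1 (W := S) (by rw [Matrix.mul_assoc, hSS, Matrix.mul_one]) f
    calc cfc f (S * X * S) = cfc f (S * X * S) * S * S := by
          rw [Matrix.mul_assoc (cfc f _), hSS, Matrix.mul_one]
      _ = _ := by rw [h]
  have h := hf.of_fintype hX hB (t := 1 / 2) (by norm_num) (by norm_num)
  set Y := (1 - (1 / 2 : ℝ)) • X + (1 / 2 : ℝ) • (S * X * S) with hY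
  have hYH : Y.IsHermitian := by
    have h1 := hX.1
    have h2 := hB.1
    rw [Matrix.IsHermitian] at *
    rw [hY, conjTranspose_add, conjTranspose_smul, conjTranspose_smul, h1, h2]
    simp
  have hhalf : ∀ M : Matrix p p ℂ, (1 - (1 / 2 : ℝ)) • M + (1 / 2 : ℝ) • M = M := by
    intro M
    rw [← add_smul]
    norm_num
  have hYW : Y * W = W * (Wᴴ * X * W) := by
    have e : X * W + S * (X * W) = (2 : ℝ) • (W * (Wᴴ * X * W)) := by
      rw [hS, Matrix.sub_mul, Matrix.smul_mul]
      simp only [Matrix.one_mul, Matrix.mul_assoc]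
      rw [add_sub_cancel]
      ext i j
      simp
    rw [hY, Matrix.add_mul, Matrix.smul_mul, Matrix.smul_mul, Matrix.mul_assoc (S * X), hSW,
      Matrix.mul_assoc S]
    rw [show (1 - (1 / 2 : ℝ)) = 1 / 2 by norm_num, ← smul_add, e, smul_smul]
    norm_num
  have hcY := cfc_intertwine hYH (isHermitian_conjTranspose_mul_mul W hX.1) hYW f
  have h' := h.conjTranspose_mul_mul_same W
  have e : Wᴴ * ((1 - (1 / 2 : ℝ)) • cfc f X + (1 / 2 : ℝ) • cfc f (S * X * S) - cfc f Y) * W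
      = Wᴴ * cfc f X * W - cfc f (Wᴴ * X * W) := by
    rw [Matrix.mul_sub, Matrix.sub_mul, Matrix.mul_assoc _ (cfc f Y), hcY, ← Matrix.mul_assoc Wᴴ W,
      hW, Matrix.one_mul, hcB]
    congr 1
    rw [Matrix.mul_add, Matrix.add_mul, Matrix.mul_smul, Matrix.mul_smul, Matrix.smul_mul,
      Matrix.smul_mul]
    have : Wᴴ * (S * cfc f X * S) * W = Wᴴ * cfc f X * W := by
      rw [Matrix.mul_assoc, Matrix.mul_assoc (S * _), hSW, ← Matrix.mul_assoc, ← Matrix.mul_assoc,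
        hWS]
    rw [this, ← add_smul]
    norm_num
  rwa [e] at h'

end OperatorConvexity

end QIG

namespace QIG

open Matrix Polynomial

/-! ### Slopes of operator convex functions are operator monotone, hence operator concave -/

section OperatorMonotonicity

variable {p q : Type*} [Fintype p] [DecidableEq p] [Fintype q] [DecidableEq q]

/-- Operator monotonicity of `F` on `(0, ∞)`. -/
def OperatorMonotone (F : ℝ → ℝ) : Prop :=
  ∀ (p : Type) [Fintype p] [DecidableEq p] (A B : Matrix p p ℂ), A.PosDef → B.PosDef →
    (B - A).PosSemidef → (cfc F B - cfc F A).PosSemidef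

/-- Both matrices are Schur complements of the block matrix with identities on the diagonal and `L`,
`Lᴴ` off it. -/
theorem posSemidef_one_sub_mul_conjTranspose {L : Matrix p p ℂ} (h : (1 - Lᴴ * L).PosSemidef) :
    (1 - L * Lᴴ).PosSemidef := by
  let : Invertible (1 : Matrix p p ℂ) := invertibleOne
  have h1 := PosDef.fromBlocks₁₁ (A := (1 : Matrix p p ℂ)) L (1 : Matrix p p ℂ) PosDef.one
  have h2 := PosDef.fromBlocks₂₂ (1 : Matrix p p ℂ) L (D := (1 : Matrix p p ℂ)) PosDef.one
  simp only [inv_one, Matrix.mul_one] at h1 h2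
  exact h2.1 (h1.2 h)

/-- The divided difference `(f(t + c) - f(c)) / t` of an operator convex function is operator
monotone. -/
theorem OperatorConvex.operatorMonotone_slope {f : ℝ → ℝ} (hf : OperatorConvex f) {c : ℝ}
    (hc : 0 < c) : OperatorMonotone fun t => (f (t + c) - f c) / t := by
  intro p _ _ A B hA hB hAB
  have hsA : ∀ x ∈ spectrum ℝ A, 0 < x := fun x hx => spectrum_pos hA hx
  have hsB : ∀ x ∈ spectrum ℝ B, 0 < x := fun x hx => spectrum_pos hB hx
  set sa := cfc (fun x => √x) A with hsa
  set ra := cfc (fun x => (√x)⁻¹) A with hra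
  set rb := cfc (fun x => (√x)⁻¹) B with hrb
  have saH : saᴴ = sa := isHermitian_cfc _ A
  have raH : raᴴ = ra := isHermitian_cfc _ A
  have rbH : rbᴴ = rb := isHermitian_cfc _ B
  have hsasa : sa * sa = A := by
    rw [hsa, cfc_mul_cfc]
    conv_rhs => rw [← cfc_id_of_isHermitian hA.1]
    exact cfc_congr fun x hx => Real.mul_self_sqrt (hsA x hx).le
  have hrasa : ra * sa = 1 := by
    rw [hsa, hra, cfc_mul_cfc, ← cfc_one_of_isHermitian hA.1]
    exact cfc_congr fun x hx => inv_mul_cancel₀ (Real.sqrt_pos.2 (hsA x hx)).ne'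
  have hrBr : rb * B * rb = 1 := by
    nth_rewrite 1 [← cfc_id_of_isHermitian hB.1]
    rw [hrb, cfc_mul_cfc, cfc_mul_cfc, ← cfc_one_of_isHermitian hB.1]
    refine cfc_congr fun x hx => ?_
    have h0 := (Real.sqrt_pos.2 (hsB x hx)).ne'
    have h1 := Real.mul_self_sqrt (hsB x hx).le
    field_simp
    rw [pow_two, h1]
  -- `K = B^{-1/2} A^{1/2}` satisfies `Kᴴ B K = A` and is a contraction because `A ≤ B`; `R` below
  -- completes it to an isometry `(K, R)`.
  set K := rb * sa with hK
  have hKH : Kᴴ = sa * rb := by rw [hK, conjTranspose_mul, saH, rbH]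
  have hKBK : Kᴴ * B * K = A := by
    rw [hKH, hK, ← hsasa]
    calc sa * rb * B * (rb * sa) = sa * (rb * B * rb) * sa := by simp only [Matrix.mul_assoc]
      _ = _ := by rw [hrBr, Matrix.mul_one]
  have hcontr : (1 - Kᴴ * K).PosSemidef := by
    have h1 : (1 - (Kᴴ)ᴴ * Kᴴ).PosSemidef := by
      have h := hAB.conjTranspose_mul_mul_same rb
      have e : rbᴴ * (B - A) * rb = 1 - (Kᴴ)ᴴ * Kᴴ := by
        rw [rbH, Matrix.mul_sub, Matrix.sub_mul, hrBr, conjTranspose_conjTranspose, hKH, hK,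
          ← hsasa]
        simp only [Matrix.mul_assoc]
      rwa [e] at h
    simpa using posSemidef_one_sub_mul_conjTranspose h1
  obtain ⟨R, hR⟩ := exists_eq_conjTranspose_mul_self hcontr
  have hsum : Kᴴ * K + Rᴴ * R = 1 := by rw [← hR]; abel
  let Bc := cfc (fun t => t + c) B
  let Ac := cfc (fun t => t + c) A
  have hBc : Bc.PosDef := posDef_cfc hB.1 fun x hx => add_pos (hsB x hx) hc
  have e1 : ∀ M : Matrix p p ℂ, M.IsHermitian → cfc (fun t => t + c) M = M + (c : ℂ) • 1 := by
    intro M hM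
    rw [cfc_add_const_of_isHermitian (fun t => t) c hM, cfc_id_of_isHermitian hM]
  have hz : ∀ z : ℂ, Kᴴ * (z • 1) * K + Rᴴ * (z • 1) * R = z • 1 := by
    intro z
    simp only [Matrix.mul_smul, Matrix.smul_mul, Matrix.mul_one, ← smul_add, hsum]
  have hcD : ((c : ℂ) • (1 : Matrix p p ℂ)).PosDef := PosDef.one.smul (by exact_mod_cast hc)
  -- The isometry compresses `(B + c) ⊕ c` to `A + c`, so Jensen gives `f(A + c) - f(c) ≤ Kᴴ (f(B +
  -- c) - f(c)) K`. Conjugation by `A^{-1/2}` then turns `K` into `B^{-1/2}`.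
  have hcomp := hf.compression (posDef_fromBlocks_zero hBc hcD) (W := fromRows K R) (by
    rw [conjTranspose_fromRows_eq_fromCols_conjTranspose, fromCols_mul_fromRows, hsum])
  have hW : ∀ P Q : Matrix p p ℂ, (fromRows K R)ᴴ * fromBlocks P 0 0 Q * fromRows K R
      = Kᴴ * P * K + Rᴴ * Q * R := by
    intro P Q
    rw [conjTranspose_fromRows_eq_fromCols_conjTranspose, fromCols_mul_fromBlocks,
      fromCols_mul_fromRows]
    simp
  rw [cfc_fromBlocks_zero f hBc.1 hcD.1, hW, hW, cfc_real_smul_one] at hcomp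
  have eA : Kᴴ * Bc * K + Rᴴ * ((c : ℂ) • 1) * R = Ac := by
    rw [show Bc = B + (c : ℂ) • 1 from e1 B hB.1, show Ac = A + (c : ℂ) • 1 from e1 A hA.1,
      Matrix.mul_add, Matrix.add_mul, hKBK, add_assoc, hz]
  have ef : Kᴴ * cfc f Bc * K + Rᴴ * ((f c : ℂ) • 1) * R - cfc f Ac
      = Kᴴ * cfc (fun t => f (t + c) - f c) B * K - cfc (fun t => f (t + c) - f c) A := by
    have e2 : ∀ M : Matrix p p ℂ, M.IsHermitian → cfc (fun t => f (t + c) - f c) M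
        = cfc f (cfc (fun t => t + c) M) - (f c : ℂ) • 1 := by
      intro M hM
      have h := cfc_add_const_of_isHermitian (fun t => f (t + c)) (-f c) hM
      rw [cfc_cfc _ _ hM]
      simpa [sub_eq_add_neg] using h
    rw [e2 A hA.1, e2 B hB.1]
    rw [Matrix.mul_sub, Matrix.sub_mul]
    have h := hz (f c)
    rw [← eq_sub_iff_add_eq'] at h
    rw [h]
    abel
  rw [eA, ef] at hcomp
  have h := hcomp.conjTranspose_mul_mul_same ra
  have hKra : K * ra = rb := by
    rw [hK, Matrix.mul_assoc]
    have : sa * ra = 1 := by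
      rw [hsa, hra, cfc_mul_cfc, ← cfc_one_of_isHermitian hA.1]
      exact cfc_congr fun x hx => mul_inv_cancel₀ (Real.sqrt_pos.2 (hsA x hx)).ne'
    rw [this, Matrix.mul_one]
  have hsand : ∀ M : Matrix p p ℂ, M.PosDef → cfc (fun x => (√x)⁻¹) M
      * cfc (fun t => f (t + c) - f c) M * cfc (fun x => (√x)⁻¹) M
      = cfc (fun t => (f (t + c) - f c) / t) M := by
    intro M hM
    rw [cfc_mul_cfc, cfc_mul_cfc]
    refine cfc_congr fun x hx => ?_
    have h0 := (Real.sqrt_pos.2 (spectrum_pos hM hx)).ne'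
    have h1 := Real.mul_self_sqrt (spectrum_pos hM hx).le
    have h2 := (spectrum_pos hM hx).ne'
    field_simp
    rw [pow_two, h1]
  have e3 : raᴴ * (Kᴴ * cfc (fun t => f (t + c) - f c) B * K - cfc (fun t => f (t + c) - f c) A) * ra
      = cfc (fun t => (f (t + c) - f c) / t) B - cfc (fun t => (f (t + c) - f c) / t) A := by
    rw [Matrix.mul_sub, Matrix.sub_mul, ← hsand A hA, ← hsand B hB, raH]
    congr 1
    have : ra * Kᴴ = rb := by
      rw [← raH, ← conjTranspose_mul, hKra, rbH]
    calc ra * (Kᴴ * cfc (fun t => f (t + c) - f c) B * K) * ra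
        = (ra * Kᴴ) * cfc (fun t => f (t + c) - f c) B * (K * ra) := by
          simp only [Matrix.mul_assoc]
      _ = _ := by rw [this, hKra]
  rwa [e3] at h

/-- An operator monotone continuous function on `(0, ∞)` is operator concave. -/
theorem OperatorMonotone.operatorConvex_neg {F : ℝ → ℝ} (hF : OperatorMonotone F)
    (hcont : ContinuousOn F (Set.Ioi 0)) : OperatorConvex fun t => -F t := by
  intro m A B hA hB t h0 h1
  set C := (1 - t) • A + t • B with hC
  have hCP : C.PosDef := by
    rcases h0.eq_or_lt with rfl | h0
    · simpa [hC] using hA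
    · refine PosDef.posSemidef_add (hA.posSemidef.smul (by linarith)) (hB.smul h0)
  set W : Matrix (Fin m ⊕ Fin m) (Fin m) ℂ :=
    fromRows ((√(1 - t) : ℂ) • 1) ((√t : ℂ) • 1) with hWdef
  have hWH : Wᴴ = fromCols ((√(1 - t) : ℂ) • 1) ((√t : ℂ) • 1) := by
    rw [hWdef, conjTranspose_fromRows_eq_fromCols_conjTranspose]
    simp [conjTranspose_smul]
  have hWB : ∀ P Q : Matrix (Fin m) (Fin m) ℂ,
      Wᴴ * fromBlocks P 0 0 Q * W = (1 - t) • P + t • Q := by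
    intro P Q
    rw [hWH, hWdef, fromCols_mul_fromBlocks, fromCols_mul_fromRows]
    simp only [Matrix.mul_zero, add_zero, zero_add, Matrix.smul_mul, Matrix.mul_smul,
      Matrix.one_mul, Matrix.mul_one, smul_smul]
    rw [← Complex.ofReal_mul, ← Complex.ofReal_mul, Real.mul_self_sqrt (by linarith),
      Real.mul_self_sqrt h0]
    rfl
  have hWW : Wᴴ * W = 1 := by
    have := hWB 1 1
    rw [fromBlocks_one, Matrix.mul_one, ← add_smul] at this
    rw [this]
    norm_num
  set X := fromBlocks A 0 0 B with hX
  have hXP : X.PosDef := posDef_fromBlocks_zero hA hB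
  set P := W * Wᴴ with hP
  have hPW : P * W = W := by rw [hP, Matrix.mul_assoc, hWW, Matrix.mul_one]
  have hWP : Wᴴ * P = Wᴴ := by rw [hP, ← Matrix.mul_assoc, hWW, Matrix.one_mul]
  have hPH : Pᴴ = P := by rw [hP, conjTranspose_mul, conjTranspose_conjTranspose]
  set Q := 1 - P with hQ
  have hQH : Qᴴ = Q := by rw [hQ, conjTranspose_sub, hPH, conjTranspose_one]
  have hQW : Q * W = 0 := by rw [hQ, Matrix.sub_mul, hPW, Matrix.one_mul, sub_self]
  have key : ∀ d : ℝ, 0 < d →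
      (cfc F ((1 + d ^ 2) • C) - ((1 - t) • cfc F A + t • cfc F B)).PosSemidef := by
    intro d hd
    -- The coefficients `d` and `-d⁻¹` make the off-diagonal blocks of `M X M` cancel those of `X`,
    -- so that `X + M X M` maps the range of `W` to itself and acts there as `(1 + d²) C`. It
    -- dominates `X`, and monotonicity compressed by `W` gives `key`.
    set M := (d : ℂ) • P - ((d⁻¹ : ℝ) : ℂ) • Q with hM
    have hMH : Mᴴ = M := by
      simp [hM, conjTranspose_sub, conjTranspose_smul, hPH, hQH]
    have hMW : M * W = (d : ℂ) • W := by
      rw [hM, Matrix.sub_mul, Matrix.smul_mul, Matrix.smul_mul, hPW, hQW, smul_zero, sub_zero]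
    have hMXM : (M * X * M).PosSemidef := by
      have := hXP.posSemidef.conjTranspose_mul_mul_same M
      rwa [hMH] at this
    have hPM : P * X * W + Q * X * W = X * W := by
      rw [← Matrix.add_mul, ← Matrix.add_mul, hQ, add_sub_cancel, Matrix.one_mul]
    have hYW : (X + M * X * M) * W = W * ((1 + d ^ 2) • C) := by
      have hd' : (d : ℂ) * ((d⁻¹ : ℝ) : ℂ) = 1 := by
        rw [← Complex.ofReal_mul, mul_inv_cancel₀ hd.ne', Complex.ofReal_one]
      have e1 : (X + M * X * M) * W = (P * X * W + Q * X * W) + (d : ℂ) • (M * X * W) := by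
        rw [hPM, Matrix.add_mul, Matrix.mul_assoc (M * X), hMW, Matrix.mul_smul]
      have e2 : (d : ℂ) • (M * X * W) = ((d ^ 2 : ℝ) : ℂ) • (P * X * W) - Q * X * W := by
        rw [hM, Matrix.sub_mul, Matrix.sub_mul, smul_sub]
        simp only [Matrix.smul_mul, smul_smul, hd', one_smul]
        push_cast
        rw [pow_two]
      have e3 : P * X * W = W * C := by
        rw [hP, Matrix.mul_assoc, Matrix.mul_assoc, ← Matrix.mul_assoc Wᴴ, hX, hWB]
      rw [e1, e2, e3, Matrix.mul_smul, add_smul, one_smul]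
      rw [show ((d ^ 2 : ℝ) : ℂ) • (W * C) = (d ^ 2) • (W * C) from rfl]
      abel
    have hYP : (X + M * X * M).PosDef := hXP.add_posSemidef hMXM
    have hmono := hF _ X (X + M * X * M) hXP hYP (by simpa using hMXM)
    have h := hmono.conjTranspose_mul_mul_same W
    have hdC : ((1 + d ^ 2) • C).IsHermitian := (hCP.smul (by positivity)).1
    rw [Matrix.mul_sub, Matrix.sub_mul, Matrix.mul_assoc, cfc_intertwine hYP.1 hdC hYW,
      ← Matrix.mul_assoc, hWW, Matrix.one_mul, hX, cfc_fromBlocks_zero F hA.1 hB.1, hWB] at h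
    exact h
  have hneg : ∀ N : Matrix (Fin m) (Fin m) ℂ, cfc (fun t => -F t) N = -cfc F N :=
    fun N => cfc_neg F N
  have goal_eq : (1 - t) • cfc (fun t => -F t) A + t • cfc (fun t => -F t) B
      - cfc (fun t => -F t) C = cfc F C - ((1 - t) • cfc F A + t • cfc F B) := by
    rw [hneg, hneg, hneg, smul_neg, smul_neg]
    abel
  rw [goal_eq]
  have hscale : ∀ d : ℝ, cfc F ((1 + d ^ 2) • C) = cfc (fun x => F ((1 + d ^ 2) * x)) C := by
    intro d
    rw [← cfc_const_mul_of_isHermitian _ hCP.1, cfc_cfc _ _ hCP.1]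
  have hherm : ∀ N : Matrix (Fin m) (Fin m) ℂ,
      (cfc F N - ((1 - t) • cfc F A + t • cfc F B)).IsHermitian := by
    intro N
    rw [Matrix.IsHermitian, conjTranspose_sub, conjTranspose_add, conjTranspose_smul,
      conjTranspose_smul, isHermitian_cfc, isHermitian_cfc, isHermitian_cfc]
    simp
  -- Continuity of `F` removes the error factor `1 + d²` as `d` decreases to `0`.
  refine posSemidef_of_tendsto (l := nhdsWithin (0 : ℝ) (Set.Ioi 0))
    (M := fun d => cfc F ((1 + d ^ 2) • C) - ((1 - t) • cfc F A + t • cfc F B)) (hherm C) ?_ ?_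
  · refine Filter.Tendsto.sub_const ?_ _
    simp only [hscale]
    refine tendsto_cfc_of_forall_tendsto fun x hx => ?_
    have hx0 := spectrum_pos hCP hx
    have hc : ContinuousAt F ((1 + (0 : ℝ) ^ 2) * x) :=
      hcont.continuousAt (Ioi_mem_nhds (by simpa using hx0))
    have : ContinuousAt (fun d : ℝ => F ((1 + d ^ 2) * x)) 0 :=
      ContinuousAt.comp (f := fun d : ℝ => (1 + d ^ 2) * x) hc (by fun_prop)
    have h2 := this.tendsto
    simp only [ne_eq, OfNat.ofNat_ne_zero, not_false_eq_true, zero_pow, add_zero, one_mul] at h2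
    exact h2.mono_left nhdsWithin_le_nhds
  · filter_upwards [self_mem_nhdsWithin] with d hd using key d hd

theorem OperatorConvex.convexOn {f : ℝ → ℝ} (hf : OperatorConvex f) :
    ConvexOn ℝ (Set.Ioi 0) f := by
  refine ⟨convex_Ioi 0, fun x hx y hy a b ha hb hab => ?_⟩
  have hP : ∀ r : ℝ, 0 < r → ((r : ℂ) • (1 : Matrix (Fin 1) (Fin 1) ℂ)).PosDef :=
    fun r hr => PosDef.one.smul (by exact_mod_cast hr)
  have h := hf 1 _ _ (hP x hx) (hP y hy) b hb (by linarith)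
  have e : (1 - b) • ((x : ℂ) • (1 : Matrix (Fin 1) (Fin 1) ℂ)) + b • ((y : ℂ) • 1)
      = ((a * x + b * y : ℝ) : ℂ) • 1 := by
    rw [show 1 - b = a by linarith]
    ext i j
    simp [mul_assoc, add_mul]
  rw [e, cfc_real_smul_one, cfc_real_smul_one, cfc_real_smul_one] at h
  have h' := h.diag_nonneg (i := 0)
  rw [show 1 - b = a by linarith] at h'
  simp only [Matrix.sub_apply, Matrix.add_apply, Matrix.smul_apply, Matrix.one_apply_eq,
    smul_eq_mul, mul_one, Complex.real_smul] at h'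
  rw [← Complex.ofReal_mul, ← Complex.ofReal_mul, ← Complex.ofReal_add, ← Complex.ofReal_sub] at h'
  have := Complex.zero_le_real.1 h'
  simp only [smul_eq_mul]
  linarith

theorem OperatorConvex.continuousOn {f : ℝ → ℝ} (hf : OperatorConvex f) :
    ContinuousOn f (Set.Ioi 0) :=
  hf.convexOn.continuousOn isOpen_Ioi

/-- The engine of the induction on finite differences: operator convexity reproduces itself while
one order of differencing is traded for a division by `t`. -/
theorem OperatorConvex.neg_slope {f : ℝ → ℝ} (hf : OperatorConvex f) {c : ℝ} (hc : 0 < c) :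
    OperatorConvex fun t => -((f (t + c) - f c) / t) := by
  refine (hf.operatorMonotone_slope hc).operatorConvex_neg ?_
  refine ContinuousOn.div ?_ continuousOn_id fun x hx => (Set.mem_Ioi.1 hx).ne'
  refine (hf.continuousOn.comp (by fun_prop) fun x hx => ?_).sub continuousOn_const
  exact add_pos (Set.mem_Ioi.1 hx) hc

end OperatorMonotonicity

end QIG

namespace QIG

open Polynomial fwdDiff Filter Topology

/-! ### Alternating differences and Bernstein's power series argument -/

section FiniteDifferences

/-- Discrete Leibniz rule; only two terms survive since the identity has constant first difference.
-/
theorem fwdDiff_iter_id_mul (F : ℝ → ℝ) (h : ℝ) (n : ℕ) (t : ℝ) :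
    Δ_[h] ^[n + 1] (fun s => s * F s) t
      = t * Δ_[h] ^[n + 1] F t + (n + 1) * h * Δ_[h] ^[n] F (t + h) := by
  induction n generalizing t with
  | zero => simp [fwdDiff]; ring
  | succ n ih =>
    rw [Function.iterate_succ_apply', fwdDiff, ih, ih, Function.iterate_succ_apply' _ (n + 1) F]
    have e : Δ_[h] ^[n + 1] F (t + h) = Δ_[h] ^[n] F (t + h + h) - Δ_[h] ^[n] F (t + h) := by
      rw [Function.iterate_succ_apply', fwdDiff]
    rw [fwdDiff, e]
    push_cast
    ring

theorem fwdDiff_iter_neg_step (f : ℝ → ℝ) (h : ℝ) (k : ℕ) (c : ℝ) :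
    Δ_[-h] ^[k] f c = (-1) ^ k * Δ_[h] ^[k] f (c - k * h) := by
  induction k generalizing c with
  | zero => simp
  | succ k ih =>
    rw [Function.iterate_succ_apply', fwdDiff, ih, ih, Function.iterate_succ_apply', fwdDiff]
    have e1 : c + -h - k * h = c - ((k + 1 : ℕ) : ℝ) * h := by push_cast; ring
    have e2 : c - k * h = c - ((k + 1 : ℕ) : ℝ) * h + h := by push_cast; ring
    rw [e1, e2]
    ring

theorem fwdDiff_iter_affine (A B h : ℝ) (k : ℕ) :
    Δ_[h] ^[k + 2] (fun x => A + B * x) = fun _ => 0 := by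
  have h2 : Δ_[h] (Δ_[h] (fun x => A + B * x)) = (0 : ℝ) • (fun _ : ℝ => (0 : ℝ)) := by
    ext x; simp [fwdDiff]; ring
  rw [Function.iterate_add_apply]
  simp only [Function.iterate_succ, Function.iterate_zero, Function.comp_apply, id]
  rw [h2, fwdDiff_iter_const_smul]
  ext x; simp

/-- An operator convex function on `(0, ∞)` has finite differences of alternating signs. -/
theorem OperatorConvex.fwdDiff_nonneg {f : ℝ → ℝ} (hf : OperatorConvex f) (n : ℕ) {y h : ℝ}
    (hy : 0 < y) (hh : 0 < h) : 0 ≤ (-1) ^ n * Δ_[h] ^[n + 2] f y := by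
  induction n generalizing f y with
  | zero =>
    have hc := hf.convexOn.2 hy (show 0 < y + h + h by positivity)
      (by norm_num : (0 : ℝ) ≤ 1 / 2) (by norm_num : (0 : ℝ) ≤ 1 / 2) (by norm_num)
    simp only [smul_eq_mul] at hc
    rw [show 1 / 2 * y + 1 / 2 * (y + h + h) = y + h by ring] at hc
    simp [fwdDiff]
    linarith
  | succ n ih =>
    have h1 := ih (hf.neg_slope hy) hh
    have e : Δ_[h] ^[n + 3] f y = Δ_[h] ^[n + 3] (fun t => f (t + y)) 0 := by
      rw [fwdDiff_iter_comp_add, zero_add]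
    -- This is `f(t + y) = f(y) - t φ(t)` with `φ` operator convex. At `t = 0` the Leibniz rule
    -- leaves only a difference of `φ` based at `h > 0`, so the value of `φ` at `0` plays no role.
    have e2 : (fun t => f (t + y))
        = (fun x => f y + 0 * x) + (-1 : ℝ) • fun t => t * -((f (t + y) - f y) / t) := by
      ext t
      rcases eq_or_ne t 0 with rfl | ht
      · simp
      · simp only [Pi.add_apply, Pi.smul_apply, smul_eq_mul]
        field_simp
        ring
    have e3 := fwdDiff_iter_affine (f y) 0 h (n + 1)
    rw [e, e2, fwdDiff_iter_add, fwdDiff_iter_const_smul, Pi.add_apply, Pi.smul_apply,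
      show n + 3 = (n + 2) + 1 from rfl, fwdDiff_iter_id_mul, show n + 2 + 1 = n + 1 + 2 from rfl,
      e3]
    simp only [zero_mul, zero_add, smul_eq_mul]
    set D := Δ_[h] ^[n + 2] (fun t => -((f (t + y) - f y) / t)) h
    have : (-1 : ℝ) ^ (n + 1) * (-1 * ((((n + 2 : ℕ) : ℝ) + 1) * h * D))
        = (((n + 2 : ℕ) : ℝ) + 1) * h * ((-1) ^ n * D) := by ring
    rw [this]
    positivity

/-- A Bernstein polynomial in powers of `x`: apply the linear functional `X^ν ↦ φ ν` to the two
expansions of `(x X + 1 - x)^N = (x (X - 1) + 1)^N`. It sends `(X - 1)^k` to the `k`-th difference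
of `φ` at `0`. -/
theorem sum_choose_mul_eq_sum_fwdDiff (φ : ℕ → ℝ) (N : ℕ) (x : ℝ) :
    ∑ ν ∈ Finset.range (N + 1), (N.choose ν : ℝ) * x ^ ν * (1 - x) ^ (N - ν) * φ ν
      = ∑ k ∈ Finset.range (N + 1), (N.choose k : ℝ) * Δ_[1] ^[k] φ 0 * x ^ k := by
  let L : ℝ[X] →ₗ[ℝ] ℝ := Polynomial.lsum fun ν => φ ν • LinearMap.id
  have hL : ∀ (a : ℝ) (ν : ℕ), L (C a * X ^ ν) = a * φ ν := by
    intro a ν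
    rw [C_mul_X_pow_eq_monomial]
    simp [L, Polynomial.lsum_apply, Polynomial.sum_monomial_index, mul_comm]
  have hΔ : ∀ k : ℕ, L ((X + C (-1)) ^ k) = Δ_[1] ^[k] φ 0 := by
    intro k
    rw [add_pow, map_sum, fwdDiff_iter_eq_sum_shift]
    refine Finset.sum_congr rfl fun j hj => ?_
    have : (X : ℝ[X]) ^ j * C (-1) ^ (k - j) * (k.choose j : ℝ[X])
        = C ((-1) ^ (k - j) * (k.choose j : ℝ)) * X ^ j := by
      simp only [C_mul, C_pow, map_natCast]
      ring
    rw [this, hL]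
    simp
  have h1 : (C x * X + C (1 - x)) ^ N = (C x * (X + C (-1)) + 1) ^ N := by
    congr 1
    simp only [C_sub, C_neg, C_1]
    ring
  have h2 := congrArg L h1
  rw [add_pow, add_pow, map_sum, map_sum] at h2
  refine Eq.trans (Finset.sum_congr rfl fun ν _ => ?_)
    (h2.trans (Finset.sum_congr rfl fun k _ => ?_))
  · rw [show (C x * X) ^ ν * C (1 - x) ^ (N - ν) * (N.choose ν : ℝ[X])
      = C ((N.choose ν : ℝ) * x ^ ν * (1 - x) ^ (N - ν)) * X ^ ν by
        simp only [C_mul, C_pow, map_natCast]; ring]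
    rw [hL]
  · rw [one_pow, mul_one, mul_pow, show C x ^ k * (X + C (-1)) ^ k * (N.choose k : ℝ[X])
      = (x ^ k * (N.choose k : ℝ)) • (X + C (-1)) ^ k by
        rw [smul_eq_C_mul]; simp only [C_mul, C_pow, map_natCast]; ring]
    rw [map_smul, hΔ, smul_eq_mul]
    ring

/-- A continuous function on `[0, 1]` all of whose finite differences at `0` are nonnegative is
the sum of a power series with nonnegative coefficients. -/
theorem exists_hasSum_of_fwdDiff_nonneg {φ : ℝ → ℝ} (hφ : ContinuousOn φ (Set.Icc 0 1))
    (hd : ∀ N k : ℕ, 0 < N → k ≤ N → 0 ≤ Δ_[(1 / N : ℝ)] ^[k] φ 0) :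
    ∃ a : ℕ → ℝ, (∀ k, 0 ≤ a k ∧ a k ≤ φ 1) ∧
      ∀ x : ℝ, 0 ≤ x → x < 1 → HasSum (fun k => a k * x ^ k) (φ x) := by
  -- The coefficients of the `N`-th Bernstein polynomial. For `N > 0` they are nonnegative with sum
  -- `φ 1`, hence bounded uniformly in `N` and `k`.
  let b : ℕ → ℕ → ℝ := fun N k => (N.choose k : ℝ) * Δ_[(1 / N : ℝ)] ^[k] φ 0
  have hb : ∀ N, 0 < N → ∀ k, 0 ≤ b N k := by
    intro N hN k
    rcases le_or_gt k N with h | h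
    · exact mul_nonneg (Nat.cast_nonneg _) (hd N k hN h)
    · simp [b, Nat.choose_eq_zero_of_lt h]
  let ψ : C(unitInterval, ℝ) := ⟨fun x => φ x, hφ.domRestrict⟩
  have hB : ∀ N : ℕ, ∀ x : unitInterval, bernsteinApproximation N ψ x
      = ∑ k ∈ Finset.range (N + 1), b N k * (x : ℝ) ^ k := by
    intro N x
    have h := sum_choose_mul_eq_sum_fwdDiff (fun ν => φ (ν / N)) N x
    have e : ∀ k, Δ_[1] ^[k] (fun ν : ℕ => φ (ν / N)) 0 = Δ_[(1 / N : ℝ)] ^[k] φ 0 := by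
      intro k
      simp [fwdDiff_iter_eq_sum_shift, div_eq_mul_inv]
    simp only [e] at h
    rw [← h, bernsteinApproximation.apply, Finset.sum_range]
    refine Finset.sum_congr rfl fun k _ => ?_
    rw [bernstein_apply, smul_eq_mul]
    rfl
  have hlim := bernsteinApproximation_uniform ψ
  have hpt : ∀ x : unitInterval, Tendsto (fun N => ∑ k ∈ Finset.range (N + 1), b N k * (x : ℝ) ^ k)
      atTop (𝓝 (φ x)) := by
    intro x
    have := ((continuous_eval_const x : Continuous fun F : C(unitInterval, ℝ) => F x).tendsto ψ).comp hlim
    exact this.congr fun N => hB N x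
  have hsum1 : ∀ N, 0 < N → ∑ k ∈ Finset.range (N + 1), b N k = φ 1 := by
    intro N hN
    have h := hB N 1
    rw [bernsteinApproximation.apply_one hN.ne'] at h
    simp only [one_pow, mul_one, Set.Icc.coe_one] at h
    exact h.symm
  have hzero : ∀ N k, k ∉ Finset.range (N + 1) → b N k = 0 := by
    intro N k hk
    simp [b, Nat.choose_eq_zero_of_lt (by simpa using hk : N < k)]
  have hb1 : ∀ N, 0 < N → ∀ k, b N k ≤ φ 1 := by
    intro N hN k
    by_cases hk : k ∈ Finset.range (N + 1)
    · rw [← hsum1 N hN]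
      exact Finset.single_le_sum (fun i _ => hb N hN i) hk
    · rw [hzero N k hk, ← hsum1 N hN]
      exact Finset.sum_nonneg fun i _ => hb N hN i
  -- An ultrafilter gives limits of all coefficients simultaneously, in place of a diagonal
  -- subsequence; `φ 1 * x ^ k` dominates the series.
  let U : Ultrafilter ℕ := hyperfilter ℕ
  have hU : (U : Filter ℕ) ≤ atTop := by
    rw [← Nat.cofinite_eq_atTop]
    exact hyperfilter_le_cofinite
  have hev : ∀ᶠ N in (U : Filter ℕ), 0 < N := hU (eventually_gt_atTop 0)
  have hex : ∀ k, ∃ a ∈ Set.Icc 0 (φ 1), Tendsto (fun N => b N k) U (𝓝 a) := by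
    intro k
    obtain ⟨a, ha, h⟩ := (isCompact_Icc (a := (0 : ℝ)) (b := φ 1)).ultrafilter_le_nhds
      (U.map fun N => b N k) (by
        rw [le_principal_iff]
        change ∀ᶠ N in (U : Filter ℕ), b N k ∈ Set.Icc 0 (φ 1)
        filter_upwards [hev] with N hN using ⟨hb N hN k, hb1 N hN k⟩)
    exact ⟨a, ha, h⟩
  choose a ha hlim' using hex
  refine ⟨a, ha, fun x hx0 hx1 => ?_⟩
  have hs : Summable fun k : ℕ => φ 1 * x ^ k := (summable_geometric_of_lt_one hx0 hx1).mul_left _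
  have hs' : Summable fun k => a k * x ^ k :=
    Summable.of_nonneg_of_le (fun k => mul_nonneg (ha k).1 (pow_nonneg hx0 k))
      (fun k => mul_le_mul_of_nonneg_right (ha k).2 (pow_nonneg hx0 k)) hs
  have ht := tendsto_tsum_of_dominated_convergence (𝓕 := (U : Filter ℕ))
    (f := fun N k => b N k * x ^ k) (g := fun k => a k * x ^ k) hs
    (fun k => (hlim' k).mul_const _) (by
      filter_upwards [hev] with N hN k
      rw [Real.norm_of_nonneg (mul_nonneg (hb N hN k) (pow_nonneg hx0 k))]
      exact mul_le_mul_of_nonneg_right (hb1 N hN k) (pow_nonneg hx0 k))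
  have ht2 := (hpt ⟨x, hx0, hx1.le⟩).mono_left hU
  have e : ∀ N, ∑' k, b N k * x ^ k = ∑ k ∈ Finset.range (N + 1), b N k * x ^ k := fun N =>
    tsum_eq_sum fun k hk => by rw [hzero N k hk, zero_mul]
  simp only [e] at ht
  rw [← tendsto_nhds_unique ht ht2]
  exact hs'.hasSum

/-- An operator convex function on `(0, ∞)` is given by a power series. -/
theorem OperatorConvex.exists_hasSum {f : ℝ → ℝ} (hf : OperatorConvex f) {ε c : ℝ} (hε : 0 < ε)
    (hc : ε < c) :
    ∃ (b : ℕ → ℝ) (M : ℝ), (∀ k, |b k| * (c - ε) ^ k ≤ M) ∧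
      ∀ t, ε < t → t ≤ c → HasSum (fun k => b k * (c - t) ^ k) (f t) := by
  set δ := c - ε with hδ
  have hδ0 : 0 < δ := sub_pos.2 hc
  have hc0 : 0 < c := hε.trans hc
  set A := |f c|
  set B := |δ * (f (c + 1) - f c)|
  -- Reversing the direction makes the alternating differences nonnegative. The affine term repairs
  -- orders `0` and `1`, whose signs operator convexity does not control: `B` dominates the first
  -- difference because slopes to the left of `c` are at most the slope over `[c, c + 1]`. It is
  -- subtracted from the coefficients at the end.
  set φ : ℝ → ℝ := (fun x => f (c - δ * x)) + fun x => A + B * x with hφ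
  have hdiff : ∀ N k : ℕ, Δ_[(1 / N : ℝ)] ^[k] (fun x => f (c - δ * x)) 0
      = (-1) ^ k * Δ_[δ / N] ^[k] f (c - k * (δ / N)) := by
    intro N k
    rw [← fwdDiff_iter_neg_step]
    simp only [fwdDiff_iter_eq_sum_shift, nsmul_eq_mul]
    refine Finset.sum_congr rfl fun j _ => ?_
    congr 2
    ring
  obtain ⟨a, ha, hs⟩ := exists_hasSum_of_fwdDiff_nonneg (φ := φ) (by
    refine ContinuousOn.add ?_ (by fun_prop)
    refine hf.continuousOn.comp (by fun_prop) fun x hx => ?_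
    simp only [Set.mem_Ioi]
    nlinarith [hx.1, hx.2]) (by
    intro N k hN hk
    have hN' : (0 : ℝ) < N := by exact_mod_cast hN
    have hh : 0 < δ / N := div_pos hδ0 hN'
    have hpos : ∀ j : ℕ, j ≤ N → 0 < c - j * (δ / N) := by
      intro j hj
      have hj' : (j : ℝ) ≤ N := by exact_mod_cast hj
      have : (j : ℝ) * (δ / N) ≤ N * (δ / N) := mul_le_mul_of_nonneg_right hj' hh.le
      rw [mul_div_cancel₀ _ hN'.ne'] at this
      linarith
    rw [hφ, fwdDiff_iter_add, Pi.add_apply, hdiff]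
    match k, hk with
    | 0, _ =>
      simp only [Function.iterate_zero, id]
      simp
      linarith [neg_abs_le (f c)]
    | 1, hk =>
      have h1 := hpos 1 hk
      have hs := hf.convexOn.slope_mono_adjacent (x := c - δ / N) (y := c) (z := c + 1)
        (by simpa using h1) (by simp; linarith) (by linarith) (by linarith)
      rw [sub_sub_cancel, add_sub_cancel_left, div_one, div_le_iff₀ hh] at hs
      have hB := le_abs_self (δ * (f (c + 1) - f c))
      have hB2 := mul_le_mul_of_nonneg_right hB (by positivity : 0 ≤ (N : ℝ)⁻¹)
      simp [fwdDiff]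
      rw [div_eq_mul_inv] at *
      nlinarith
    | k + 2, hk =>
      rw [fwdDiff_iter_affine, add_zero, pow_add, neg_one_sq, mul_one]
      exact hf.fwdDiff_nonneg k (hpos _ hk) hh)
  refine ⟨fun k => (a k - if k = 0 then A else if k = 1 then B else 0) / δ ^ k,
    φ 1 + A + B, fun k => ?_, fun t ht htc => ?_⟩
  · rw [abs_div, abs_of_pos (pow_pos hδ0 k), div_mul_cancel₀ _ (pow_pos hδ0 k).ne']
    have hA : 0 ≤ A := abs_nonneg _
    have hB : 0 ≤ B := abs_nonneg _
    have := ha k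
    split_ifs <;> exact abs_le.2 ⟨by linarith, by linarith⟩
  · have h := hs ((c - t) / δ) (div_nonneg (by linarith) hδ0.le)
      ((div_lt_one hδ0).2 (by linarith))
    have hφt : φ ((c - t) / δ) = f t + (A + B * ((c - t) / δ)) := by
      simp only [hφ, Pi.add_apply]
      rw [mul_div_cancel₀ _ hδ0.ne', sub_sub_cancel]
    have h2 : HasSum (fun k : ℕ => (if k = 0 then A else if k = 1 then B else 0)
        * ((c - t) / δ) ^ k) (A + B * ((c - t) / δ)) := by
      have := hasSum_sum_of_ne_finset_zero (L := SummationFilter.unconditional ℕ) (s := Finset.range 2)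
        (f := fun k : ℕ => (if k = 0 then A else if k = 1 then B else 0) * ((c - t) / δ) ^ k)
        (fun k hk => by
          have : 1 < k := by simpa using hk
          simp [show k ≠ 0 by omega, show k ≠ 1 by omega])
      simpa [Finset.sum_range_succ] using this
    have h3 := h.sub h2
    rw [hφt, add_sub_cancel_right] at h3
    refine h3.congr_fun fun k => ?_
    rw [← sub_mul, div_pow]
    ring

end FiniteDifferences

end QIG

namespace QIG

open Polynomial Filter Topology

/-! ### Analyticity of the functional calculus -/

section Analyticity

open scoped Matrix.Norms.L2Operator

variable {p : Type*} [Fintype p] [DecidableEq p]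

/-- On a neighbourhood of a positive definite matrix, the functional calculus of an operator convex
function on hermitian matrices is the restriction of an analytic map. -/
theorem OperatorConvex.exists_contDiffAt_eq_cfc {f : ℝ → ℝ} (hf : OperatorConvex f)
    {A : Matrix p p ℂ} (hA : A.PosDef) :
    ∃ F : Matrix p p ℂ → Matrix p p ℂ, ContDiffAt ℝ ⊤ F A ∧
      ∀ᶠ N in 𝓝 A, N.IsHermitian → cfc f N = F N := by
  rcases isEmpty_or_nonempty p with hp | hp
  · exact ⟨fun _ => 0, contDiffAt_const, Eventually.of_forall fun N _ => Subsingleton.elim _ _⟩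
  obtain ⟨ε, hε, hεA⟩ : ∃ ε > 0, ∀ x ∈ spectrum ℝ A, ε < x := by
    have hfin := Matrix.finite_real_spectrum (A := A)
    rcases (spectrum ℝ A).eq_empty_or_nonempty with h | h
    · exact ⟨1, one_pos, by simp [h]⟩
    · obtain ⟨m, hm, hmin⟩ := hfin.exists_minimal h
      have := spectrum_pos hA hm
      refine ⟨m / 2, by linarith, fun x hx => ?_⟩
      have hmx : m ≤ x := by
        rcases le_total m x with h | h
        · exact h
        · exact hmin hx h
      linarith
  have hbound : ∀ (N : Matrix p p ℂ) (x : ℝ), x ∈ spectrum ℝ N → |x| ≤ ‖N‖ := fun N x hx =>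
    spectrum.norm_le_norm_of_mem hx
  -- Near `A` all spectra lie in `(ε, c]`, where the series represents `f`, and `c - N` stays in the
  -- ball of radius `c - ε`, where the matrix series converges.
  set c := ‖A‖ + ε + 1 with hc
  have hcε : 0 < c - ε := by have := norm_nonneg A; linarith
  have hAc : ‖(c : ℝ) • (1 : Matrix p p ℂ) - A‖ < c - ε := by
    have h : cfc (fun x : ℝ => c - x) A = (c : ℝ) • (1 : Matrix p p ℂ) - A := by
      rw [← cfc_sub_cfc (fun _ => c) (fun x => x), cfc_id_of_isHermitian hA.1]
      have := cfc_const_mul (R := ℝ) c (fun _ => (1 : ℝ)) A (continuousOn_spectrum _ _)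
      simp only [mul_one] at this
      rw [this, cfc_one_of_isHermitian hA.1]
    rw [← h]
    refine norm_cfc_lt hcε fun x hx => ?_
    have h1 := hεA x hx
    have h2 := (abs_le.1 (hbound A x hx)).2
    rw [Real.norm_eq_abs, abs_lt]
    constructor <;> linarith
  obtain ⟨b, M, hb, hs⟩ := hf.exists_hasSum hε (sub_pos.1 hcε)
  set P := FormalMultilinearSeries.ofScalars (Matrix p p ℂ) b with hP
  have hrad : ENNReal.ofReal (c - ε) ≤ P.radius := by
    refine P.le_radius_of_bound M fun k => ?_
    rw [FormalMultilinearSeries.ofScalars_norm, Real.coe_toNNReal _ hcε.le]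
    exact hb k
  have hPball := P.hasFPowerSeriesOnBall
    (lt_of_lt_of_le (ENNReal.ofReal_pos.2 hcε) hrad)
  have hmem : ∀ N : Matrix p p ℂ, ‖N‖ < c - ε → N ∈ Metric.eball 0 P.radius := by
    intro N hN
    refine Metric.mem_eball.2 (lt_of_lt_of_le ?_ hrad)
    rw [edist_zero_right, ← ofReal_norm]
    exact (ENNReal.ofReal_lt_ofReal_iff hcε).2 hN
  refine ⟨fun N => P.sum ((c : ℝ) • (1 : Matrix p p ℂ) - N), ?_, ?_⟩
  · have h1 := (hPball.analyticAt_of_mem (hmem _ hAc)).contDiffAt (n := ⊤)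
    exact h1.comp A (contDiffAt_const.sub contDiffAt_id)
  · have ho1 : ∀ᶠ N in 𝓝 A, ‖(c : ℝ) • (1 : Matrix p p ℂ) - N‖ < c - ε :=
      (continuous_const.sub continuous_id).norm.continuousAt.eventually_lt continuousAt_const hAc
    have ho2 : ∀ᶠ N : Matrix p p ℂ in 𝓝 A, ‖N‖ < c :=
      continuous_norm.continuousAt.eventually_lt continuousAt_const (by linarith)
    filter_upwards [ho1, ho2] with N h1 h2 hN
    have hspec : ∀ x ∈ spectrum ℝ N, ε < x ∧ x ≤ c := by
      intro x hx
      have hx1 := (abs_le.1 (hbound N x hx)).2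
      have hx2 : c - x ∈ spectrum ℝ ((c : ℝ) • (1 : Matrix p p ℂ) - N) := by
        rw [← Algebra.algebraMap_eq_smul_one]
        have := spectrum.singleton_sub_eq N c
        rw [← this]
        exact Set.sub_mem_sub rfl hx
      have hx3 := (abs_le.1 (hbound _ _ hx2)).2
      constructor <;> linarith
    have hsum := hPball.hasSum (hmem _ h1)
    rw [zero_add] at hsum
    have ht := hsum.tendsto_sum_nat
    have hcfc : Tendsto (fun K => cfc (fun t => ∑ k ∈ Finset.range K, b k * (c - t) ^ k) N) atTop
        (𝓝 (cfc f N)) :=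
      tendsto_cfc_of_forall_tendsto fun x hx =>
        (hs x (hspec x hx).1 (hspec x hx).2).tendsto_sum_nat
    -- The partial sums are polynomials, for which the functional calculus and the matrix series
    -- coincide.
    refine tendsto_nhds_unique hcfc (ht.congr fun K => ?_)
    rw [cfc_eq_aeval hN (P := ∑ k ∈ Finset.range K, C (b k) * (C c - X) ^ k) fun x _ => by
      simp [eval_finsetSum]]
    rw [map_sum]
    refine Finset.sum_congr rfl fun k _ => ?_
    rw [hP, FormalMultilinearSeries.ofScalars_apply_eq]
    simp [Algebra.algebraMap_eq_smul_one]

theorem contDiffAt_matrix {V : Type*} [NormedAddCommGroup V] [NormedSpace ℝ V]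
    {T : V → Matrix p p ℂ} {v : V} {n : WithTop ℕ∞}
    (h : ∀ i j, ContDiffAt ℝ n (fun w => T w i j) v) : ContDiffAt ℝ n T v := by
  have e : T = fun w => ∑ i, ∑ j, T w i j • Matrix.single i j (1 : ℂ) := by
    ext1 w
    conv_lhs => rw [Matrix.matrix_eq_sum_single (T w)]
    simp
  rw [e]
  exact ContDiffAt.sum fun i _ => ContDiffAt.sum fun j _ => (h i j).smul contDiffAt_const

theorem OperatorConvex.contDiffAt_cfc {f : ℝ → ℝ} (hf : OperatorConvex f)
    {V : Type*} [NormedAddCommGroup V] [NormedSpace ℝ V] {T : V → Matrix p p ℂ} {v : V}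
    (hT : ∀ i j, ContDiffAt ℝ ⊤ (fun w => T w i j) v) (hherm : ∀ᶠ w in 𝓝 v, (T w).IsHermitian)
    (hpos : (T v).PosDef) (i j : p) : ContDiffAt ℝ ⊤ (fun w => cfc f (T w) i j) v := by
  obtain ⟨F, hF, he⟩ := hf.exists_contDiffAt_eq_cfc hpos
  have hTc := contDiffAt_matrix hT
  have h1 : ContDiffAt ℝ ⊤ (fun w => F (T w)) v := hF.comp v hTc
  let L : Matrix p p ℂ →ₗ[ℝ] ℂ :=
    { toFun := fun M => M i j, map_add' := fun _ _ => rfl, map_smul' := fun _ _ => rfl }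
  have h2 : ContDiffAt ℝ ⊤ (fun w => F (T w) i j) v :=
    (L.toContinuousLinearMap.contDiff.contDiffAt).comp v h1
  refine h2.congr_of_eventuallyEq ?_
  filter_upwards [hherm, hTc.continuousAt.eventually he] with w h3 h4
  rw [h4 h3]

end Analyticity

theorem OperatorConvex.contDiffAt {f : ℝ → ℝ} (hf : OperatorConvex f) {t : ℝ} (ht : 0 < t) :
    ContDiffAt ℝ ⊤ f t := by
  have h := hf.contDiffAt_cfc (p := Unit) (T := fun t : ℝ => (t : ℂ) • 1) (v := t)
    (fun i j => by
      simp only [Matrix.smul_apply, smul_eq_mul]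
      exact Complex.ofRealCLM.contDiff.contDiffAt.mul contDiffAt_const)
    (Eventually.of_forall fun w => by ext; simp)
    (Matrix.PosDef.one.smul (by exact_mod_cast ht)) () ()
  simp only [cfc_real_smul_one, Matrix.smul_apply, Matrix.one_apply_eq, smul_eq_mul, mul_one] at h
  exact Complex.reCLM.contDiff.contDiffAt.comp t h

end QIG

namespace QIG

open Matrix Filter Topology

/-! ### Formulas for the relative entropy -/

section RelativeEntropy

variable {n : ℕ}

theorem applyOp_mul (K L : Matrix (Fin n × Fin n) (Fin n × Fin n) ℂ) (X : Matrix (Fin n) (Fin n) ℂ) :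
    applyOp (K * L) X = applyOp K (applyOp L X) := by
  ext i j
  simp only [applyOp, Matrix.of_apply, ← Matrix.mulVec_mulVec]

theorem applyOp_one (X : Matrix (Fin n) (Fin n) ℂ) : applyOp 1 X = X := by
  ext i j
  simp [applyOp]

theorem applyOp_add (K L : Matrix (Fin n × Fin n) (Fin n × Fin n) ℂ)
    (X : Matrix (Fin n) (Fin n) ℂ) : applyOp (K + L) X = applyOp K X + applyOp L X := by
  ext i j
  simp [applyOp, Matrix.add_mulVec]

theorem applyOp_smul (r : ℝ) (K : Matrix (Fin n × Fin n) (Fin n × Fin n) ℂ)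
    (X : Matrix (Fin n) (Fin n) ℂ) : applyOp (r • K) X = r • applyOp K X := by
  ext i j
  simp [applyOp, Matrix.smul_mulVec]

theorem applyOp_one_kronecker (S X : Matrix (Fin n) (Fin n) ℂ) :
    applyOp (1 ⊗ₖ Sᵀ) X = X * S := by
  ext i j
  simp [applyOp, Matrix.mulVec, dotProduct, Fintype.sum_prod_type, Matrix.kroneckerMap_apply,
    Matrix.mul_apply, Matrix.one_apply, mul_comm]

theorem posDef_relModular {ρ σ : Matrix (Fin n) (Fin n) ℂ} (hρ : ρ.PosDef) (hσ : σ.PosDef) :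
    (relModular σ ρ).PosDef :=
  hσ.kronecker hρ.inv.transpose

theorem sqrt_mul_sqrt {ρ : Matrix (Fin n) (Fin n) ℂ} (hρ : ρ.PosDef) :
    cfc Real.sqrt ρ * cfc Real.sqrt ρ = ρ := by
  rw [cfc_mul_cfc]
  conv_rhs => rw [← cfc_id_of_isHermitian hρ.1]
  exact cfc_congr fun x hx => Real.mul_self_sqrt (spectrum_pos hρ hx).le

theorem sqrt_mul_inv {ρ : Matrix (Fin n) (Fin n) ℂ} (hρ : ρ.PosDef) :
    cfc Real.sqrt ρ * ρ⁻¹ = ρ⁻¹ * cfc Real.sqrt ρ := by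
  have hu := (Matrix.isUnit_iff_isUnit_det ρ).1 hρ.isUnit
  have hc : ρ * cfc Real.sqrt ρ = cfc Real.sqrt ρ * ρ := by
    nth_rewrite 1 [← sqrt_mul_sqrt hρ]
    nth_rewrite 5 [← sqrt_mul_sqrt hρ]
    rw [Matrix.mul_assoc]
  calc cfc Real.sqrt ρ * ρ⁻¹ = ρ⁻¹ * (ρ * cfc Real.sqrt ρ) * ρ⁻¹ := by
        rw [← Matrix.mul_assoc, Matrix.nonsing_inv_mul _ hu, Matrix.one_mul]
    _ = _ := by rw [hc, Matrix.mul_assoc, Matrix.mul_assoc, Matrix.mul_nonsing_inv _ hu,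
          Matrix.mul_one]

/-- Exhibits the entropy as a quadratic form of `g(L_σ / R_ρ)`, hence monotone in `g`. -/
theorem relEntropy_eq_dotProduct (g : ℝ → ℝ) (ρ σ : Matrix (Fin n) (Fin n) ℂ) :
    relEntropy g ρ σ = (star (fun p : Fin n × Fin n => cfc Real.sqrt ρ p.1 p.2) ⬝ᵥ
      (cfc g (relModular σ ρ) *ᵥ fun p : Fin n × Fin n => cfc Real.sqrt ρ p.1 p.2)).re := by
  have hS : ∀ i j, star (cfc Real.sqrt ρ i j) = cfc Real.sqrt ρ j i := fun i j =>
    (isHermitian_cfc Real.sqrt ρ).apply j i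
  rw [relEntropy, Matrix.trace]
  simp only [Matrix.diag_apply, Matrix.mul_apply, applyOp, Matrix.of_apply, dotProduct,
    Pi.star_apply, hS, Fintype.sum_prod_type]
  rw [Finset.sum_comm]

theorem relEntropy_mono {f g : ℝ → ℝ} {ρ σ : Matrix (Fin n) (Fin n) ℂ}
    (h : ∀ x ∈ spectrum ℝ (relModular σ ρ), f x ≤ g x) :
    relEntropy f ρ σ ≤ relEntropy g ρ σ := by
  have hP : (cfc g (relModular σ ρ) - cfc f (relModular σ ρ)).PosSemidef := by
    rw [cfc_sub_cfc]
    exact posSemidef_cfc fun x hx => sub_nonneg.2 (h x hx)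
  have := (Complex.le_def.1 (hP.dotProduct_mulVec_nonneg
    fun p : Fin n × Fin n => cfc Real.sqrt ρ p.1 p.2)).1
  rw [Matrix.sub_mulVec, dotProduct_sub, Complex.sub_re, Complex.zero_re] at this
  rw [relEntropy_eq_dotProduct, relEntropy_eq_dotProduct]
  linarith

/-- Right multiplication by `ρ^{1/2}` commutes with `L_σ / R_ρ`, so the two square roots merge into
`ρ`. Smoothness of the entropy then involves only the functional calculus of `g`. -/
theorem relEntropy_eq_trace (g : ℝ → ℝ) {ρ σ : Matrix (Fin n) (Fin n) ℂ} (hρ : ρ.PosDef)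
    (hσ : σ.PosDef) :
    relEntropy g ρ σ = (Matrix.trace (applyOp (cfc g (relModular σ ρ)) ρ)).re := by
  set S := cfc Real.sqrt ρ with hS
  have hT := (posDef_relModular hρ hσ).1
  have hcomm : relModular σ ρ * (1 ⊗ₖ Sᵀ) = (1 ⊗ₖ Sᵀ) * relModular σ ρ := by
    rw [relModular, ← Matrix.mul_kronecker_mul, ← Matrix.mul_kronecker_mul, Matrix.mul_one,
      Matrix.one_mul, ← Matrix.transpose_mul, ← Matrix.transpose_mul, hS, sqrt_mul_inv hρ]
  have h := cfc_intertwine hT hT hcomm g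
  have e : applyOp (cfc g (relModular σ ρ)) ρ = applyOp (cfc g (relModular σ ρ)) S * S := by
    rw [← applyOp_one_kronecker S, ← applyOp_mul, ← h, applyOp_mul, applyOp_one_kronecker, hS,
      sqrt_mul_sqrt hρ]
  rw [relEntropy, e, Matrix.trace_mul_comm]

/-- The relative entropy of a quadratic function. -/
theorem relEntropy_quadratic (β γ δ : ℝ) {ρ σ : Matrix (Fin n) (Fin n) ℂ} (hρ : ρ.PosDef)
    (hσ : σ.PosDef) :
    relEntropy (fun u => β + γ * u + δ * u ^ 2) ρ σ
      = β * ρ.trace.re + γ * σ.trace.re + δ * (Matrix.trace (σ * σ * ρ⁻¹)).re := by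
  have hT := (posDef_relModular hρ hσ).1
  have hu := (Matrix.isUnit_iff_isUnit_det ρ).1 hρ.isUnit
  have e : cfc (fun u => β + γ * u + δ * u ^ 2) (relModular σ ρ)
      = β • 1 + γ • relModular σ ρ + δ • (relModular σ ρ * relModular σ ρ) := by
    rw [cfc_eq_aeval hT (P := Polynomial.C β + Polynomial.C γ * Polynomial.X
      + Polynomial.C δ * Polynomial.X ^ 2) fun x _ => by simp]
    simp [Algebra.algebraMap_eq_smul_one, pow_two]
  rw [relEntropy_eq_trace _ hρ hσ, e]
  simp only [applyOp_add, applyOp_smul, applyOp_mul, applyOp_relModular, applyOp_one,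
    Matrix.mul_assoc, Matrix.mul_nonsing_inv _ hu, Matrix.mul_one, Matrix.trace_add,
    Matrix.trace_smul, Complex.add_re]
  simp

/-- The relative entropy in terms of spectral decompositions. -/
theorem relEntropy_eq_sum (g : ℝ → ℝ) {U V : Matrix (Fin n) (Fin n) ℂ} (hU : U * Uᴴ = 1)
    (hV : V * Vᴴ = 1) {l m : Fin n → ℝ} (hm : ∀ j, 0 < m j) :
    relEntropy g (V * diagonal (fun j => (m j : ℂ)) * Vᴴ) (U * diagonal (fun i => (l i : ℂ)) * Uᴴ)
      = ∑ i, ∑ j, m j * g (l i / m j) * Complex.normSq ((Uᴴ * V) i j) := by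
  have hU' : Uᴴ * U = 1 := mul_eq_one_comm.1 hU
  have hV' : Vᴴ * V = 1 := mul_eq_one_comm.1 hV
  set ρ := V * diagonal (fun j => (m j : ℂ)) * Vᴴ with hρ
  set σ := U * diagonal (fun i => (l i : ℂ)) * Uᴴ with hσ
  have hherm : ∀ (W : Matrix (Fin n) (Fin n) ℂ) (d : Fin n → ℝ),
      (W * diagonal (fun j => (d j : ℂ)) * Wᴴ).IsHermitian := fun W d =>
    isHermitian_mul_mul_conjTranspose W (isHermitian_diagonal_ofReal d)
  have hinv : ρ⁻¹ = V * diagonal (fun j => ((m j)⁻¹ : ℂ)) * Vᴴ := by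
    refine Matrix.inv_eq_right_inv ?_
    calc ρ * (V * diagonal (fun j => ((m j)⁻¹ : ℂ)) * Vᴴ)
        = V * diagonal (fun j => (m j : ℂ)) * (Vᴴ * V) * diagonal (fun j => ((m j)⁻¹ : ℂ)) * Vᴴ := by
          rw [hρ]; simp only [Matrix.mul_assoc]
      _ = 1 := by
          rw [hV', Matrix.mul_one, Matrix.mul_assoc V, diagonal_mul_diagonal]
          have : (diagonal fun j => (m j : ℂ) * (m j : ℂ)⁻¹) = 1 := by
            rw [← diagonal_one]
            congr 1
            ext j
            exact mul_inv_cancel₀ (by exact_mod_cast (hm j).ne')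
          rw [this, Matrix.mul_one, hV]
  have hTH : (relModular σ ρ).IsHermitian := by
    have h1 : ρ⁻¹.IsHermitian := (hherm V m).inv
    rw [relModular, Matrix.IsHermitian, conjTranspose_kronecker, (hherm U l).eq, h1.transpose.eq]
  -- The columns of `M` are eigenvectors of `L_σ / R_ρ`, with eigenvalues `l i / m j`.
  set M : Matrix (Fin n × Fin n) (Fin n × Fin n) ℂ := U ⊗ₖ (Vᴴ)ᵀ with hM
  set r : Fin n × Fin n → ℝ := fun p => l p.1 / m p.2 with hr
  have hMH : Mᴴ = Uᴴ ⊗ₖ Vᵀ := by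
    rw [hM, conjTranspose_kronecker]
    congr 1
    ext
    simp
  have hMM : M * Mᴴ = 1 := by
    rw [hMH, hM, ← Matrix.mul_kronecker_mul, hU, ← Matrix.transpose_mul, hV, transpose_one,
      one_kronecker_one]
  have hTM : relModular σ ρ * M = M * diagonal fun p => (r p : ℂ) := by
    have hD : (diagonal fun p => (r p : ℂ))
        = diagonal (fun i => (l i : ℂ)) ⊗ₖ diagonal (fun j => ((m j)⁻¹ : ℂ)) := by
      rw [diagonal_kronecker_diagonal]
      congr 1
      ext p
      simp [hr, div_eq_mul_inv]
    rw [hD, relModular, hM, ← Matrix.mul_kronecker_mul, ← Matrix.mul_kronecker_mul,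
      ← Matrix.transpose_mul, hinv, hσ, Matrix.mul_assoc (U * _), hU', Matrix.mul_one]
    congr 1
    rw [← Matrix.mul_assoc, ← Matrix.mul_assoc, hV', Matrix.one_mul, Matrix.transpose_mul,
      diagonal_transpose]
  have hcfc : cfc g (relModular σ ρ) = M * diagonal (fun p => (g (r p) : ℂ)) * Mᴴ := by
    have h := cfc_intertwine hTH (isHermitian_diagonal_ofReal r) hTM g
    rw [cfc_diagonal] at h
    rw [← h, Matrix.mul_assoc, hMM, Matrix.mul_one]
  have hS : cfc Real.sqrt ρ * V = V * diagonal fun j => (√(m j) : ℂ) := by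
    have h := cfc_intertwine (hherm V m) (isHermitian_diagonal_ofReal m) (W := V)
      (by rw [Matrix.mul_assoc (V * _), hV', Matrix.mul_one]) Real.sqrt
    rwa [cfc_diagonal] at h
  set v : Fin n × Fin n → ℂ := fun p => cfc Real.sqrt ρ p.1 p.2 with hv
  have hMv : ∀ p, (Mᴴ *ᵥ v) p = (√(m p.2) : ℂ) * (Uᴴ * V) p.1 p.2 := by
    intro p
    have h1 : (Mᴴ *ᵥ v) p = (Uᴴ * (cfc Real.sqrt ρ * V)) p.1 p.2 := by
      rw [hMH]
      simp only [Matrix.mulVec, dotProduct, Fintype.sum_prod_type, Matrix.kroneckerMap_apply,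
        Matrix.mul_apply, Finset.mul_sum, hv, Matrix.transpose_apply]
      refine Finset.sum_congr rfl fun i _ => Finset.sum_congr rfl fun j _ => ?_
      ring
    rw [h1, hS, ← Matrix.mul_assoc, Matrix.mul_diagonal, mul_comm]
  have hquad : star v ⬝ᵥ (cfc g (relModular σ ρ) *ᵥ v)
      = ∑ p : Fin n × Fin n, ((m p.2 * g (r p) * Complex.normSq ((Uᴴ * V) p.1 p.2) : ℝ) : ℂ) := by
    rw [hcfc, ← Matrix.mulVec_mulVec, ← Matrix.mulVec_mulVec, Matrix.dotProduct_mulVec,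
      ← Matrix.conjTranspose_conjTranspose M, ← Matrix.star_mulVec,
      Matrix.conjTranspose_conjTranspose, dotProduct]
    refine Finset.sum_congr rfl fun p _ => ?_
    rw [Pi.star_apply, Matrix.mulVec_diagonal, hMv, star_mul']
    have h2 : star ((√(m p.2) : ℝ) : ℂ) = (√(m p.2) : ℝ) := Complex.conj_ofReal _
    rw [h2]
    have h3 : ((√(m p.2) : ℝ) : ℂ) * (√(m p.2) : ℝ) = m p.2 := by
      rw [← Complex.ofReal_mul, Real.mul_self_sqrt (hm _).le]
    have h4 : star ((Uᴴ * V) p.1 p.2) * (Uᴴ * V) p.1 p.2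
        = (Complex.normSq ((Uᴴ * V) p.1 p.2) : ℂ) := by
      rw [mul_comm]; exact Complex.mul_conj _
    push_cast
    rw [← h3, ← h4]
    ring
  rw [relEntropy_eq_dotProduct, hquad, ← Complex.ofReal_sum, Complex.ofReal_re,
    Fintype.sum_prod_type]

theorem exists_spectral_decomposition {A : Matrix (Fin n) (Fin n) ℂ} (hA : A.PosDef) :
    ∃ (U : Matrix (Fin n) (Fin n) ℂ) (l : Fin n → ℝ), U * Uᴴ = 1 ∧ (∀ i, 0 < l i) ∧
      A = U * diagonal (fun i => (l i : ℂ)) * Uᴴ := by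
  refine ⟨hA.1.eigenvectorUnitary, hA.1.eigenvalues, ?_, hA.eigenvalues_pos, ?_⟩
  · exact Unitary.coe_mul_star_self _
  · have := hA.1.spectral_theorem
    conv_lhs => rw [this]
    rfl

theorem smul_mul_diagonal_mul (c : ℝ) (W : Matrix (Fin n) (Fin n) ℂ) (d : Fin n → ℝ) :
    c • (W * diagonal (fun i => (d i : ℂ)) * Wᴴ)
      = W * diagonal (fun i => ((c * d i : ℝ) : ℂ)) * Wᴴ := by
  have : (diagonal fun i => ((c * d i : ℝ) : ℂ)) = c • diagonal fun i => (d i : ℂ) := by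
    rw [← diagonal_smul]
    congr 1
    ext i
    simp
  rw [this, Matrix.mul_smul, Matrix.smul_mul]

theorem relEntropy_smul_self (g : ℝ → ℝ) {ρ : Matrix (Fin n) (Fin n) ℂ} (hρ : ρ.PosDef)
    (u : ℝ) : relEntropy g ρ (u • ρ) = g u * ρ.trace.re := by
  obtain ⟨V, m, hV, hm, rfl⟩ := exists_spectral_decomposition hρ
  have hV' : Vᴴ * V = 1 := mul_eq_one_comm.1 hV
  rw [smul_mul_diagonal_mul, relEntropy_eq_sum _ hV hV hm, hV', Matrix.trace_mul_comm,
    ← Matrix.mul_assoc, hV', Matrix.one_mul, Matrix.trace_diagonal, Complex.re_sum,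
    Finset.mul_sum]
  refine Finset.sum_congr rfl fun i _ => ?_
  rw [Finset.sum_eq_single i (fun j _ hj => by simp [Matrix.one_apply_ne' hj]) (by simp)]
  rw [mul_div_cancel_right₀ _ (hm i).ne']
  simp [mul_comm]

/-- Termwise in the spectral formula, `l ĝ(m / l) = m g(l / m)`. Everything defined from `ĝ` becomes
a derivative of the same divergence in the other argument. -/
theorem relEntropy_hat (g : ℝ → ℝ) {ρ σ : Matrix (Fin n) (Fin n) ℂ} (hρ : ρ.PosDef)
    (hσ : σ.PosDef) : relEntropy (hat g) ρ σ = relEntropy g σ ρ := by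
  obtain ⟨V, m, hV, hm, rfl⟩ := exists_spectral_decomposition hρ
  obtain ⟨U, l, hU, hl, rfl⟩ := exists_spectral_decomposition hσ
  rw [relEntropy_eq_sum _ hU hV hm, relEntropy_eq_sum _ hV hU hl, Finset.sum_comm]
  refine Finset.sum_congr rfl fun j _ => Finset.sum_congr rfl fun i _ => ?_
  have e : (Vᴴ * U) j i = star ((Uᴴ * V) i j) := by
    rw [← Matrix.conjTranspose_apply, Matrix.conjTranspose_mul, Matrix.conjTranspose_conjTranspose]
  have hmj := (hm j).ne'
  rw [e, hat, inv_div]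
  change _ = _ * Complex.normSq ((starRingEnd ℂ) _)
  rw [Complex.normSq_conj]
  field_simp

theorem relEntropy_smul_smul (g : ℝ → ℝ) {ρ σ : Matrix (Fin n) (Fin n) ℂ} (hρ : ρ.PosDef)
    (hσ : σ.PosDef) {c : ℝ} (hc : 0 < c) :
    relEntropy g (c • ρ) (c • σ) = c * relEntropy g ρ σ := by
  obtain ⟨V, m, hV, hm, rfl⟩ := exists_spectral_decomposition hρ
  obtain ⟨U, l, hU, hl, rfl⟩ := exists_spectral_decomposition hσ
  rw [smul_mul_diagonal_mul, smul_mul_diagonal_mul, relEntropy_eq_sum _ hU hV hm,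
    relEntropy_eq_sum _ hU hV (m := fun j => c * m j) fun j => mul_pos hc (hm j), Finset.mul_sum]
  refine Finset.sum_congr rfl fun i _ => ?_
  rw [Finset.mul_sum]
  refine Finset.sum_congr rfl fun j _ => ?_
  rw [mul_div_mul_left _ _ hc.ne']
  ring

end RelativeEntropy

end QIG

noncomputable section

namespace QIG

open Filter Topology

/-! ### Geometry of an abstract homogeneous divergence -/

section Divergence

set_option maxSynthPendingDepth 3

variable {V : Type*} [NormedAddCommGroup V] [NormedSpace ℝ V]
  {E : Type*} [NormedAddCommGroup E] [NormedSpace ℝ E]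

theorem hasDerivAt_line_at {F : V → E} {x v : V} {s : ℝ} (hF : DifferentiableAt ℝ F (x + s • v)) :
    HasDerivAt (fun s : ℝ => F (x + s • v)) (fderiv ℝ F (x + s • v) v) s := by
  have h1 : HasDerivAt (fun s : ℝ => x + s • v) v s := by
    simpa using ((hasDerivAt_id s).smul_const v).const_add x
  exact hF.hasFDerivAt.comp_hasDerivAt s h1

theorem hasDerivAt_line {F : V → E} {x : V} (hF : DifferentiableAt ℝ F x) (v : V) :
    HasDerivAt (fun s : ℝ => F (x + s • v)) (fderiv ℝ F x v) 0 := by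
  have e : x + (0 : ℝ) • v = x := by simp
  have h := hasDerivAt_line_at (F := F) (x := x) (v := v) (s := 0) (by rwa [e])
  rwa [e] at h

/-- Differentiation lowers the degree of homogeneity by one; used three times, from `H` up to its
third derivative. -/
theorem fderiv_smul_of_forall_eq {F : V → E} {U : Set V} (hU : IsOpen U) {c a : ℝ}
    (h : ∀ p ∈ U, F (c • p) = a • F p) {p : V} (hp : p ∈ U) (hF : DifferentiableAt ℝ F p) :
    c • fderiv ℝ F (c • p) = a • fderiv ℝ F p := by
  rw [← fderiv_comp_smul, ← fderiv_fun_const_smul hF]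
  refine Filter.EventuallyEq.fderiv_eq ?_
  filter_upwards [hU.mem_nhds hp] with q hq using h q hq

/-- The second derivative. -/
def hess (H : V × V → ℝ) : V × V → V × V →L[ℝ] V × V →L[ℝ] ℝ := fderiv ℝ (fderiv ℝ H)

/-- The third derivative. -/
def third (H : V × V → ℝ) : V × V → V × V →L[ℝ] V × V →L[ℝ] V × V →L[ℝ] ℝ :=
  fderiv ℝ (hess H)

/-- A smooth divergence on an open cone, homogeneous of degree one, whose behaviour on
proportional pairs of points is that of the relative entropy of a function `g`. -/
structure IsDivergence (H : V × V → ℝ) (Ω : Set V) (τ : V →L[ℝ] ℝ) (g : ℝ → ℝ) : Prop where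
  isOpen : IsOpen Ω
  smul_mem : ∀ {x : V} {c : ℝ}, x ∈ Ω → 0 < c → c • x ∈ Ω
  contDiffAt : ∀ {x y : V}, x ∈ Ω → y ∈ Ω → ContDiffAt ℝ ⊤ H (x, y)
  map_smul : ∀ {x y : V} {c : ℝ}, x ∈ Ω → y ∈ Ω → 0 < c → H (c • x, c • y) = c * H (x, y)
  fderiv_right : ∀ {x : V} {u : ℝ} (W : V), x ∈ Ω → 0 < u →
    fderiv ℝ H (x, u • x) (0, W) = deriv g u * τ W
  fderiv_left : ∀ {x : V} {u : ℝ} (W : V), x ∈ Ω → 0 < u →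
    fderiv ℝ H (x, u • x) (W, 0) = (g u - u * deriv g u) * τ W
  hess_pos : ∀ {x X : V}, x ∈ Ω → X ≠ 0 → 0 < hess H (x, x) (0, X) (0, X)
  contDiffAt_fun : ∀ {u : ℝ}, 0 < u → ContDiffAt ℝ ⊤ g u
  second_deriv_one : deriv (deriv g) 1 = 1

/-- The metric tensor of a divergence. -/
def gram (H : V × V → ℝ) (x : V) : V →L[ℝ] V →L[ℝ] ℝ :=
  -(((ContinuousLinearMap.compL ℝ V (V × V) ℝ).flip (ContinuousLinearMap.inr ℝ V V)) ∘L
    (hess H (x, x)) ∘L (ContinuousLinearMap.inl ℝ V V))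

/-- The skewness of a divergence. -/
def skew (H : V × V → ℝ) (x X Y : V) : V →L[ℝ] ℝ :=
  -(third H (x, x) (X, 0) (Y, 0) ∘L ContinuousLinearMap.inr ℝ V V)
    + third H (x, x) (0, X) (0, Y) ∘L ContinuousLinearMap.inl ℝ V V

/-- The Christoffel symbols of the first kind of the metric connection of a divergence. -/
def levi (H : V × V → ℝ) (x X Y : V) : V →L[ℝ] ℝ :=
  -((1 / 2 : ℝ) • (third H (x, x) (X, X) (Y, 0) ∘L ContinuousLinearMap.inr ℝ V V
    + third H (x, x) (Y, Y) (X, 0) ∘L ContinuousLinearMap.inr ℝ V V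
    - third H (x, x) (X, 0) (0, Y) ∘L (ContinuousLinearMap.id ℝ V).prod (.id ℝ V)))

/-- The Christoffel symbols of the first kind of the connection `∇̄ - q D`. -/
def chrisForm (H : V × V → ℝ) (q : ℝ) (x X Y : V) : V →L[ℝ] ℝ := levi H x X Y - q • skew H x X Y

/-- The connection `∇̄ - q D`. -/
def chris (H : V × V → ℝ) (q : ℝ) (x X Y : V) : V := (gram H x).inverse (chrisForm H q x X Y)

/-- The curvature of the connection `∇̄ - q D`. -/
def riem (H : V × V → ℝ) (q : ℝ) (x X Y Z W : V) : ℝ :=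
  gram H x ((deriv (fun s : ℝ => chris H q (x + s • X) Y Z) 0 + chris H q x X (chris H q x Y Z))
    - (deriv (fun s : ℝ => chris H q (x + s • Y) X Z) 0 + chris H q x Y (chris H q x X Z))) W

theorem gram_apply (H : V × V → ℝ) (x X Y : V) :
    gram H x X Y = -hess H (x, x) (X, 0) (0, Y) := by
  simp [gram]

theorem skew_apply (H : V × V → ℝ) (x X Y Z : V) :
    skew H x X Y Z = -third H (x, x) (X, 0) (Y, 0) (0, Z)
      + third H (x, x) (0, X) (0, Y) (Z, 0) := by
  simp [skew]

theorem levi_apply (H : V × V → ℝ) (x X Y Z : V) :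
    levi H x X Y Z = -(1 / 2) * (third H (x, x) (X, X) (Y, 0) (0, Z)
      + third H (x, x) (Y, Y) (X, 0) (0, Z) - third H (x, x) (X, 0) (0, Y) (Z, Z)) := by
  simp [levi]

theorem chrisForm_apply (H : V × V → ℝ) (q : ℝ) (x X Y Z : V) :
    chrisForm H q x X Y Z = levi H x X Y Z - q * skew H x X Y Z := by
  simp [chrisForm]

theorem hasDerivAt_one_add_inv_pow (k : ℕ) (r : ℝ) :
    HasDerivAt (fun s : ℝ => ((1 + s) ^ k)⁻¹ * r) (-k * r) 0 := by
  have h1 : HasDerivAt (fun s : ℝ => 1 + s) 1 0 := (hasDerivAt_id 0).const_add 1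
  have h2 := ((h1.pow k).inv (by simp)).mul_const r
  simpa using h2

theorem eventually_one_add_pos : ∀ᶠ s : ℝ in 𝓝 0, 0 < 1 + s := by
  have : ContinuousAt (fun s : ℝ => 1 + s) 0 := by fun_prop
  exact this.eventually (Ioi_mem_nhds (by norm_num))

theorem line_diag (x X : V) (s : ℝ) :
    (x, x) + s • (X, X) = (x + s • X, x + s • X) := rfl

theorem diag_eq_add (X : V) : ((X, X) : V × V) = (X, 0) + (0, X) := by simp

namespace IsDivergence

variable {H : V × V → ℝ} {Ω : Set V} {τ : V →L[ℝ] ℝ} {g : ℝ → ℝ}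

section

variable (hH : IsDivergence H Ω τ g)
include hH

theorem isOpen_prod : IsOpen (Ω ×ˢ Ω) := hH.isOpen.prod hH.isOpen

theorem contDiffAt_fderiv {x y : V} (hx : x ∈ Ω) (hy : y ∈ Ω) :
    ContDiffAt ℝ ⊤ (fderiv ℝ H) (x, y) := (hH.contDiffAt hx hy).fderiv_right le_top

theorem contDiffAt_hess {x y : V} (hx : x ∈ Ω) (hy : y ∈ Ω) :
    ContDiffAt ℝ ⊤ (hess H) (x, y) := (hH.contDiffAt_fderiv hx hy).fderiv_right le_top

theorem contDiffAt_third {x y : V} (hx : x ∈ Ω) (hy : y ∈ Ω) :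
    ContDiffAt ℝ ⊤ (third H) (x, y) := (hH.contDiffAt_hess hx hy).fderiv_right le_top

theorem hess_comm {x y : V} (hx : x ∈ Ω) (hy : y ∈ Ω) (u v : V × V) :
    hess H (x, y) u v = hess H (x, y) v u :=
  (hH.contDiffAt hx hy).isSymmSndFDerivAt (by simp) u v

theorem third_comm_left {x y : V} (hx : x ∈ Ω) (hy : y ∈ Ω) (u v w : V × V) :
    third H (x, y) u v w = third H (x, y) v u w :=
  DFunLike.congr_fun ((hH.contDiffAt_fderiv hx hy).isSymmSndFDerivAt (by simp) u v) w

theorem hasDerivAt_hess {x y : V} (hx : x ∈ Ω) (hy : y ∈ Ω) (u v w : V × V) :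
    HasDerivAt (fun s : ℝ => hess H ((x, y) + s • u) v w) (third H (x, y) u v w) 0 := by
  have h := hasDerivAt_line ((hH.contDiffAt_hess hx hy).differentiableAt (by simp)) u
  have h2 := (h.clm_apply (hasDerivAt_const (0 : ℝ) v)).clm_apply (hasDerivAt_const (0 : ℝ) w)
  simpa [third] using h2

theorem hasDerivAt_fderiv {x y : V} (hx : x ∈ Ω) (hy : y ∈ Ω) (u v : V × V) :
    HasDerivAt (fun s : ℝ => fderiv ℝ H ((x, y) + s • u) v) (hess H (x, y) u v) 0 := by
  have h := hasDerivAt_line ((hH.contDiffAt_fderiv hx hy).differentiableAt (by simp)) u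
  have h2 := h.clm_apply (hasDerivAt_const (0 : ℝ) v)
  simpa [hess] using h2

theorem eventually_line {x y : V} (hx : x ∈ Ω) (hy : y ∈ Ω) (u : V × V) :
    ∀ᶠ s : ℝ in 𝓝 0, (x, y) + s • u ∈ Ω ×ˢ Ω := by
  have hc : ContinuousAt (fun s : ℝ => (x, y) + s • u) 0 := by fun_prop
  refine hc.eventually (hH.isOpen_prod.mem_nhds ?_)
  simpa using And.intro hx hy

theorem third_comm_right {x y : V} (hx : x ∈ Ω) (hy : y ∈ Ω) (u v w : V × V) :
    third H (x, y) u v w = third H (x, y) u w v := by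
  refine (hH.hasDerivAt_hess hx hy u v w).unique ?_
  refine (hH.hasDerivAt_hess hx hy u w v).congr_of_eventuallyEq ?_
  filter_upwards [hH.eventually_line hx hy u] with s hs
  exact hH.hess_comm hs.1 hs.2 v w

theorem fderiv_smul {x y : V} (hx : x ∈ Ω) (hy : y ∈ Ω) {c : ℝ} (hc : 0 < c) :
    fderiv ℝ H (c • (x, y)) = fderiv ℝ H (x, y) := by
  have h := fderiv_smul_of_forall_eq (F := H) hH.isOpen_prod (c := c) (a := c)
    (fun p hp => hH.map_smul hp.1 hp.2 hc) (p := (x, y)) ⟨hx, hy⟩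
    ((hH.contDiffAt hx hy).differentiableAt (by simp))
  exact smul_right_injective _ hc.ne' h

theorem hess_smul {x y : V} (hx : x ∈ Ω) (hy : y ∈ Ω) {c : ℝ} (hc : 0 < c) :
    hess H (c • (x, y)) = c⁻¹ • hess H (x, y) := by
  have h := fderiv_smul_of_forall_eq (F := fderiv ℝ H) hH.isOpen_prod (c := c) (a := 1)
    (fun p hp => by rw [one_smul]; exact hH.fderiv_smul hp.1 hp.2 hc) (p := (x, y)) ⟨hx, hy⟩
    ((hH.contDiffAt_fderiv hx hy).differentiableAt (by simp))
  rw [one_smul] at h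
  rw [hess, ← h, smul_smul, inv_mul_cancel₀ hc.ne', one_smul]

theorem third_smul {x y : V} (hx : x ∈ Ω) (hy : y ∈ Ω) {c : ℝ} (hc : 0 < c) :
    third H (c • (x, y)) = (c ^ 2)⁻¹ • third H (x, y) := by
  have h := fderiv_smul_of_forall_eq (F := hess H) hH.isOpen_prod (c := c) (a := c⁻¹)
    (fun p hp => hH.hess_smul hp.1 hp.2 hc) (p := (x, y)) ⟨hx, hy⟩
    ((hH.contDiffAt_hess hx hy).differentiableAt (by simp))
  rw [third]
  have h2 := congrArg (fun T => c⁻¹ • T) h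
  simp only [smul_smul, inv_mul_cancel₀ hc.ne', one_smul] at h2
  rw [h2]
  congr 1
  rw [pow_two, mul_inv]

/-- Euler's identity for the second derivative, which is homogeneous of degree `-1`. -/
theorem third_self_left {x y : V} (hx : x ∈ Ω) (hy : y ∈ Ω) (v w : V × V) :
    third H (x, y) (x, y) v w = -hess H (x, y) v w := by
  have h := hasDerivAt_one_add_inv_pow 1 (hess H (x, y) v w)
  simp only [pow_one, Nat.cast_one, neg_mul, one_mul] at h
  refine (hH.hasDerivAt_hess hx hy (x, y) v w).unique (h.congr_of_eventuallyEq ?_)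
  filter_upwards [eventually_one_add_pos] with s hs
  have e : (x, y) + s • (x, y) = (1 + s) • (x, y) := by rw [add_smul, one_smul]
  rw [e, hH.hess_smul hx hy hs]
  rfl

theorem fderiv_diag_right {x : V} (hx : x ∈ Ω) (W : V) :
    fderiv ℝ H (x, x) (0, W) = deriv g 1 * τ W := by
  simpa using hH.fderiv_right W hx one_pos

theorem fderiv_diag_left {x : V} (hx : x ∈ Ω) (W : V) :
    fderiv ℝ H (x, x) (W, 0) = (g 1 - deriv g 1) * τ W := by
  simpa using hH.fderiv_left W hx one_pos

theorem eventually_line_mem {x : V} (hx : x ∈ Ω) (X : V) :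
    ∀ᶠ s : ℝ in 𝓝 0, x + s • X ∈ Ω := by
  have hc : ContinuousAt (fun s : ℝ => x + s • X) 0 := by fun_prop
  exact hc.eventually (hH.isOpen.mem_nhds (by simpa using hx))

/-- The first derivative at `(x, x)` is a fixed multiple of `τ`, constant along the diagonal. Hence
the blocks of the second derivative on the diagonal agree up to sign, each giving the metric. -/
theorem hess_diag_right {x : V} (hx : x ∈ Ω) (X W : V) : hess H (x, x) (X, X) (0, W) = 0 := by
  refine (hH.hasDerivAt_fderiv hx hx (X, X) (0, W)).unique
    ((hasDerivAt_const (0 : ℝ) (deriv g 1 * τ W)).congr_of_eventuallyEq ?_)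
  filter_upwards [hH.eventually_line_mem hx X] with s hs
  rw [line_diag, hH.fderiv_diag_right hs]

theorem hess_diag_left {x : V} (hx : x ∈ Ω) (X W : V) : hess H (x, x) (X, X) (W, 0) = 0 := by
  refine (hH.hasDerivAt_fderiv hx hx (X, X) (W, 0)).unique
    ((hasDerivAt_const (0 : ℝ) ((g 1 - deriv g 1) * τ W)).congr_of_eventuallyEq ?_)
  filter_upwards [hH.eventually_line_mem hx X] with s hs
  rw [line_diag, hH.fderiv_diag_left hs]

theorem gram_eq_hess_right {x : V} (hx : x ∈ Ω) (X Y : V) :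
    gram H x X Y = hess H (x, x) (0, X) (0, Y) := by
  have h := hH.hess_diag_right hx X Y
  rw [diag_eq_add X, map_add, add_apply] at h
  rw [gram_apply]
  linarith

theorem gram_eq_hess_left {x : V} (hx : x ∈ Ω) (X Y : V) :
    gram H x X Y = hess H (x, x) (X, 0) (Y, 0) := by
  have h := hH.hess_diag_left hx Y X
  rw [diag_eq_add Y, map_add, add_apply, hH.hess_comm hx hx (Y, 0),
    hH.hess_comm hx hx (0, Y)] at h
  rw [gram_apply]
  linarith

theorem gram_comm {x : V} (hx : x ∈ Ω) (X Y : V) : gram H x X Y = gram H x Y X := by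
  rw [hH.gram_eq_hess_right hx, hH.gram_eq_hess_right hx, hH.hess_comm hx hx]

theorem gram_pos {x X : V} (hx : x ∈ Ω) (hX : X ≠ 0) : 0 < gram H x X X := by
  rw [hH.gram_eq_hess_right hx]
  exact hH.hess_pos hx hX

theorem gram_injective {x X X' : V} (hx : x ∈ Ω) (h : ∀ W, gram H x X W = gram H x X' W) :
    X = X' := by
  by_contra hne
  have hpos := hH.gram_pos hx (sub_ne_zero.2 hne)
  have h0 : gram H x (X - X') (X - X') = gram H x X (X - X') - gram H x X' (X - X') := by
    rw [map_sub (gram H x), sub_apply]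
  rw [h0, h, sub_self] at hpos
  exact hpos.ne rfl

/-- Polarized derivative of the metric tensor. -/
theorem third_diag_mixed {x : V} (hx : x ∈ Ω) (X Y Z : V) :
    third H (x, x) (X, X) (0, Y) (0, Z) = -third H (x, x) (X, X) (Y, 0) (0, Z) := by
  refine (hH.hasDerivAt_hess hx hx (X, X) (0, Y) (0, Z)).unique
    ((hH.hasDerivAt_hess hx hx (X, X) (Y, 0) (0, Z)).neg.congr_of_eventuallyEq ?_)
  filter_upwards [hH.eventually_line_mem hx X] with s hs
  simp only [line_diag, Pi.neg_apply]
  rw [← hH.gram_eq_hess_right hs, gram_apply]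

theorem third_diag_left {x : V} (hx : x ∈ Ω) (X Y Z : V) :
    third H (x, x) (X, X) (Y, 0) (Z, 0) = -third H (x, x) (X, X) (Y, 0) (0, Z) := by
  refine (hH.hasDerivAt_hess hx hx (X, X) (Y, 0) (Z, 0)).unique
    ((hH.hasDerivAt_hess hx hx (X, X) (Y, 0) (0, Z)).neg.congr_of_eventuallyEq ?_)
  filter_upwards [hH.eventually_line_mem hx X] with s hs
  simp only [line_diag, Pi.neg_apply]
  rw [← hH.gram_eq_hess_left hs, gram_apply]

end

end IsDivergence

end Divergence

end QIG

end

noncomputable section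

namespace QIG

open Filter Topology

/-! ### Third derivatives in the direction of the base point -/

section DivergenceCurvature

set_option maxSynthPendingDepth 3

variable {V : Type*} [NormedAddCommGroup V] [NormedSpace ℝ V]

theorem add_smul_prod_mk_zero_left (x y : V) (s : ℝ) :
    (x, y) + s • ((0 : V), y) = (x, (1 + s) • y) := by
  simp [add_smul]

theorem skew_comm_of_isDivergence {H : V × V → ℝ} {Ω : Set V} {τ : V →L[ℝ] ℝ} {g : ℝ → ℝ}
    (hH : IsDivergence H Ω τ g) {x : V} (hx : x ∈ Ω) (X Y : V) : skew H x X Y = skew H x Y X := by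
  ext Z
  simp only [skew_apply]
  rw [hH.third_comm_left hx hx (X, 0), hH.third_comm_left hx hx (0, X)]

theorem prod_mk_smul_zero (c : ℝ) (X : V) : ((c • X, 0) : V × V) = c • (X, 0) := by simp

theorem prod_mk_zero_smul (c : ℝ) (X : V) : ((0, c • X) : V × V) = c • (0, X) := by simp

omit [NormedSpace ℝ V] in
theorem prod_mk_add_zero (X Y : V) : ((X + Y, 0) : V × V) = (X, 0) + (Y, 0) := by simp

omit [NormedSpace ℝ V] in
theorem prod_mk_zero_add (X Y : V) : ((0, X + Y) : V × V) = (0, X) + (0, Y) := by simp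

theorem third_diag_split (H : V × V → ℝ) (x X : V) (v w : V × V) :
    third H (x, x) (X, X) v w = third H (x, x) (X, 0) v w + third H (x, x) (0, X) v w := by
  rw [diag_eq_add X, map_add, add_apply, add_apply]

theorem chrisForm_smul_left (H : V × V → ℝ) (q : ℝ) (x : V) (c : ℝ) (X Y Z : V) :
    chrisForm H q x (c • X) Y Z = c * chrisForm H q x X Y Z := by
  simp only [chrisForm_apply, levi_apply, skew_apply, prod_mk_smul_zero, prod_mk_zero_smul,
    ← Prod.smul_mk, map_smul, smul_apply, smul_eq_mul]
  ring

theorem chrisForm_add_left (H : V × V → ℝ) (q : ℝ) (x X X' Y Z : V) :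
    chrisForm H q x (X + X') Y Z = chrisForm H q x X Y Z + chrisForm H q x X' Y Z := by
  simp only [chrisForm_apply, levi_apply, skew_apply, prod_mk_add_zero, prod_mk_zero_add,
    ← Prod.mk_add_mk, map_add, add_apply]
  ring

theorem chrisForm_smul_right (H : V × V → ℝ) (q : ℝ) (x : V) (c : ℝ) (X Y Z : V) :
    chrisForm H q x X (c • Y) Z = c * chrisForm H q x X Y Z := by
  simp only [chrisForm_apply, levi_apply, skew_apply, prod_mk_smul_zero, prod_mk_zero_smul,
    ← Prod.smul_mk, map_smul, smul_apply, smul_eq_mul]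
  ring

theorem chrisForm_add_right (H : V × V → ℝ) (q : ℝ) (x X Y Y' Z : V) :
    chrisForm H q x X (Y + Y') Z = chrisForm H q x X Y Z + chrisForm H q x X Y' Z := by
  simp only [chrisForm_apply, levi_apply, skew_apply, prod_mk_add_zero, prod_mk_zero_add,
    ← Prod.mk_add_mk, map_add, add_apply]
  ring

namespace IsDivergence

variable {H : V × V → ℝ} {Ω : Set V} {τ : V →L[ℝ] ℝ} {g : ℝ → ℝ}

section

variable (hH : IsDivergence H Ω τ g)
include hH

theorem contDiffAt_deriv {u : ℝ} (hu : 0 < u) : ContDiffAt ℝ ⊤ (deriv g) u := by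
  have h := ((hH.contDiffAt_fun hu).fderiv_right (m := ⊤) le_top).clm_apply
    (contDiffAt_const (c := (1 : ℝ)))
  exact h

theorem contDiffAt_deriv_deriv {u : ℝ} (hu : 0 < u) : ContDiffAt ℝ ⊤ (deriv (deriv g)) u := by
  have h := ((hH.contDiffAt_deriv hu).fderiv_right (m := ⊤) le_top).clm_apply
    (contDiffAt_const (c := (1 : ℝ)))
  exact h

theorem hasDerivAt_deriv {u : ℝ} (hu : 0 < u) : HasDerivAt (deriv g) (deriv (deriv g) u) u :=
  ((hH.contDiffAt_deriv hu).differentiableAt (by simp)).hasDerivAt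

theorem hasDerivAt_deriv_deriv {u : ℝ} (hu : 0 < u) :
    HasDerivAt (deriv (deriv g)) (deriv (deriv (deriv g)) u) u :=
  ((hH.contDiffAt_deriv_deriv hu).differentiableAt (by simp)).hasDerivAt

theorem third_self_split {x : V} (hx : x ∈ Ω) (v w : V × V) :
    third H (x, x) (x, 0) v w = -hess H (x, x) v w - third H (x, x) (0, x) v w := by
  have h := hH.third_self_left hx hx v w
  rw [third_diag_split] at h
  linarith

theorem hess_ray {x : V} (hx : x ∈ Ω) {u : ℝ} (hu : 0 < u) (W : V) :
    hess H (x, u • x) (0, x) (0, W) = deriv (deriv g) u * τ W := by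
  have hd : HasDerivAt (fun s : ℝ => deriv g (u + s) * τ W) (deriv (deriv g) u * τ W) 0 := by
    have h1 : HasDerivAt (fun s : ℝ => u + s) 1 0 := (hasDerivAt_id 0).const_add u
    have h2 : HasDerivAt (deriv g) (deriv (deriv g) u) (u + 0) := by
      simpa using hH.hasDerivAt_deriv hu
    simpa using (h2.comp (0 : ℝ) h1).mul_const (τ W)
  refine (hH.hasDerivAt_fderiv hx (hH.smul_mem hx hu) (0, x) (0, W)).unique
    (hd.congr_of_eventuallyEq ?_)
  have hc : ContinuousAt (fun s : ℝ => u + s) 0 := by fun_prop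
  filter_upwards [hc.eventually (lt_mem_nhds (by simpa using hu))] with s hs
  have e : (x, u • x) + s • ((0 : V), x) = (x, (u + s) • x) := by simp [add_smul]
  rw [e, hH.fderiv_right W hx hs]

theorem third_ray {x : V} (hx : x ∈ Ω) (W : V) :
    third H (x, x) (0, x) (0, x) (0, W) = deriv (deriv (deriv g)) 1 * τ W := by
  have hd : HasDerivAt (fun s : ℝ => deriv (deriv g) (1 + s) * τ W)
      (deriv (deriv (deriv g)) 1 * τ W) 0 := by
    have h1 : HasDerivAt (fun s : ℝ => 1 + s) 1 0 := (hasDerivAt_id 0).const_add 1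
    have h2 : HasDerivAt (deriv (deriv g)) (deriv (deriv (deriv g)) 1) (1 + 0) := by
      simpa using hH.hasDerivAt_deriv_deriv one_pos
    simpa using (h2.comp (0 : ℝ) h1).mul_const (τ W)
  refine (hH.hasDerivAt_hess hx hx (0, x) (0, x) (0, W)).unique (hd.congr_of_eventuallyEq ?_)
  filter_upwards [eventually_one_add_pos] with s hs
  rw [add_smul_prod_mk_zero_left, hH.hess_ray hx hs]

/-- The normalization `g''(1) = 1` enters here: the base point is metrically dual to the constant
form `τ`. -/
theorem gram_self {x : V} (hx : x ∈ Ω) (W : V) : gram H x x W = τ W := by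
  have h := hH.hess_ray hx one_pos W
  rw [one_smul, hH.second_deriv_one, one_mul] at h
  rw [hH.gram_eq_hess_right hx, h]

/-- Differentiate `gram_self` along `Y`: the right side is constant, so the derivative of the metric
cancels that of the vector `x`. -/
theorem third_diag_self_left {x : V} (hx : x ∈ Ω) (Y W : V) :
    third H (x, x) (Y, Y) (x, 0) (0, W) = gram H x Y W := by
  have hd : HasDerivAt (fun s : ℝ => -τ W - s * hess H ((x, x) + s • (Y, Y)) (Y, 0) (0, W))
      (gram H x Y W) 0 := by
    have h := ((hasDerivAt_id (0 : ℝ)).mul (hH.hasDerivAt_hess hx hx (Y, Y) (Y, 0) (0, W))).const_sub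
      (-τ W)
    refine h.congr_deriv ?_
    simp [gram_apply]
  refine (hH.hasDerivAt_hess hx hx (Y, Y) (x, 0) (0, W)).unique (hd.congr_of_eventuallyEq ?_)
  filter_upwards [hH.eventually_line_mem hx Y] with s hs
  have h := hH.gram_self hs W
  rw [gram_apply, prod_mk_add_zero, prod_mk_smul_zero, map_add, _root_.map_smul, add_apply, smul_apply,
    smul_eq_mul] at h
  rw [line_diag]
  linarith

theorem third_diag_self_right {x : V} (hx : x ∈ Ω) (Y W : V) :
    third H (x, x) (Y, Y) (W, 0) (0, x) = gram H x Y W := by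
  have hd : HasDerivAt (fun s : ℝ => -τ W - s * hess H ((x, x) + s • (Y, Y)) (W, 0) (0, Y))
      (gram H x Y W) 0 := by
    have h := ((hasDerivAt_id (0 : ℝ)).mul (hH.hasDerivAt_hess hx hx (Y, Y) (W, 0) (0, Y))).const_sub
      (-τ W)
    refine h.congr_deriv ?_
    rw [hH.gram_comm hx]
    simp [gram_apply]
  refine (hH.hasDerivAt_hess hx hx (Y, Y) (W, 0) (0, x)).unique (hd.congr_of_eventuallyEq ?_)
  filter_upwards [hH.eventually_line_mem hx Y] with s hs
  have h := hH.gram_self hs W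
  rw [hH.gram_comm hs, gram_apply, prod_mk_zero_add, prod_mk_zero_smul, map_add, _root_.map_smul,
    smul_eq_mul] at h
  rw [line_diag]
  linarith

theorem third_rev {x y : V} (hx : x ∈ Ω) (hy : y ∈ Ω) (u v w : V × V) :
    third H (x, y) u v w = third H (x, y) w v u := by
  rw [hH.third_comm_left hx hy, hH.third_comm_right hx hy, hH.third_comm_left hx hy]

/-- The source of `α`. Euler's identity and the diagonal identities reduce both third derivatives to
`T((0, x), (0, x), (0, W)) = g'''(1) τ(W)`; they contribute `-(g'''(1) + 2)` and `-(g'''(1) + 1)`.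
-/
theorem skew_self {x : V} (hx : x ∈ Ω) (W : V) :
    skew H x x x W = -(2 * deriv (deriv (deriv g)) 1 + 3) * τ W := by
  have hG := hH.gram_self hx W
  have h1 := hH.third_ray hx W
  have hR := hH.gram_eq_hess_right hx x W
  have hM := gram_apply H x x W
  have e1 := hH.third_self_split hx (x, 0) (0, W)
  have e2 := hH.third_self_split hx (0, x) (0, W)
  have e3 := hH.third_comm_left hx hx (x, 0) (0, x) (0, W)
  have e4 := third_diag_split H x W (0, x) (0, x)
  have e5 := hH.third_diag_mixed hx W x x
  have e6 := hH.third_diag_self_left hx W x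
  have e7 := hH.gram_comm hx x W
  have e8 := hH.third_rev hx hx (0, x) (0, x) (W, 0)
  have e9 := hH.third_rev hx hx (0, x) (0, x) (0, W)
  rw [skew_apply]
  linarith

theorem third_self_gram {x : V} (hx : x ∈ Ω) (Y W : V) :
    third H (x, x) (x, x) (Y, 0) (0, W) = gram H x Y W := by
  rw [hH.third_self_left hx hx, gram_apply]

theorem levi_self_right {x : V} (hx : x ∈ Ω) (Y W : V) :
    levi H x Y x W = -(1 / 2) * gram H x Y W := by
  have h : third H (x, x) (Y, 0) (0, x) (W, W) = gram H x Y W := by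
    rw [hH.third_comm_right hx hx, hH.third_comm_left hx hx, hH.third_diag_self_right hx,
      hH.gram_comm hx]
  rw [levi_apply, h, hH.third_diag_self_left hx, hH.third_self_gram hx]
  ring

theorem levi_self_left {x : V} (hx : x ∈ Ω) (Y W : V) :
    levi H x x Y W = -(1 / 2) * gram H x Y W := by
  have h : third H (x, x) (x, 0) (0, Y) (W, W) = gram H x Y W := by
    rw [hH.third_comm_right hx hx, hH.third_comm_left hx hx, hH.third_diag_self_left hx,
      hH.gram_comm hx]
  rw [levi_apply, h, hH.third_diag_self_left hx, hH.third_self_gram hx]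
  ring

theorem chrisForm_self_right {x : V} (hx : x ∈ Ω) (q : ℝ) (Y W : V) :
    chrisForm H q x Y x W = -(1 / 2) * gram H x Y W - q * skew H x x Y W := by
  rw [chrisForm_apply, hH.levi_self_right hx, skew_comm_of_isDivergence hH hx]

theorem chrisForm_self_left {x : V} (hx : x ∈ Ω) (q : ℝ) (Y W : V) :
    chrisForm H q x x Y W = -(1 / 2) * gram H x Y W - q * skew H x x Y W := by
  rw [chrisForm_apply, hH.levi_self_left hx]

theorem chrisForm_self_self {x : V} (hx : x ∈ Ω) (q : ℝ) (W : V) :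
    chrisForm H q x x x W = (-(1 / 2) + q * (2 * deriv (deriv (deriv g)) 1 + 3)) * τ W := by
  rw [hH.chrisForm_self_left hx, hH.gram_self hx, hH.skew_self hx]
  ring

/-- Replaces the mixed third derivatives by pure ones, which are derivatives along rays of the
second derivative in one argument and thus computable from rotations. -/
theorem skew_diag {x : V} (hx : x ∈ Ω) (Y : V) :
    skew H x x Y Y = third H (x, x) (Y, 0) (Y, 0) (x, 0) - third H (x, x) (0, Y) (0, Y) (0, x) := by
  have e1 := hH.third_diag_left hx Y Y x
  have e2 := hH.third_diag_mixed hx Y Y x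
  rw [third_diag_split] at e1 e2
  have f1 := hH.third_rev hx hx (x, 0) (Y, 0) (0, Y)
  have f2 := hH.third_rev hx hx (0, x) (0, Y) (Y, 0)
  rw [skew_apply]
  linarith

end

end IsDivergence

end DivergenceCurvature

end QIG

end

noncomputable section

namespace QIG

open Filter Topology

/-! ### Curvature in planes containing the base point -/

section DivergenceCurvature

set_option maxSynthPendingDepth 3

variable {V : Type*} [NormedAddCommGroup V] [NormedSpace ℝ V]

theorem skew_smul_right (H : V × V → ℝ) (x : V) (c : ℝ) (X Y Z : V) :
    skew H x X (c • Y) Z = c * skew H x X Y Z := by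
  simp only [skew_apply, prod_mk_smul_zero, prod_mk_zero_smul, map_smul, smul_apply, smul_eq_mul]
  ring

theorem skew_add_right (H : V × V → ℝ) (x X Y Y' Z : V) :
    skew H x X (Y + Y') Z = skew H x X Y Z + skew H x X Y' Z := by
  simp only [skew_apply, prod_mk_add_zero, prod_mk_zero_add, map_add, add_apply]
  ring

namespace IsDivergence

variable {H : V × V → ℝ} {Ω : Set V} {τ : V →L[ℝ] ℝ} {g : ℝ → ℝ}

section

variable (hH : IsDivergence H Ω τ g)
include hH

theorem contDiffAt_hess_diag {x : V} (hx : x ∈ Ω) : ContDiffAt ℝ ⊤ (fun z => hess H (z, z)) x :=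
  ContDiffAt.comp (g := hess H) (f := fun z => (z, z)) x (hH.contDiffAt_hess hx hx)
    (contDiffAt_id.prodMk contDiffAt_id)

theorem contDiffAt_third_diag {x : V} (hx : x ∈ Ω) : ContDiffAt ℝ ⊤ (fun z => third H (z, z)) x :=
  ContDiffAt.comp (g := third H) (f := fun z => (z, z)) x (hH.contDiffAt_third hx hx)
    (contDiffAt_id.prodMk contDiffAt_id)

theorem contDiffAt_gram {x : V} (hx : x ∈ Ω) : ContDiffAt ℝ ⊤ (gram H) x := by
  unfold gram
  exact (contDiffAt_const.clm_comp ((hH.contDiffAt_hess_diag hx).clm_comp contDiffAt_const)).neg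

theorem contDiffAt_chrisForm {x : V} (hx : x ∈ Ω) (q : ℝ) (X Y : V) :
    ContDiffAt ℝ ⊤ (fun z => chrisForm H q z X Y) x := by
  have h (u v : V × V) (T : V →L[ℝ] V × V) :
      ContDiffAt ℝ ⊤ (fun z => third H (z, z) u v ∘L T) x :=
    (((hH.contDiffAt_third_diag hx).clm_apply contDiffAt_const).clm_apply
      contDiffAt_const).clm_comp contDiffAt_const
  unfold chrisForm levi skew
  exact (((contDiffAt_const (c := (1 / 2 : ℝ))).smul (((h _ _ _).add (h _ _ _)).sub (h _ _ _))).neg).sub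
    ((contDiffAt_const (c := q)).smul ((h _ _ _).neg.add (h _ _ _)))

theorem exists_gram_equiv [FiniteDimensional ℝ V] {x : V} (hx : x ∈ Ω) :
    ∃ e : V ≃L[ℝ] (V →L[ℝ] ℝ), (e : V →L[ℝ] V →L[ℝ] ℝ) = gram H x := by
  have hinj : Function.Injective (gram H x : V →ₗ[ℝ] V →L[ℝ] ℝ) := fun X X' h =>
    hH.gram_injective hx fun W => DFunLike.congr_fun h W
  have hrank : Module.finrank ℝ V = Module.finrank ℝ (V →L[ℝ] ℝ) := by
    rw [← (LinearMap.toContinuousLinearMap (𝕜 := ℝ) (E := V) (F' := ℝ)).finrank_eq]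
    exact Subspace.dual_finrank_eq.symm
  refine ⟨(LinearMap.linearEquivOfInjective _ hinj hrank).toContinuousLinearEquiv, ?_⟩
  ext X Y
  rfl

theorem gram_inverse_apply [FiniteDimensional ℝ V] {x : V} (hx : x ∈ Ω) (l : V →L[ℝ] ℝ) :
    gram H x ((gram H x).inverse l) = l := by
  obtain ⟨e, he⟩ := hH.exists_gram_equiv hx
  rw [← he, ContinuousLinearMap.inverse_equiv]
  simp

theorem contDiffAt_chris [FiniteDimensional ℝ V] {x : V} (hx : x ∈ Ω) (q : ℝ) (X Y : V) :
    ContDiffAt ℝ ⊤ (fun z => chris H q z X Y) x := by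
  have := FiniteDimensional.complete ℝ V
  obtain ⟨e, he⟩ := hH.exists_gram_equiv hx
  have h : ContDiffAt ℝ ⊤ ContinuousLinearMap.inverse (gram H x) := he ▸ contDiffAt_map_inverse e
  exact (h.comp x (hH.contDiffAt_gram hx)).clm_apply (hH.contDiffAt_chrisForm hx q X Y)

theorem gram_chris [FiniteDimensional ℝ V] {x : V} (hx : x ∈ Ω) (q : ℝ) (X Y W : V) :
    gram H x (chris H q x X Y) W = chrisForm H q x X Y W := by
  rw [chris, hH.gram_inverse_apply hx]

theorem hasDerivAt_gram {x : V} (hx : x ∈ Ω) (X Y Z : V) :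
    HasDerivAt (fun s : ℝ => gram H (x + s • X) Y Z)
      (-third H (x, x) (X, X) (Y, 0) (0, Z)) 0 := by
  refine (hH.hasDerivAt_hess hx hx (X, X) (Y, 0) (0, Z)).neg.congr_of_eventuallyEq ?_
  filter_upwards with s
  rw [Pi.neg_apply, gram_apply, line_diag]

theorem fderiv_gram_apply {x : V} (hx : x ∈ Ω) (X Y Z : V) :
    fderiv ℝ (gram H) x X Y Z = -third H (x, x) (X, X) (Y, 0) (0, Z) := by
  have h := hasDerivAt_line ((hH.contDiffAt_gram hx).differentiableAt (by simp)) X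
  have h2 := (h.clm_apply (hasDerivAt_const (0 : ℝ) Y)).clm_apply (hasDerivAt_const (0 : ℝ) Z)
  have h3 := h2.unique (hH.hasDerivAt_gram hx X Y Z)
  simpa using h3

/-- The product rule for `λ(Γ(Y, Z), W)` moves the derivative to the symbols of the first kind, so
the inverse of the metric never has to be differentiated explicitly. -/
theorem gram_deriv_chris [FiniteDimensional ℝ V] {x : V} (hx : x ∈ Ω) (q : ℝ) (X Y Z W : V)
    {c : ℝ} (hc : HasDerivAt (fun s : ℝ => chrisForm H q (x + s • X) Y Z W) c 0) :
    gram H x (deriv (fun s : ℝ => chris H q (x + s • X) Y Z) 0) W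
      = c + third H (x, x) (X, X) (chris H q x Y Z, 0) (0, W) := by
  have h1 := hasDerivAt_line ((hH.contDiffAt_gram hx).differentiableAt (by simp)) X
  have h2 := hasDerivAt_line ((hH.contDiffAt_chris hx q Y Z).differentiableAt (by simp)) X
  have h3 := (h1.clm_apply h2).clm_apply (hasDerivAt_const (0 : ℝ) W)
  have h4 : HasDerivAt (fun s : ℝ => chrisForm H q (x + s • X) Y Z W) _ 0 :=
    h3.congr_of_eventuallyEq (by
      filter_upwards [hH.eventually_line_mem hx X] with s hs
      rw [hH.gram_chris hs])
  have h5 := hc.unique h4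
  simp only [zero_smul, add_zero, map_zero, add_apply, hH.fderiv_gram_apply hx] at h5
  rw [h2.deriv]
  linarith

theorem hasDerivAt_chrisForm_self {x : V} (hx : x ∈ Ω) (q : ℝ) (Y Z W : V) :
    HasDerivAt (fun s : ℝ => chrisForm H q (x + s • x) Y Z W) (-2 * chrisForm H q x Y Z W) 0 := by
  refine (hasDerivAt_one_add_inv_pow 2 _).congr_of_eventuallyEq ?_
  filter_upwards [eventually_one_add_pos] with s hs
  have e : (x + s • x, x + s • x) = (1 + s) • (x, x) := by
    rw [Prod.smul_mk, add_smul, one_smul]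
  simp only [chrisForm_apply, levi_apply, skew_apply]
  rw [e, hH.third_smul hx hx hs]
  simp only [smul_apply, smul_eq_mul]
  ring

/-- At `z = x + s Y` the form `Γ_z(z, z)` is a constant multiple of `τ`. Expanding it bilinearly
gives the derivative of `Γ_z(x, x)` as minus the terms linear in `Y`. -/
theorem hasDerivAt_chrisForm_base {x : V} (hx : x ∈ Ω) (q : ℝ) (Y W : V) :
    HasDerivAt (fun s : ℝ => chrisForm H q (x + s • Y) x x W)
      (gram H x Y W + 2 * q * skew H x x Y W) 0 := by
  have hd (A B : V) : HasDerivAt (fun s : ℝ => chrisForm H q (x + s • Y) A B W)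
      (fderiv ℝ (fun z => chrisForm H q z A B) x Y W) 0 := by
    simpa using (hasDerivAt_line
      ((hH.contDiffAt_chrisForm hx q A B).differentiableAt (by simp)) Y).clm_apply
      (hasDerivAt_const (0 : ℝ) W)
  set m := -(1 / 2) + q * (2 * deriv (deriv (deriv g)) 1 + 3)
  have h := ((((hasDerivAt_id (0 : ℝ)).mul (hd x Y)).add
    ((hasDerivAt_id (0 : ℝ)).mul (hd Y x))).add
    (((hasDerivAt_id (0 : ℝ)).mul (hasDerivAt_id (0 : ℝ))).mul (hd Y Y))).const_sub (m * τ W)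
  refine (h.congr_of_eventuallyEq ?_).congr_deriv ?_
  · filter_upwards [hH.eventually_line_mem hx Y] with s hs
    have e := hH.chrisForm_self_self hs q W
    simp only [chrisForm_add_left, chrisForm_add_right, chrisForm_smul_left,
      chrisForm_smul_right] at e
    simp only [Pi.add_apply, Pi.mul_apply, id, m]
    linear_combination e
  · simp only [Pi.mul_apply, id, zero_smul, add_zero, hH.chrisForm_self_left hx,
      hH.chrisForm_self_right hx]
    ring

theorem chris_self [FiniteDimensional ℝ V] {x : V} (hx : x ∈ Ω) (q : ℝ) :
    chris H q x x x = (-(1 / 2) + q * (2 * deriv (deriv (deriv g)) 1 + 3)) • x := by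
  refine hH.gram_injective hx fun W => ?_
  rw [hH.gram_chris hx, hH.chrisForm_self_self hx, _root_.map_smul, smul_apply, hH.gram_self hx,
    smul_eq_mul]

/-- Only the part linear in `q` matters for comparing `q` with `-q`, so the quadratic coefficient is
left as an unspecified `S`, which must not depend on `q`. -/
theorem riem_self [FiniteDimensional ℝ V] {x : V} (hx : x ∈ Ω) (Y : V) :
    ∃ S : ℝ, ∀ q : ℝ, riem H q x x Y x Y = q ^ 2 * S
      - q / 2 * ((2 * deriv (deriv (deriv g)) 1 + 3) * gram H x Y Y + skew H x x Y Y) := by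
  set α := 2 * deriv (deriv (deriv g)) 1 + 3 with hα
  set D := (gram H x).inverse (skew H x x Y) with hD
  have hDW (W : V) : gram H x D W = skew H x x Y W := by rw [hD, hH.gram_inverse_apply hx]
  refine ⟨skew H x x D Y + α * skew H x x Y Y, fun q => ?_⟩
  have hP : chris H q x Y x = (-(1 / 2) : ℝ) • Y + (-q) • D := by
    refine hH.gram_injective hx fun W => ?_
    rw [hH.gram_chris hx, hH.chrisForm_self_right hx, map_add, add_apply, _root_.map_smul,
      smul_apply, _root_.map_smul, smul_apply, hDW, smul_eq_mul, smul_eq_mul]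
    ring
  have h1 := hH.gram_deriv_chris hx q x Y x Y (hH.hasDerivAt_chrisForm_self hx q Y x Y)
  have h2 := hH.gram_deriv_chris hx q Y x x Y (hH.hasDerivAt_chrisForm_base hx q Y Y)
  rw [hH.third_self_gram hx, hH.gram_chris hx, hH.chrisForm_self_right hx] at h1
  rw [hH.chris_self hx, prod_mk_smul_zero, _root_.map_smul, smul_apply,
    hH.third_diag_self_left hx, smul_eq_mul, ← hα] at h2
  rw [riem, map_sub, sub_apply, map_add, map_add, add_apply, add_apply, h1, h2,
    hH.gram_chris hx, hH.gram_chris hx, hH.chrisForm_self_left hx, hH.chris_self hx, ← hα,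
    chrisForm_smul_right, hH.chrisForm_self_right hx, hP, skew_add_right, skew_smul_right,
    skew_smul_right, map_add, add_apply, _root_.map_smul, smul_apply, _root_.map_smul, smul_apply,
    hDW, smul_eq_mul, smul_eq_mul]
  ring

/-- If the connections `∇̄ ± D / 2` have the same curvature, the skewness is, in the direction of
the base point, a multiple of the metric. -/
theorem skew_eq_of_riem_eq [FiniteDimensional ℝ V] {x : V} (hx : x ∈ Ω) (Y : V)
    (h : riem H (1 / 2) x x Y x Y = riem H (-(1 / 2)) x x Y x Y) :
    skew H x x Y Y = -(2 * deriv (deriv (deriv g)) 1 + 3) * gram H x Y Y := by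
  obtain ⟨S, hS⟩ := hH.riem_self hx Y
  rw [hS, hS] at h
  linarith

end

end IsDivergence

end DivergenceCurvature

end QIG

end

noncomputable section

namespace QIG

open Filter Topology Matrix

/-! ### Convexity estimates for scalar functions -/

section Scalar

theorem add_deriv_mul_sub_le {g : ℝ → ℝ} {S : Set ℝ} (hg : ConvexOn ℝ S g) {u t : ℝ} (hu : u ∈ S)
    (ht : t ∈ S) (hd : DifferentiableAt ℝ g u) : g u + deriv g u * (t - u) ≤ g t := by
  rcases lt_trichotomy u t with h | h | h
  · have h1 := hg.deriv_le_slope hu ht h hd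
    rw [slope_def_field, le_div_iff₀ (by linarith)] at h1
    linarith
  · simp [h]
  · have h1 := hg.slope_le_deriv ht hu h hd
    rw [slope_def_field, div_le_iff₀ (by linarith)] at h1
    linarith

theorem deriv_deriv_nonneg_of_isLocalMin {f : ℝ → ℝ} {x : ℝ} (h : IsLocalMin f x)
    (hc : ContinuousAt f x) : 0 ≤ deriv (deriv f) x := by
  by_contra! hneg
  have hmax := isLocalMax_of_deriv_deriv_neg hneg h.deriv_eq_zero hc
  have heq : f =ᶠ[𝓝 x] fun _ => f x := by
    filter_upwards [h, hmax] with y h1 h2 using le_antisymm h2 h1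
  have h2 : deriv (deriv f) x = 0 := by
    rw [heq.deriv.deriv_eq]
    simp
  linarith

/-- Away from `1`, the chord from `(1, 0)` forces at least linear growth; on a bounded range this
dominates a small multiple of `(t - 1)²`. -/
theorem exists_mul_sq_le_of_convexOn {k : ℝ → ℝ} (hk : ConvexOn ℝ (Set.Ioi 0) k) (h1 : k 1 = 0)
    {m : ℝ} (hm : 0 < m) (hloc : ∀ᶠ t in 𝓝 (1 : ℝ), m * (t - 1) ^ 2 ≤ k t) (R : ℝ) :
    ∃ c : ℝ, 0 < c ∧ ∀ t : ℝ, 0 < t → t ≤ R → c * (t - 1) ^ 2 ≤ k t := by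
  obtain ⟨δ, hδ, hball⟩ := Metric.eventually_nhds_iff.1 hloc
  set ε := min (δ / 2) (1 / 2) with hε
  have hε0 : 0 < ε := by positivity
  have hεδ : ε < δ := (min_le_left _ _).trans_lt (by linarith)
  have hε1 : ε < 1 := (min_le_right _ _).trans_lt (by norm_num)
  set M := max 1 |R| + 1 with hM
  have hM0 : 1 < M := by have := le_max_left 1 |R|; linarith
  refine ⟨m * ε / M, by positivity, fun t ht htR => ?_⟩
  have htM : |t - 1| ≤ M := by
    have h2 : t ≤ max 1 |R| := htR.trans ((le_abs_self R).trans (le_max_right _ _))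
    rw [abs_le]
    constructor <;> linarith
  rcases lt_or_ge |t - 1| δ with hlt | hge
  · refine le_trans ?_ (hball (by rwa [Real.dist_eq]))
    have : m * ε / M ≤ m := by
      rw [div_le_iff₀ (by linarith)]
      nlinarith
    gcongr
  · set d := |t - 1| with hd
    have hd0 : 0 < d := by linarith
    have hθ : ε / d ≤ 1 := (div_le_one hd0).2 (by linarith)
    have hconv := hk.2 (Set.mem_Ioi.2 one_pos) (Set.mem_Ioi.2 ht)
      (sub_nonneg.2 hθ) (div_pos hε0 hd0).le (by ring)
    simp only [smul_eq_mul, h1, mul_zero, zero_add, mul_one] at hconv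
    have hdist : |1 - ε / d + ε / d * t - 1| = ε := by
      have : 1 - ε / d + ε / d * t - 1 = ε / d * (t - 1) := by ring
      rw [this, abs_mul, ← hd, abs_of_pos (div_pos hε0 hd0), div_mul_cancel₀ _ hd0.ne']
    have hlow := hball (y := 1 - ε / d + ε / d * t) (by rw [Real.dist_eq, hdist]; exact hεδ)
    rw [← sq_abs, hdist] at hlow
    have h3 := hlow.trans hconv
    rw [div_mul_eq_mul_div, le_div_iff₀ hd0] at h3
    have h4 : m * ε * d ≤ k t := by
      have : ε * (m * ε * d) ≤ ε * k t := by nlinarith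
      exact le_of_mul_le_mul_left this hε0
    refine le_trans ?_ h4
    rw [← sq_abs, ← hd, div_mul_eq_mul_div, div_le_iff₀ (by linarith), pow_two, ← mul_assoc]
    gcongr

/-- A normalized operator convex function grows quadratically away from its tangent at `1`. -/
theorem InG.exists_mul_sq_le {g : ℝ → ℝ} (hg : InG g) (R : ℝ) :
    ∃ c : ℝ, 0 < c ∧ ∀ t : ℝ, 0 < t → t ≤ R →
      c * (t - 1) ^ 2 ≤ g t - deriv g 1 * (t - 1) := by
  set a := deriv g 1 with ha
  have hlin : ConvexOn ℝ (Set.Ioi (0 : ℝ)) fun t : ℝ => -(a * (t - 1)) := by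
    refine ⟨convex_Ioi 0, fun x _ y _ s t _ _ hst => ?_⟩
    simp only [smul_eq_mul]
    apply le_of_eq
    linear_combination (-a) * hst
  have hconv : ConvexOn ℝ (Set.Ioi 0) fun t : ℝ => g t - a * (t - 1) := by
    have h := hg.operatorConvex.convexOn.add hlin
    simp only [sub_eq_add_neg (g _)]
    exact h
  have hsm := hg.operatorConvex.contDiffAt one_pos
  have hd : ∀ᶠ t in 𝓝 (1 : ℝ), HasDerivAt g (deriv g t) t := by
    filter_upwards [lt_mem_nhds one_pos] with t ht
    exact ((hg.operatorConvex.contDiffAt ht).differentiableAt (by simp)).hasDerivAt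
  have hd2 : HasDerivAt (deriv g) 1 1 := by
    have h1 : ContDiffAt ℝ ⊤ (deriv g) 1 := by
      have h := (hsm.fderiv_right (m := ⊤) le_top).clm_apply (contDiffAt_const (c := (1 : ℝ)))
      exact h
    have h2 := (h1.differentiableAt (by simp)).hasDerivAt
    have h3 := hg.second_deriv_one
    rw [iteratedDeriv_succ, iteratedDeriv_one] at h3
    rwa [h3] at h2
  have hderiv : deriv (fun t : ℝ => g t - a * (t - 1) - 1 / 4 * (t - 1) ^ 2) =ᶠ[𝓝 1]
      fun t => deriv g t - a - 1 / 2 * (t - 1) := by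
    filter_upwards [hd] with t ht
    have h1 : HasDerivAt (fun t : ℝ => t - 1) 1 t := (hasDerivAt_id t).sub_const 1
    have h2 := (ht.sub (h1.const_mul a)).sub ((h1.pow 2).const_mul (1 / 4 : ℝ))
    refine h2.deriv.trans ?_
    norm_num
    ring
  -- Any coefficient below `1/2` would do; with `1/4` the second derivative at `1` is `1/2 > 0`.
  have hmin : IsLocalMin (fun t : ℝ => g t - a * (t - 1) - 1 / 4 * (t - 1) ^ 2) 1 := by
    refine isLocalMin_of_deriv_deriv_pos ?_ ?_ ?_
    · rw [hderiv.deriv_eq]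
      have h1 : HasDerivAt (fun t : ℝ => t - 1) 1 1 := (hasDerivAt_id 1).sub_const 1
      have h2 := ((hd2.sub_const a).sub (h1.const_mul (1 / 2 : ℝ))).deriv
      refine lt_of_lt_of_eq ?_ h2.symm
      norm_num
    · rw [hderiv.eq_of_nhds, ha]
      ring
    · have := hsm.continuousAt
      fun_prop
  refine exists_mul_sq_le_of_convexOn hconv (by simp [hg.map_one]) (m := 1 / 4) (by norm_num) ?_ R
  filter_upwards [hmin] with t ht
  simp only [hg.map_one, sub_self] at ht
  linarith

end Scalar

/-! ### Positive definite matrices: bounds, openness, smooth inverse -/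

section MatrixFacts

variable {p : Type*} [Fintype p] [DecidableEq p]

/-- Supplies a locally uniform bound on the spectrum of `L_σ / R_ρ`, the range on which the
quadratic estimate is used. -/
theorem le_trace_of_mem_spectrum {T : Matrix p p ℂ} (hT : T.PosDef) {x : ℝ}
    (hx : x ∈ spectrum ℝ T) : x ≤ T.trace.re := by
  rw [hT.1.spectrum_real_eq_range_eigenvalues] at hx
  obtain ⟨i, rfl⟩ := hx
  rw [hT.1.trace_eq_sum_eigenvalues, Complex.re_sum]
  exact Finset.single_le_sum (f := fun j => ((hT.1.eigenvalues j : ℂ)).re)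
    (fun j _ => (hT.posSemidef.eigenvalues_nonneg j)) (Finset.mem_univ i)

theorem trace_mul_mul_inv_pos {ρ X : Matrix p p ℂ} (hρ : ρ.PosDef) (hX : X.IsHermitian)
    (hX0 : X ≠ 0) : 0 < (trace (X * X * ρ⁻¹)).re := by
  have hi := hρ.inv
  obtain ⟨i, j, hij⟩ : ∃ i j, X i j ≠ 0 := by
    by_contra! h
    exact hX0 (by ext i j; exact h i j)
  have htr : trace (X * X * ρ⁻¹) = ∑ j, star (fun i => X i j) ⬝ᵥ ρ⁻¹ *ᵥ (fun i => X i j) := by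
    have h : X * X * ρ⁻¹ = X * (Xᴴ * ρ⁻¹) := by rw [hX.eq, Matrix.mul_assoc]
    rw [h, trace_mul_comm, Matrix.mul_assoc]
    rfl
  rw [htr, Complex.re_sum]
  refine Finset.sum_pos' (fun j _ => hi.posSemidef.re_dotProduct_nonneg _)
    ⟨j, Finset.mem_univ j, hi.re_dotProduct_pos fun h => hij (congrFun h i)⟩

/-- Positivity of the quadratic form is an open condition, uniformly over the compact unit sphere;
homogeneity extends it to all vectors. -/
theorem eventually_posDef {V : Type*} [TopologicalSpace V] {T : V → Matrix p p ℂ} {v : V}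
    (hT : ContinuousAt T v) (hherm : ∀ᶠ w in 𝓝 v, (T w).IsHermitian) (hpos : (T v).PosDef) :
    ∀ᶠ w in 𝓝 v, (T w).PosDef := by
  have hev : ∀ᶠ w in 𝓝 v, ∀ x ∈ Metric.sphere (0 : p → ℂ) 1, 0 < (star x ⬝ᵥ T w *ᵥ x).re := by
    refine (isCompact_sphere _ _).eventually_forall_of_forall_eventually fun x hx => ?_
    have hx0 : x ≠ 0 := by
      rintro rfl
      simp at hx
    have hc : ContinuousAt (fun z : V × (p → ℂ) => (star z.2 ⬝ᵥ T z.1 *ᵥ z.2).re) (v, x) := by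
      have hT1 : ContinuousAt (fun z : V × (p → ℂ) => T z.1) (v, x) :=
        ContinuousAt.comp (x := (v, x)) hT continuousAt_fst
      have hTij (i j : p) : ContinuousAt (fun z : V × (p → ℂ) => T z.1 i j) (v, x) :=
        (continuous_apply_apply i j).continuousAt.comp hT1
      simp only [dotProduct, mulVec, Pi.star_apply]
      refine Complex.continuous_re.continuousAt.comp ?_
      refine tendsto_finsetSum _ fun i _ => ContinuousAt.mul (by fun_prop) ?_
      exact tendsto_finsetSum _ fun j _ => (hTij i j).mul (by fun_prop)
    exact hc.eventually (lt_mem_nhds (hpos.re_dotProduct_pos hx0))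
  filter_upwards [hev, hherm] with w hw hh
  refine PosDef.of_dotProduct_mulVec_pos hh fun x hx => ?_
  have hn : 0 < ‖x‖ := norm_pos_iff.2 hx
  have h1 := hw ((‖x‖ : ℂ)⁻¹ • x) (by simp [norm_smul, hn.ne'])
  have h2 : star ((‖x‖ : ℂ)⁻¹ • x) ⬝ᵥ T w *ᵥ ((‖x‖ : ℂ)⁻¹ • x)
      = (((‖x‖⁻¹) ^ 2 : ℝ) : ℂ) * (star x ⬝ᵥ T w *ᵥ x) := by
    rw [star_smul, smul_dotProduct, mulVec_smul, dotProduct_smul]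
    simp only [smul_eq_mul, RCLike.star_def, map_inv₀, Complex.conj_ofReal]
    push_cast
    ring
  rw [h2, Complex.re_ofReal_mul] at h1
  have h3 : 0 < (star x ⬝ᵥ T w *ᵥ x).re := (mul_pos_iff_of_pos_left (by positivity)).1 h1
  have him : (star x ⬝ᵥ T w *ᵥ x).im = 0 := hh.im_star_dotProduct_mulVec_self x
  exact Complex.lt_def.2 ⟨by simpa using h3, by simpa using him.symm⟩

variable {V : Type*} [NormedAddCommGroup V] [NormedSpace ℝ V]

theorem contDiffAt_det {T : V → Matrix p p ℂ} {v : V} {k : WithTop ℕ∞}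
    (hT : ∀ i j, ContDiffAt ℝ k (fun w => T w i j) v) :
    ContDiffAt ℝ k (fun w => (T w).det) v := by
  simp only [det_apply]
  exact ContDiffAt.sum fun σ _ => (contDiffAt_prod fun i _ => hT _ _).const_smul _

theorem contDiffAt_inv {T : V → Matrix p p ℂ} {v : V} {k : WithTop ℕ∞}
    (hT : ∀ i j, ContDiffAt ℝ k (fun w => T w i j) v) (hdet : (T v).det ≠ 0) (i j : p) :
    ContDiffAt ℝ k (fun w => (T w)⁻¹ i j) v := by
  simp only [inv_def, Ring.inverse_eq_inv', Matrix.smul_apply, smul_eq_mul, adjugate_apply]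
  refine ((contDiffAt_det hT).inv hdet).mul (contDiffAt_det fun a b => ?_)
  simp only [updateRow_apply]
  split_ifs
  · exact contDiffAt_const
  · exact hT a b

end MatrixFacts

end QIG

end

noncomputable section

namespace QIG

open Filter Topology Matrix

/-! ### The relative entropy in coordinates is a divergence -/

section Chart

variable {n : ℕ} {V : Type*} [NormedAddCommGroup V] [NormedSpace ℝ V]

/-- A linear parametrization of the hermitian matrices by a normed space. -/
structure IsHermitianChart (ι : V →ₗ[ℝ] Matrix (Fin n) (Fin n) ℂ) : Prop where
  injective : Function.Injective ι
  isHermitian_iff : ∀ {A : Matrix (Fin n) (Fin n) ℂ}, A.IsHermitian ↔ ∃ v, ι v = A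

theorem IsHermitianChart.isHermitian {ι : V →ₗ[ℝ] Matrix (Fin n) (Fin n) ℂ}
    (hι : IsHermitianChart ι) (v : V) : (ι v).IsHermitian := hι.isHermitian_iff.2 ⟨v, rfl⟩

/-- Coordinates on the real space of hermitian matrices, in which the positive definite cone is
open, as Fréchet derivatives require. -/
theorem exists_isHermitianChart (n : ℕ) :
    ∃ (d : ℕ) (ι : (Fin d → ℝ) →ₗ[ℝ] Matrix (Fin n) (Fin n) ℂ), IsHermitianChart ι := by
  let S := selfAdjoint.submodule ℝ (Matrix (Fin n) (Fin n) ℂ)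
  let e := (Module.finBasis ℝ S).equivFun
  refine ⟨_, S.subtype ∘ₗ e.symm.toLinearMap, S.injective_subtype.comp e.symm.injective,
    fun {A} => ⟨fun hA => ⟨e ⟨A, hA⟩, by simp⟩, ?_⟩⟩
  rintro ⟨v, rfl⟩
  exact (e.symm v).2

/-- The relative entropy in coordinates. -/
def entropyFun (g : ℝ → ℝ) (ι : V →ₗ[ℝ] Matrix (Fin n) (Fin n) ℂ) (z : V × V) : ℝ :=
  relEntropy g (ι z.1) (ι z.2)

/-- The positive definite matrices in coordinates. -/
def posDefCone (ι : V →ₗ[ℝ] Matrix (Fin n) (Fin n) ℂ) : Set V := {v | (ι v).PosDef}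

theorem mem_posDefCone {ι : V →ₗ[ℝ] Matrix (Fin n) (Fin n) ℂ} {v : V} :
    v ∈ posDefCone ι ↔ (ι v).PosDef := Iff.rfl

variable [FiniteDimensional ℝ V]

/-- The trace in coordinates. -/
def traceForm (ι : V →ₗ[ℝ] Matrix (Fin n) (Fin n) ℂ) : V →L[ℝ] ℝ :=
  LinearMap.toContinuousLinearMap (Complex.reLm ∘ₗ traceLinearMap (Fin n) ℝ ℂ ∘ₗ ι)

theorem traceForm_apply (ι : V →ₗ[ℝ] Matrix (Fin n) (Fin n) ℂ) (v : V) :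
    traceForm ι v = (ι v).trace.re := rfl

/-- A matrix entry in coordinates. -/
def entryForm (ι : V →ₗ[ℝ] Matrix (Fin n) (Fin n) ℂ) (i j : Fin n) : V →L[ℝ] ℂ :=
  LinearMap.toContinuousLinearMap (entryLinearMap ℝ ℂ i j ∘ₗ ι)

theorem entryForm_apply (ι : V →ₗ[ℝ] Matrix (Fin n) (Fin n) ℂ) (i j : Fin n) (v : V) :
    entryForm ι i j v = ι v i j := rfl

namespace IsHermitianChart

variable {ι : V →ₗ[ℝ] Matrix (Fin n) (Fin n) ℂ}

theorem continuous (ι : V →ₗ[ℝ] Matrix (Fin n) (Fin n) ℂ) : Continuous ι :=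
  continuous_matrix fun i j => (entryForm ι i j).continuous

section

variable (hι : IsHermitianChart ι)
include hι

theorem isOpen_posDefCone : IsOpen (posDefCone ι) := by
  refine isOpen_iff_mem_nhds.2 fun v hv => ?_
  exact eventually_posDef (continuous ι).continuousAt (Eventually.of_forall hι.isHermitian) hv

theorem contDiffAt_entropyFun {g : ℝ → ℝ} (hg : OperatorConvex g) {x y : V}
    (hx : x ∈ posDefCone ι) (hy : y ∈ posDefCone ι) :
    ContDiffAt ℝ ⊤ (entropyFun g ι) (x, y) := by
  have hentry (i j : Fin n) (v : V) : ContDiffAt ℝ ⊤ (fun w => ι w i j) v :=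
    (entryForm ι i j).contDiff.contDiffAt
  have hpos : ∀ᶠ z : V × V in 𝓝 (x, y), (ι z.1).PosDef ∧ (ι z.2).PosDef := by
    refine ((hι.isOpen_posDefCone.prod hι.isOpen_posDefCone).mem_nhds ⟨hx, hy⟩)
  have h1 (i j : Fin n) : ContDiffAt ℝ ⊤ (fun z : V × V => ι z.1 i j) (x, y) :=
    (hentry i j x).comp (x, y) contDiffAt_fst
  have h2 (i j : Fin n) : ContDiffAt ℝ ⊤ (fun z : V × V => ι z.2 i j) (x, y) :=
    (hentry i j y).comp (x, y) contDiffAt_snd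
  have hinv (i j : Fin n) : ContDiffAt ℝ ⊤ (fun z : V × V => (ι z.1)⁻¹ i j) (x, y) :=
    contDiffAt_inv h1 hx.det_pos.ne' i j
  have hcfc := hg.contDiffAt_cfc (T := fun z : V × V => relModular (ι z.2) (ι z.1)) (v := (x, y))
    (fun a b => (h2 a.1 b.1).mul (hinv b.2 a.2))
    (hpos.mono fun z hz => (posDef_relModular hz.1 hz.2).1) (posDef_relModular hx hy)
  have htr : ContDiffAt ℝ ⊤ (fun z : V × V =>
      ((applyOp (cfc g (relModular (ι z.2) (ι z.1))) (ι z.1)).trace).re) (x, y) := by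
    refine Complex.reCLM.contDiff.contDiffAt.comp (x, y) ?_
    exact ContDiffAt.sum fun i _ => ContDiffAt.sum fun a _ => (hcfc _ _).mul (h1 _ _)
  refine htr.congr_of_eventuallyEq ?_
  filter_upwards [hpos] with z hz
  exact relEntropy_eq_trace g hz.1 hz.2

/-- Replacing `g` by its tangent at `u` gives a linear minorant `L` of the entropy, with equality at
`(x, u x)`. The difference has a minimum there, so the derivative is `L`. -/
theorem fderiv_entropyFun_ray {g : ℝ → ℝ} (hg : OperatorConvex g) {x : V} {u : ℝ}
    (hx : x ∈ posDefCone ι) (hu : 0 < u) :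
    fderiv ℝ (entropyFun g ι) (x, u • x)
      = ((g u - u * deriv g u) • traceForm ι) ∘L ContinuousLinearMap.fst ℝ V V
        + (deriv g u • traceForm ι) ∘L ContinuousLinearMap.snd ℝ V V := by
  set L := ((g u - u * deriv g u) • traceForm ι) ∘L ContinuousLinearMap.fst ℝ V V
        + (deriv g u • traceForm ι) ∘L ContinuousLinearMap.snd ℝ V V with hL
  have hux : u • x ∈ posDefCone ι := by
    rw [mem_posDefCone, _root_.map_smul]
    exact hx.smul hu
  have hLz (z : V × V) (h1 : (ι z.1).PosDef) (h2 : (ι z.2).PosDef) :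
      L z = relEntropy (fun t => (g u - u * deriv g u) + deriv g u * t + 0 * t ^ 2)
        (ι z.1) (ι z.2) := by
    rw [relEntropy_quadratic _ _ _ h1 h2]
    simp [hL, traceForm_apply]
  have hmin : IsLocalMin (fun z => entropyFun g ι z - L z) (x, u • x) := by
    filter_upwards [(hι.isOpen_posDefCone.prod hι.isOpen_posDefCone).mem_nhds ⟨hx, hux⟩]
      with z hz
    have e : entropyFun g ι (x, u • x) - L (x, u • x) = 0 := by
      rw [hLz (x, u • x) hx hux, entropyFun]
      simp only [_root_.map_smul]
      rw [relEntropy_smul_self g hx, relEntropy_smul_self _ hx]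
      ring
    rw [e, hLz z hz.1 hz.2, sub_nonneg]
    refine relEntropy_mono fun t ht => ?_
    have ht0 := spectrum_pos (posDef_relModular hz.1 hz.2) ht
    have h := add_deriv_mul_sub_le hg.convexOn (Set.mem_Ioi.2 hu) (Set.mem_Ioi.2 ht0)
      ((hg.contDiffAt hu).differentiableAt (by simp))
    linarith
  have h0 := hmin.fderiv_eq_zero
  rw [fderiv_fun_sub ((hι.contDiffAt_entropyFun hg hx hux).differentiableAt (by simp))
    L.differentiableAt, L.fderiv, sub_eq_zero] at h0
  exact h0

/-- Compares `g` with its tangent at `1` plus `c (t - 1)²`, whose entropy is explicit; the quadratic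
gain is `c Tr(X² ρ⁻¹) s²`. -/
theorem exists_mul_sq_le_entropyFun {g : ℝ → ℝ} (hg : InG g) {x X : V}
    (hx : x ∈ posDefCone ι) (hX : X ≠ 0) :
    ∃ c : ℝ, 0 < c ∧ ∀ᶠ s : ℝ in 𝓝 0,
      s * (deriv g 1 * traceForm ι X) + c * s ^ 2 ≤ entropyFun g ι (x, x + s • X) := by
  have hline : ContinuousAt (fun s : ℝ => x + s • X) 0 := by fun_prop
  have hev : ∀ᶠ s : ℝ in 𝓝 0, x + s • X ∈ posDefCone ι :=
    hline.eventually (hι.isOpen_posDefCone.mem_nhds (by simpa using hx))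
  have htr : ContinuousAt (fun s : ℝ => (relModular (ι (x + s • X)) (ι x)).trace.re) 0 := by
    simp only [relModular, trace_kronecker]
    have : Continuous fun s : ℝ => ι (x + s • X) := (continuous ι).comp (by fun_prop)
    exact (Complex.continuous_re.comp (this.matrix_trace.mul continuous_const)).continuousAt
  set R := (relModular (ι (x + (0 : ℝ) • X)) (ι x)).trace.re + 1
  have hR := htr.eventually (gt_mem_nhds (lt_add_one _))
  obtain ⟨c, hc, hcR⟩ := hg.exists_mul_sq_le R
  set Q := (trace (ι X * ι X * (ι x)⁻¹)).re with hQ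
  have hQ0 : 0 < Q := trace_mul_mul_inv_pos hx (hι.isHermitian X) fun h =>
    hX (hι.injective (by rw [h, map_zero]))
  refine ⟨c * Q, by positivity, ?_⟩
  filter_upwards [hev, hR] with s hs hsR
  have hT := posDef_relModular hx hs
  have hmono : relEntropy (fun t => (c - deriv g 1) + (deriv g 1 - 2 * c) * t + c * t ^ 2)
      (ι x) (ι (x + s • X)) ≤ relEntropy g (ι x) (ι (x + s • X)) := by
    refine relEntropy_mono fun t ht => ?_
    have h := hcR t (spectrum_pos hT ht) ((le_trace_of_mem_spectrum hT ht).trans hsR.le)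
    linarith
  rw [relEntropy_quadratic _ _ _ hx hs] at hmono
  refine le_of_eq_of_le ?_ hmono
  have hdet : IsUnit (ι x).det := hx.det_pos.ne'.isUnit
  have hsq : (ι (x + s • X) * ι (x + s • X) * (ι x)⁻¹).trace.re
      = (ι x).trace.re + 2 * s * (ι X).trace.re + s ^ 2 * Q := by
    have e : ι (x + s • X) * ι (x + s • X) * (ι x)⁻¹
        = ι x + s • (ι x * ι X * (ι x)⁻¹) + s • ι X + (s * s) • (ι X * ι X * (ι x)⁻¹) := by
      rw [map_add, _root_.map_smul]
      simp only [Matrix.add_mul, Matrix.mul_add, Matrix.smul_mul, Matrix.mul_smul, smul_add,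
        smul_smul]
      rw [Matrix.mul_assoc (ι x) (ι x), Matrix.mul_assoc (ι X) (ι x),
        Matrix.mul_nonsing_inv _ hdet, Matrix.mul_one, Matrix.mul_one]
      abel
    have hcyc : trace (ι x * ι X * (ι x)⁻¹) = trace (ι X) := by
      rw [trace_mul_comm, ← Matrix.mul_assoc, Matrix.nonsing_inv_mul _ hdet, Matrix.one_mul]
    rw [e]
    simp only [trace_add, trace_smul, hcyc, Complex.add_re, Complex.smul_re, smul_eq_mul, ← hQ]
    ring
  rw [hsq, traceForm_apply, map_add, _root_.map_smul, trace_add, trace_smul, Complex.add_re,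
    Complex.smul_re, smul_eq_mul]
  ring

theorem hess_entropyFun_pos {g : ℝ → ℝ} (hg : InG g) {x X : V} (hx : x ∈ posDefCone ι)
    (hX : X ≠ 0) : 0 < hess (entropyFun g ι) (x, x) (0, X) (0, X) := by
  obtain ⟨c, hc, hev⟩ := hι.exists_mul_sq_le_entropyFun hg hx hX
  set H := entropyFun g ι with hH
  set b := deriv g 1 * traceForm ι X
  have e (s : ℝ) : (x, x) + s • ((0 : V), X) = (x, x + s • X) := by simp
  have hline : ∀ᶠ s : ℝ in 𝓝 0, x + s • X ∈ posDefCone ι := by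
    have hc : ContinuousAt (fun s : ℝ => x + s • X) 0 := by fun_prop
    exact hc.eventually (hι.isOpen_posDefCone.mem_nhds (by simpa using hx))
  have hpoly (s : ℝ) : HasDerivAt (fun s : ℝ => s * b + c * s ^ 2) (b + 2 * c * s) s := by
    have h := ((hasDerivAt_id s).mul_const b).add (((hasDerivAt_id s).pow 2).const_mul c)
    refine h.congr_deriv ?_
    simp only [id, Nat.cast_ofNat, Nat.add_one_sub_one, pow_one]
    ring
  have hd : ∀ᶠ s : ℝ in 𝓝 0, HasDerivAt (fun s : ℝ => H (x, x + s • X) - (s * b + c * s ^ 2))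
      (fderiv ℝ H ((x, x) + s • (0, X)) (0, X) - (b + 2 * c * s)) s := by
    filter_upwards [hline] with s hs
    have hdiff : DifferentiableAt ℝ H ((x, x) + s • ((0 : V), X)) := by
      rw [e]
      exact (hι.contDiffAt_entropyFun hg.operatorConvex hx hs).differentiableAt (by simp)
    have h := (hasDerivAt_line_at hdiff).sub (hpoly s)
    refine h.congr_of_eventuallyEq (Eventually.of_forall fun r => ?_)
    simp only [Pi.sub_apply, e]
  have hfd : DifferentiableAt ℝ (fderiv ℝ H) (x, x) :=
    ((hι.contDiffAt_entropyFun hg.operatorConvex hx hx).fderiv_right (m := ⊤)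
      le_top).differentiableAt (by simp)
  have h2 : deriv (deriv fun s : ℝ => H (x, x + s • X) - (s * b + c * s ^ 2)) 0
      = hess H (x, x) (0, X) (0, X) - 2 * c := by
    have heq := hd.mono fun s hs => hs.deriv
    rw [EventuallyEq.deriv_eq heq]
    have h3 := ((hasDerivAt_line hfd (0, X)).clm_apply (hasDerivAt_const (0 : ℝ) (0, X))).sub
      (((hasDerivAt_id (0 : ℝ)).const_mul (2 * c)).const_add b)
    refine h3.deriv.trans ?_
    simp [hess]
  have hmin : IsLocalMin (fun s : ℝ => H (x, x + s • X) - (s * b + c * s ^ 2)) 0 := by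
    filter_upwards [hev] with s hs
    have h0 : H (x, x) = 0 := by
      have h := relEntropy_smul_self g hx 1
      rw [one_smul, hg.map_one, zero_mul] at h
      exact h
    simp only [zero_smul, add_zero, h0]
    linarith
  have h3 := deriv_deriv_nonneg_of_isLocalMin hmin hd.self_of_nhds.continuousAt
  rw [h2] at h3
  linarith

theorem isDivergence {g : ℝ → ℝ} (hg : InG g) :
    IsDivergence (entropyFun g ι) (posDefCone ι) (traceForm ι) g where
  isOpen := hι.isOpen_posDefCone
  smul_mem hx hc := by
    rw [mem_posDefCone, _root_.map_smul]
    exact hx.smul hc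
  contDiffAt hx hy := hι.contDiffAt_entropyFun hg.operatorConvex hx hy
  map_smul hx hy hc := by
    simp only [entropyFun, _root_.map_smul]
    exact relEntropy_smul_smul g hx hy hc
  fderiv_right W hx hu := by
    rw [hι.fderiv_entropyFun_ray hg.operatorConvex hx hu]
    simp
  fderiv_left W hx hu := by
    rw [hι.fderiv_entropyFun_ray hg.operatorConvex hx hu]
    simp
  hess_pos hx hX := hι.hess_entropyFun_pos hg hx hX
  contDiffAt_fun hu := hg.operatorConvex.contDiffAt hu
  second_deriv_one := by
    have h := hg.second_deriv_one
    rwa [iteratedDeriv_succ, iteratedDeriv_one] at h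

end

end IsHermitianChart

end Chart

end QIG

end

noncomputable section

namespace QIG

open Filter Topology Matrix

/-! ### Iterated directional derivatives as Fréchet derivatives -/

section IteratedDerivatives

set_option maxSynthPendingDepth 3

variable {V : Type*} [NormedAddCommGroup V] [NormedSpace ℝ V]
  {H : V × V → ℝ} {Ω : Set V} {τ : V →L[ℝ] ℝ} {g : ℝ → ℝ}

theorem IsDivergence.deriv_line (hH : IsDivergence H Ω τ g) {z : V × V} (hz : z ∈ Ω ×ˢ Ω)
    (P : V × V) : deriv (fun s : ℝ => H (z + s • P)) 0 = fderiv ℝ H z P :=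
  (hasDerivAt_line ((hH.contDiffAt hz.1 hz.2).differentiableAt (by simp)) P).deriv

theorem IsDivergence.deriv_deriv_line (hH : IsDivergence H Ω τ g) {z : V × V} (hz : z ∈ Ω ×ˢ Ω)
    (P Q : V × V) :
    deriv (fun s : ℝ => deriv (fun t : ℝ => H (z + s • P + t • Q)) 0) 0 = hess H z P Q := by
  have h : (fun s : ℝ => deriv (fun t : ℝ => H (z + s • P + t • Q)) 0)
      =ᶠ[𝓝 0] fun s => fderiv ℝ H (z + s • P) Q := by
    filter_upwards [hH.eventually_line hz.1 hz.2 P] with s hs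
    exact hH.deriv_line hs Q
  rw [h.deriv_eq]
  exact (hH.hasDerivAt_fderiv hz.1 hz.2 P Q).deriv

theorem IsDivergence.deriv_deriv_deriv_line (hH : IsDivergence H Ω τ g) {z : V × V}
    (hz : z ∈ Ω ×ˢ Ω) (P Q R : V × V) :
    deriv (fun s : ℝ => deriv (fun t : ℝ => deriv (fun u : ℝ =>
      H (z + s • P + t • Q + u • R)) 0) 0) 0 = third H z P Q R := by
  have h : (fun s : ℝ => deriv (fun t : ℝ => deriv (fun u : ℝ =>
      H (z + s • P + t • Q + u • R)) 0) 0) =ᶠ[𝓝 0] fun s => hess H (z + s • P) Q R := by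
    filter_upwards [hH.eventually_line hz.1 hz.2 P] with s hs
    exact hH.deriv_deriv_line hs Q R
  rw [h.deriv_eq]
  exact (hH.hasDerivAt_hess hz.1 hz.2 P Q R).deriv

end IteratedDerivatives

/-! ### From matrices to coordinates: metric, connections, curvature -/

section Transfer

set_option maxSynthPendingDepth 3

variable {n : ℕ} {V : Type*} [NormedAddCommGroup V] [NormedSpace ℝ V] [FiniteDimensional ℝ V]
  {ι : V →ₗ[ℝ] Matrix (Fin n) (Fin n) ℂ} {g : ℝ → ℝ}

namespace IsHermitianChart

variable (hι : IsHermitianChart ι) (hg : InG g)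
include hι hg

theorem metric_eq {x : V} (hx : x ∈ posDefCone ι) (X Y : V) :
    metric g (ι x) (ι X) (ι Y) = gram (entropyFun g ι) x X Y := by
  rw [gram_apply, ← (hι.isDivergence hg).deriv_deriv_line (z := (x, x)) ⟨hx, hx⟩, metric]
  simp [entropyFun]

theorem metric_hat_eq {x : V} (hx : x ∈ posDefCone ι) (X Y : V) :
    metric (hat g) (ι x) (ι X) (ι Y) = gram (entropyFun g ι) x X Y := by
  have hH := hι.isDivergence hg
  rw [hH.gram_comm hx, gram_apply, hH.hess_comm hx hx,
    ← hH.deriv_deriv_line (z := (x, x)) ⟨hx, hx⟩, metric]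
  congr 1
  refine EventuallyEq.deriv_eq ?_
  filter_upwards [hH.eventually_line_mem hx X] with s hs
  refine EventuallyEq.deriv_eq ?_
  filter_upwards [hH.eventually_line_mem hx Y] with t ht
  have h := relEntropy_hat g (mem_posDefCone.1 hs) (mem_posDefCone.1 ht)
  simpa [entropyFun] using h

/-- The choice in `metricDual` is forced, since the metric is nondegenerate. The function `f` is `g`
or `ĝ`, which induce the same metric. -/
theorem metricDual_eq {f : ℝ → ℝ} {x : V} (hx : x ∈ posDefCone ι)
    (hf : ∀ X Y, metric f (ι x) (ι X) (ι Y) = gram (entropyFun g ι) x X Y)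
    {l : Matrix (Fin n) (Fin n) ℂ → ℝ} {L : V →L[ℝ] ℝ} (hl : ∀ Z, l (ι Z) = L Z) :
    metricDual f (ι x) l = ι ((gram (entropyFun g ι) x).inverse L) := by
  have hH := hι.isDivergence hg
  have hex : ∃ W : Matrix (Fin n) (Fin n) ℂ,
      W.IsHermitian ∧ ∀ Z, Z.IsHermitian → metric f (ι x) W Z = l Z := by
    refine ⟨ι ((gram (entropyFun g ι) x).inverse L), hι.isHermitian _, fun Z hZ => ?_⟩
    obtain ⟨Z, rfl⟩ := hι.isHermitian_iff.1 hZ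
    rw [hf, hl, hH.gram_inverse_apply hx]
  obtain ⟨hW, hWZ⟩ := Classical.epsilon_spec hex
  change (metricDual f (ι x) l).IsHermitian at hW
  obtain ⟨w, hw⟩ := hι.isHermitian_iff.1 hW
  rw [← hw]
  congr 1
  refine hH.gram_injective hx fun Z => ?_
  rw [hH.gram_inverse_apply hx, ← hl, ← hWZ _ (hι.isHermitian Z), ← hf, hw]
  rfl

theorem entropyConn_eq {x : V} (hx : x ∈ posDefCone ι) (X Y : V) :
    entropyConn g (ι x) (ι X) (ι Y) = ι ((gram (entropyFun g ι) x).inverse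
      (-(third (entropyFun g ι) (x, x) (X, 0) (Y, 0) ∘L ContinuousLinearMap.inr ℝ V V))) := by
  have hH := hι.isDivergence hg
  refine hι.metricDual_eq hg hx (fun X Y => hι.metric_eq hg hx X Y) fun Z => ?_
  have h := hH.deriv_deriv_deriv_line (z := (x, x)) ⟨hx, hx⟩ (X, 0) (Y, 0) (0, Z)
  refine (congrArg Neg.neg ?_).trans (congrArg Neg.neg h)
  simp [entropyFun]

theorem entropyConn_hat_eq {x : V} (hx : x ∈ posDefCone ι) (X Y : V) :
    entropyConn (hat g) (ι x) (ι X) (ι Y) = ι ((gram (entropyFun g ι) x).inverse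
      (-(third (entropyFun g ι) (x, x) (0, X) (0, Y) ∘L ContinuousLinearMap.inl ℝ V V))) := by
  have hH := hι.isDivergence hg
  refine hι.metricDual_eq hg hx (fun X Y => hι.metric_hat_eq hg hx X Y) fun Z => ?_
  have h := hH.deriv_deriv_deriv_line (z := (x, x)) ⟨hx, hx⟩ (0, X) (0, Y) (Z, 0)
  refine (congrArg Neg.neg ?_).trans (congrArg Neg.neg h)
  refine EventuallyEq.deriv_eq ?_
  filter_upwards [hH.eventually_line_mem hx X] with s hs
  refine EventuallyEq.deriv_eq ?_
  filter_upwards [hH.eventually_line_mem hs Y] with t ht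
  refine EventuallyEq.deriv_eq ?_
  filter_upwards [hH.eventually_line_mem hx Z] with u hu
  have h := relEntropy_hat g (mem_posDefCone.1 ht) (mem_posDefCone.1 hu)
  simpa [entropyFun] using h

theorem skewTensor_eq {x : V} (hx : x ∈ posDefCone ι) (X Y : V) :
    skewTensor g (ι x) (ι X) (ι Y)
      = ι ((gram (entropyFun g ι) x).inverse (skew (entropyFun g ι) x X Y)) := by
  rw [skewTensor, hι.entropyConn_eq hg hx, hι.entropyConn_hat_eq hg hx, ← map_sub, ← map_sub,
    sub_neg_eq_add, skew]

theorem derivAlong_metric {x : V} (hx : x ∈ posDefCone ι) (X Y Z : V) :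
    derivAlong (fun ρ => metric g ρ (ι Y) (ι Z)) (ι x) (ι X)
      = -third (entropyFun g ι) (x, x) (X, X) (Y, 0) (0, Z) := by
  have hH := hι.isDivergence hg
  rw [← (hH.hasDerivAt_gram hx X Y Z).deriv, derivAlong]
  refine EventuallyEq.deriv_eq ?_
  filter_upwards [hH.eventually_line_mem hx X] with s hs
  rw [← hι.metric_eq hg hs, map_add, _root_.map_smul]

theorem metricConn_eq {x : V} (hx : x ∈ posDefCone ι) (X Y : V) :
    metricConn g (ι x) (ι X) (ι Y)
      = ι ((gram (entropyFun g ι) x).inverse (levi (entropyFun g ι) x X Y)) := by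
  have hH := hι.isDivergence hg
  refine hι.metricDual_eq hg hx (fun X Y => hι.metric_eq hg hx X Y) fun Z => ?_
  have h : third (entropyFun g ι) (x, x) (Z, Z) (X, 0) (0, Y)
      = third (entropyFun g ι) (x, x) (X, 0) (0, Y) (Z, Z) := by
    rw [hH.third_comm_left hx hx, hH.third_comm_right hx hx]
  rw [hι.derivAlong_metric hg hx, hι.derivAlong_metric hg hx, hι.derivAlong_metric hg hx,
    levi_apply, h]
  ring

theorem pConn_eq {x : V} (hx : x ∈ posDefCone ι) (p : ℝ) (X Y : V) :
    pConn g p (ι x) (ι X) (ι Y) = ι (chris (entropyFun g ι) ((1 - 2 * p) / 2) x X Y) := by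
  rw [pConn, hι.metricConn_eq hg hx, hι.skewTensor_eq hg hx, chris, chrisForm, map_sub, map_sub,
    _root_.map_smul, _root_.map_smul]

theorem covDeriv_pConn_eq {x : V} (hx : x ∈ posDefCone ι) (p : ℝ) (X : V)
    {F : Matrix (Fin n) (Fin n) ℂ → Matrix (Fin n) (Fin n) ℂ} {f : V → V}
    (hF : ∀ᶠ z in 𝓝 x, F (ι z) = ι (f z)) (hf : DifferentiableAt ℝ f x) :
    covDeriv (pConn g p) (ι X) F (ι x) = ι (deriv (fun s : ℝ => f (x + s • X)) 0
      + chris (entropyFun g ι) ((1 - 2 * p) / 2) x X (f x)) := by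
  rw [covDeriv, hF.self_of_nhds, hι.pConn_eq hg hx, map_add]
  congr 1
  ext i j
  have hc : ContinuousAt (fun s : ℝ => x + s • X) 0 := by fun_prop
  have hline : ∀ᶠ s : ℝ in 𝓝 0, F (ι (x + s • X)) = ι (f (x + s • X)) :=
    hc.eventually (by simpa using hF)
  have hd := hasDerivAt_line hf X
  have h := (entryForm ι i j).hasFDerivAt.comp_hasDerivAt (0 : ℝ) hd
  rw [Matrix.of_apply, hd.deriv, ← entryForm_apply, ← h.deriv]
  refine EventuallyEq.deriv_eq ?_
  filter_upwards [hline] with s hs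
  rw [Function.comp_apply, entryForm_apply, ← hs, map_add, _root_.map_smul]

theorem covDeriv_pConn_const {x : V} (hx : x ∈ posDefCone ι) (p : ℝ) (X Z : V) :
    covDeriv (pConn g p) (ι X) (fun _ => ι Z) (ι x)
      = ι (chris (entropyFun g ι) ((1 - 2 * p) / 2) x X Z) := by
  rw [hι.covDeriv_pConn_eq hg hx p X (f := fun _ => Z) (Eventually.of_forall fun _ => rfl)
    (differentiableAt_const Z)]
  simp

theorem covDeriv_covDeriv_pConn {x : V} (hx : x ∈ posDefCone ι) (p : ℝ) (X Y Z : V) :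
    covDeriv (pConn g p) (ι X) (covDeriv (pConn g p) (ι Y) fun _ => ι Z) (ι x)
      = ι (deriv (fun s : ℝ => chris (entropyFun g ι) ((1 - 2 * p) / 2) (x + s • X) Y Z) 0
        + chris (entropyFun g ι) ((1 - 2 * p) / 2) x X
          (chris (entropyFun g ι) ((1 - 2 * p) / 2) x Y Z)) := by
  have hH := hι.isDivergence hg
  refine hι.covDeriv_pConn_eq hg hx p X
    (f := fun z => chris (entropyFun g ι) ((1 - 2 * p) / 2) z Y Z) ?_
    ((hH.contDiffAt_chris hx _ Y Z).differentiableAt (by simp))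
  filter_upwards [hH.isOpen.mem_nhds hx] with z hz
  exact hι.covDeriv_pConn_const hg hz p Y Z

theorem curvature_eq {x : V} (hx : x ∈ posDefCone ι) (p : ℝ) (X Y Z W : V) :
    curvature g p (ι x) (ι X) (ι Y) (ι Z) (ι W)
      = riem (entropyFun g ι) ((1 - 2 * p) / 2) x X Y Z W := by
  rw [curvature, hι.covDeriv_covDeriv_pConn hg hx, hι.covDeriv_covDeriv_pConn hg hx, ← map_sub,
    hι.metric_eq hg hx, riem]

theorem skew_eq_of_conjugateSymmetric (hsymm : ConjugateSymmetric n g) {x : V}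
    (hx : x ∈ posDefCone ι) (Y : V) :
    skew (entropyFun g ι) x x Y Y
      = -(2 * deriv (deriv (deriv g)) 1 + 3) * gram (entropyFun g ι) x Y Y := by
  refine (hι.isDivergence hg).skew_eq_of_riem_eq hx Y ?_
  -- The single value `p = 0` suffices: it compares `q = 1/2` with `q = -1/2`.
  have h := hsymm 0 (ι x) (ι x) (ι Y) (ι x) (ι Y) hx (hι.isHermitian x) (hι.isHermitian Y)
    (hι.isHermitian x) (hι.isHermitian Y)
  rw [hι.curvature_eq hg hx, hι.curvature_eq hg hx] at h
  norm_num at h ⊢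
  exact h

end IsHermitianChart

end Transfer

end QIG

end

noncomputable section

namespace QIG

open Filter Topology Matrix

/-! ### Rotations of diagonal matrices -/

section Rotation

variable {n : ℕ}

/-- The rotation by the angle `t` in the plane of the coordinates `i` and `j`. -/
def planeRotation (i j : Fin n) (t : ℝ) : Matrix (Fin n) (Fin n) ℂ :=
  Matrix.of fun k => if k = i then Pi.single i (Real.cos t : ℂ) - Pi.single j (Real.sin t : ℂ)
    else if k = j then Pi.single i (Real.sin t : ℂ) + Pi.single j (Real.cos t : ℂ)
    else Pi.single k 1

theorem planeRotation_left (i j : Fin n) (t : ℝ) :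
    planeRotation i j t i = Pi.single i (Real.cos t : ℂ) - Pi.single j (Real.sin t : ℂ) :=
  if_pos rfl

theorem planeRotation_right {i j : Fin n} (hij : i ≠ j) (t : ℝ) :
    planeRotation i j t j = Pi.single i (Real.sin t : ℂ) + Pi.single j (Real.cos t : ℂ) :=
  (if_neg hij.symm).trans (if_pos rfl)

theorem planeRotation_of_ne {i j k : Fin n} (hi : k ≠ i) (hj : k ≠ j) (t : ℝ) :
    planeRotation i j t k = Pi.single k 1 :=
  (if_neg hi).trans (if_neg hj)

/-- Writes the orbit with two fixed hermitian matrices: the first is its velocity at `0`, and the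
second, half its acceleration, is traceless. -/
theorem planeRotation_mul_diagonal_mul {i j : Fin n} (hij : i ≠ j) (t : ℝ) (d : Fin n → ℝ) :
    planeRotation i j t * diagonal (fun k => (d k : ℂ)) * (planeRotation i j t)ᴴ
      = diagonal (fun k => (d k : ℂ))
        + (Real.sin t * Real.cos t) • ((d i - d j) • (single i j (1 : ℂ) + single j i 1))
        + (Real.sin t ^ 2) • ((d j - d i) • (single i i (1 : ℂ) - single j j 1)) := by
  have hcs : Complex.cos t ^ 2 = 1 - Complex.sin t ^ 2 := Complex.cos_sq' t
  have hcos : (starRingEnd ℂ) (Complex.cos t) = Complex.cos t := by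
    rw [← Complex.cos_conj, Complex.conj_ofReal]
  have hsin : (starRingEnd ℂ) (Complex.sin t) = Complex.sin t := by
    rw [← Complex.sin_conj, Complex.conj_ofReal]
  have hji := hij.symm
  ext k l
  rw [Matrix.mul_assoc, Matrix.mul_apply]
  simp only [diagonal_mul, conjTranspose_apply, Matrix.add_apply, Matrix.smul_apply,
    Matrix.sub_apply, single_apply, diagonal_apply]
  by_cases hki : k = i
  · subst hki
    rw [planeRotation_left]
    by_cases hli : l = k
    · subst hli
      simp [planeRotation_left, Pi.single_apply, sub_mul, Finset.sum_sub_distrib, hij, hji, hcos,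
        hsin]
      linear_combination (d l : ℂ) * hcs
    · by_cases hlj : l = j
      · subst hlj
        simp [planeRotation_right hij, Pi.single_apply, sub_mul, Finset.sum_sub_distrib, hij, hji, hcos,
        hsin]
        ring
      · simp [planeRotation_of_ne hli hlj, Pi.single_apply, sub_mul, hji, hli, hlj,
          Ne.symm hli, Ne.symm hlj]
  · by_cases hkj : k = j
    · subst hkj
      rw [planeRotation_right hij]
      by_cases hli : l = i
      · subst hli
        simp [planeRotation_left, Pi.single_apply, add_mul, Finset.sum_add_distrib, hij, hji,
          hcos, hsin]
        ring
      · by_cases hlj : l = k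
        · subst hlj
          simp [planeRotation_right hij, Pi.single_apply, add_mul, Finset.sum_add_distrib, hij, hji,
          hcos, hsin]
          linear_combination (d l : ℂ) * hcs
        · simp [planeRotation_of_ne hli hlj, Pi.single_apply, add_mul, hij, hli, hlj,
            Ne.symm hli, Ne.symm hlj]
    · rw [planeRotation_of_ne hki hkj]
      by_cases hli : l = i
      · subst hli
        simp [planeRotation_left, Pi.single_apply, hji, hki, hkj, Ne.symm hki, Ne.symm hkj]
      · by_cases hlj : l = j
        · subst hlj
          simp [planeRotation_right hij, Pi.single_apply, hij, hki, hkj, Ne.symm hki,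
            Ne.symm hkj]
        · simp only [planeRotation_of_ne hli hlj, Pi.single_apply]
          rcases eq_or_ne k l with rfl | hkl
          · simp [Ne.symm hki, Ne.symm hkj]
          · simp [hkl, hkl.symm, Ne.symm hki, Ne.symm hkj]

/-- The squared moduli of the entries are those of the identity outside the `i`, `j` block, where
they are `cos² t` and `sin² t`. -/
theorem sum_sum_normSq_planeRotation {i j : Fin n} (hij : i ≠ j) (t : ℝ)
    (F : Fin n → Fin n → ℝ) :
    ∑ k, ∑ l, F k l * Complex.normSq (planeRotation i j t l k)
      = ∑ k, F k k + Real.sin t ^ 2 * (F i j + F j i - F i i - F j j) := by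
  have hcs : Real.cos t ^ 2 = 1 - Real.sin t ^ 2 := Real.cos_sq' t
  have hji := hij.symm
  have h (l : Fin n) : ∑ k, F k l * Complex.normSq (planeRotation i j t l k)
      = F l l + (if l = i then Real.sin t ^ 2 * (F j i - F i i) else 0)
        + (if l = j then Real.sin t ^ 2 * (F i j - F j j) else 0) := by
    by_cases hli : l = i
    · subst hli
      rw [planeRotation_left, ← Finset.add_sum_erase _ _ (Finset.mem_univ l),
        ← Finset.add_sum_erase _ _ (Finset.mem_erase.2 ⟨hji, Finset.mem_univ j⟩),
        Finset.sum_eq_zero]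
      · simp only [Pi.sub_apply, Pi.single_apply, hij, hji, if_true, if_false, sub_zero, zero_sub,
          add_zero, Complex.normSq_neg, Complex.normSq_ofReal]
        linear_combination F l l * hcs
      · intro k hk
        simp only [Finset.mem_erase] at hk
        simp [hk.1, hk.2.1]
    · by_cases hlj : l = j
      · subst hlj
        rw [planeRotation_right hij, ← Finset.add_sum_erase _ _ (Finset.mem_univ l),
          ← Finset.add_sum_erase _ _ (Finset.mem_erase.2 ⟨hij, Finset.mem_univ i⟩),
          Finset.sum_eq_zero]
        · simp only [Pi.add_apply, Pi.single_apply, hij, hji, if_true, if_false, add_zero, zero_add,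
            Complex.normSq_ofReal]
          linear_combination F l l * hcs
        · intro k hk
          simp only [Finset.mem_erase] at hk
          simp [hk.1, hk.2.1]
      · rw [planeRotation_of_ne hli hlj]
        simp [hli, hlj, Pi.single_apply, apply_ite Complex.normSq]
  rw [Finset.sum_comm]
  simp only [h, Finset.sum_add_distrib, Finset.sum_ite_eq', Finset.mem_univ, if_true]
  ring

theorem planeRotation_mul_conjTranspose {i j : Fin n} (hij : i ≠ j) (t : ℝ) :
    planeRotation i j t * (planeRotation i j t)ᴴ = 1 := by
  have h := planeRotation_mul_diagonal_mul hij t (fun _ => 1)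
  simpa using h

/-- The relative entropy of a diagonal matrix and a rotated one. -/
theorem exists_relEntropy_rotation {i j : Fin n} (hij : i ≠ j) (g : ℝ → ℝ) {d : Fin n → ℝ}
    (hd : ∀ k, 0 < d k) (u : ℝ) : ∃ C : ℝ, ∀ t : ℝ,
    relEntropy g (diagonal fun k => (d k : ℂ))
      (u • (planeRotation i j t * diagonal (fun k => (d k : ℂ)) * (planeRotation i j t)ᴴ))
      = C + Real.sin t ^ 2 * (d j * g (u * (d i / d j)) + d i * g (u * (d j / d i))
          - (d i + d j) * g u) := by
  refine ⟨∑ k, d k * g (u * d k / d k), fun t => ?_⟩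
  have hU := planeRotation_mul_conjTranspose hij t
  have h := relEntropy_eq_sum g hU (V := 1) (by simp) (l := fun k => u * d k) hd
  rw [← smul_mul_diagonal_mul, Matrix.one_mul, conjTranspose_one, Matrix.mul_one, Matrix.mul_one]
    at h
  rw [h]
  simp only [conjTranspose_apply, RCLike.star_def, Complex.normSq_conj]
  rw [sum_sum_normSq_planeRotation hij t fun k l => d l * g (u * d k / d l)]
  have h1 (k : Fin n) : u * d k / d k = u := mul_div_cancel_right₀ u (hd k).ne'
  simp only [h1, mul_div_assoc]
  ring

end Rotation

/-! ### Second derivatives from a curve of rotations -/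

section Curve

set_option maxSynthPendingDepth 3

variable {V : Type*} [NormedAddCommGroup V] [NormedSpace ℝ V]
  {H : V × V → ℝ} {Ω : Set V} {τ : V →L[ℝ] ℝ} {g : ℝ → ℝ}

/-- Differentiate twice at `t = 0`: the curve has velocity `P` and acceleration `2 Q`. -/
theorem IsDivergence.hess_eq_of_rotation (hH : IsDivergence H Ω τ g) {z P Q : V × V}
    (hz : z ∈ Ω ×ˢ Ω) {C K : ℝ}
    (h : ∀ᶠ t : ℝ in 𝓝 0, H (z + (Real.sin t * Real.cos t) • P + (Real.sin t ^ 2) • Q)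
      = C + Real.sin t ^ 2 * K) :
    hess H z P P + 2 * fderiv ℝ H z Q = 2 * K := by
  set γ : ℝ → V × V := fun t => z + (Real.sin t * Real.cos t) • P + (Real.sin t ^ 2) • Q with hγ
  set γ' : ℝ → V × V := fun t => (Real.cos t ^ 2 - Real.sin t ^ 2) • P
    + (2 * Real.sin t * Real.cos t) • Q with hγ'
  have h1 (t : ℝ) : HasDerivAt γ (γ' t) t := by
    have e := ((((Real.hasDerivAt_sin t).mul (Real.hasDerivAt_cos t)).smul_const P).const_add z).add
      (((Real.hasDerivAt_sin t).pow 2).smul_const Q)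
    refine e.congr_deriv ?_
    simp only [hγ']
    congr 2
    · ring
    · simp
  have h2 : HasDerivAt γ' ((2 : ℝ) • Q) 0 := by
    have e := ((((Real.hasDerivAt_cos 0).pow 2).sub ((Real.hasDerivAt_sin 0).pow 2)).smul_const P).add
      ((((Real.hasDerivAt_sin 0).const_mul 2).mul (Real.hasDerivAt_cos 0)).smul_const Q)
    refine e.congr_deriv ?_
    simp
  have hγ0 : γ 0 = z := by simp [hγ]
  have hγ'0 : γ' 0 = P := by simp [hγ']
  have hmem : ∀ᶠ t in 𝓝 (0 : ℝ), γ t ∈ Ω ×ˢ Ω :=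
    (h1 0).continuousAt.eventually (hH.isOpen_prod.mem_nhds (by rwa [hγ0]))
  have hF : deriv (fun t => H (γ t)) =ᶠ[𝓝 0] fun t => fderiv ℝ H (γ t) (γ' t) := by
    filter_upwards [hmem] with t ht
    exact ((((hH.contDiffAt ht.1 ht.2).differentiableAt (by simp)).hasFDerivAt).comp_hasDerivAt t
      (h1 t)).deriv
  have hG : deriv (fun t => H (γ t)) =ᶠ[𝓝 0] fun t => 2 * Real.sin t * Real.cos t * K := by
    have h' : (fun t => H (γ t)) =ᶠ[𝓝 0] fun t => C + Real.sin t ^ 2 * K := h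
    refine h'.deriv.trans (Eventually.of_forall fun t => ?_)
    refine ((((Real.hasDerivAt_sin t).pow 2).mul_const K).const_add C).deriv.trans ?_
    simp
  have hd1 : HasDerivAt (fun t => fderiv ℝ H (γ t) (γ' t))
      (hess H z P P + fderiv ℝ H z ((2 : ℝ) • Q)) 0 := by
    have hdiff : DifferentiableAt ℝ (fderiv ℝ H) (γ 0) := by
      rw [hγ0]
      exact (hH.contDiffAt_fderiv hz.1 hz.2).differentiableAt (by simp)
    have e := (hdiff.hasFDerivAt.comp_hasDerivAt 0 (h1 0)).clm_apply h2
    rw [hγ0, hγ'0] at e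
    refine e.congr_deriv ?_
    simp [hess, hγ0]
  have hd2 : HasDerivAt (fun t => 2 * Real.sin t * Real.cos t * K) (2 * K) 0 := by
    have e := ((((Real.hasDerivAt_sin 0).const_mul 2).mul (Real.hasDerivAt_cos 0)).mul_const K)
    refine e.congr_deriv ?_
    simp
  have h3 := (hd1.congr_of_eventuallyEq (hG.symm.trans hF)).unique hd2
  rwa [_root_.map_smul, smul_eq_mul] at h3

end Curve

end QIG

end

/-! ### Evaluation of the skewness identity and the functional equation -/

noncomputable section

namespace QIG

open Filter Topology Matrix

/-- The coefficient of `sin² t` in the relative `g`-entropy of a diagonal matrix with entries `a`,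
`b` and `u` times its rotation by the angle `t`. -/
def rotationCoeff (g : ℝ → ℝ) (a b u : ℝ) : ℝ :=
  b * g (u * (a / b)) + a * g (u * (b / a)) - (a + b) * g u

theorem hasDerivAt_rotationCoeff {f f' : ℝ → ℝ} (hf : ∀ u, 0 < u → HasDerivAt f (f' u) u)
    {a b : ℝ} (ha : 0 < a) (hb : 0 < b) :
    HasDerivAt (rotationCoeff f a b) (a * f' (a / b) + b * f' (b / a) - (a + b) * f' 1) 1 := by
  have h (r : ℝ) (hr : 0 < r) : HasDerivAt (fun u => f (u * r)) (f' r * r) 1 := by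
    have h1 : HasDerivAt (fun u : ℝ => u * r) r 1 := by
      simpa using (hasDerivAt_id (1 : ℝ)).mul_const r
    exact HasDerivAt.comp (1 : ℝ) (by simpa using hf r hr) h1
  have e := (((h _ (div_pos ha hb)).const_mul b).add ((h _ (div_pos hb ha)).const_mul a)).sub
    ((hf 1 one_pos).const_mul (a + b))
  refine e.congr_deriv ?_
  field_simp

theorem hasDerivAt_hat {g : ℝ → ℝ} {u d : ℝ} (hu : 0 < u) (hg : HasDerivAt g d u⁻¹) :
    HasDerivAt (hat g) (g u⁻¹ - d / u) u := by
  have e := (hasDerivAt_id u).mul (hg.comp u (hasDerivAt_inv hu.ne'))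
  refine e.congr_deriv ?_
  simp only [id, Function.comp_apply]
  field_simp
  ring

section Evaluation

set_option maxSynthPendingDepth 3

variable {n : ℕ} {V : Type*} [NormedAddCommGroup V] [NormedSpace ℝ V] [FiniteDimensional ℝ V]
  {ι : V →ₗ[ℝ] Matrix (Fin n) (Fin n) ℂ} {g : ℝ → ℝ}

namespace IsHermitianChart

variable {i j : Fin n} {d : Fin n → ℝ} {x Y N : V}

theorem map_rotation (hij : i ≠ j) (hx : ι x = diagonal fun k => (d k : ℂ))
    (hY : ι Y = (d i - d j) • (single i j (1 : ℂ) + single j i 1))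
    (hN : ι N = (d j - d i) • (single i i (1 : ℂ) - single j j 1)) (t : ℝ) :
    ι (x + (Real.sin t * Real.cos t) • Y + (Real.sin t ^ 2) • N)
      = planeRotation i j t * diagonal (fun k => (d k : ℂ)) * (planeRotation i j t)ᴴ := by
  rw [planeRotation_mul_diagonal_mul hij, map_add, map_add, _root_.map_smul, _root_.map_smul, hx,
    hY, hN]

theorem traceForm_eq_zero (hN : ι N = (d j - d i) • (single i i (1 : ℂ) - single j j 1)) :
    traceForm ι N = 0 := by
  rw [traceForm_apply, hN]
  simp

variable (hι : IsHermitianChart ι) (hg : InG g)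
include hι hg

/-- The acceleration term drops out: on rays the first derivative is a multiple of the trace, and
`N` is traceless. -/
theorem hess_right_rotation (hij : i ≠ j) (hd : ∀ k, 0 < d k)
    (hx : ι x = diagonal fun k => (d k : ℂ))
    (hY : ι Y = (d i - d j) • (single i j (1 : ℂ) + single j i 1))
    (hN : ι N = (d j - d i) • (single i i (1 : ℂ) - single j j 1))
    (hxΩ : x ∈ posDefCone ι) {u : ℝ} (hu : 0 < u) :
    u ^ 2 * hess (entropyFun g ι) (x, u • x) (0, Y) (0, Y)
      = 2 * rotationCoeff g (d i) (d j) u := by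
  have hH := hι.isDivergence hg
  obtain ⟨C, hC⟩ := exists_relEntropy_rotation hij g hd u
  have h := hH.hess_eq_of_rotation (z := (x, u • x)) (P := (0, u • Y)) (Q := (0, u • N))
    (C := C) (K := rotationCoeff g (d i) (d j) u) ⟨hxΩ, hH.smul_mem hxΩ hu⟩
    (Eventually.of_forall fun t => ?_)
  · rw [hH.fderiv_right _ hxΩ hu, _root_.map_smul, traceForm_eq_zero hN, prod_mk_zero_smul,
      _root_.map_smul, _root_.map_smul, _root_.smul_apply] at h
    simp only [smul_eq_mul] at h
    linarith
  · rw [rotationCoeff, ← hC t, ← map_rotation hij hx hY hN, entropyFun, ← hx, ← _root_.map_smul]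
    simp only [Prod.fst_add, Prod.snd_add, Prod.smul_mk, smul_zero, add_zero, smul_add]
    rw [smul_comm u, smul_comm u]

theorem hess_left_rotation (hij : i ≠ j) (hd : ∀ k, 0 < d k)
    (hx : ι x = diagonal fun k => (d k : ℂ))
    (hY : ι Y = (d i - d j) • (single i j (1 : ℂ) + single j i 1))
    (hN : ι N = (d j - d i) • (single i i (1 : ℂ) - single j j 1))
    (hxΩ : x ∈ posDefCone ι) {u : ℝ} (hu : 0 < u) :
    u ^ 2 * hess (entropyFun g ι) (u • x, x) (Y, 0) (Y, 0)
      = 2 * rotationCoeff (hat g) (d i) (d j) u := by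
  have hH := hι.isDivergence hg
  have hux := hH.smul_mem hxΩ hu
  obtain ⟨C, hC⟩ := exists_relEntropy_rotation hij (hat g) hd u
  have hcurve : ∀ᶠ t : ℝ in 𝓝 0, x + (Real.sin t * Real.cos t) • Y + (Real.sin t ^ 2) • N
      ∈ posDefCone ι := by
    have hc : ContinuousAt
        (fun t : ℝ => x + (Real.sin t * Real.cos t) • Y + (Real.sin t ^ 2) • N) 0 := by fun_prop
    exact hc.eventually (hH.isOpen.mem_nhds (by simpa using hxΩ))
  have h := hH.hess_eq_of_rotation (z := (u • x, x)) (P := (u • Y, 0)) (Q := (u • N, 0))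
    (C := C) (K := rotationCoeff (hat g) (d i) (d j) u) ⟨hux, hxΩ⟩
    (by
      filter_upwards [hcurve] with t ht
      have hut := hH.smul_mem ht hu
      rw [rotationCoeff, ← hC t, ← map_rotation hij hx hY hN, ← hx, ← _root_.map_smul,
        relEntropy_hat g (mem_posDefCone.1 hxΩ) (mem_posDefCone.1 hut), entropyFun]
      simp only [Prod.fst_add, Prod.snd_add, Prod.smul_mk, smul_zero, add_zero, smul_add]
      rw [smul_comm u, smul_comm u])
  -- The pair `(u x, x)` is read as a ray based at `u x` with ratio `u⁻¹`.
  have e := hH.fderiv_left (u • N) hux (inv_pos.2 hu)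
  rw [smul_smul, inv_mul_cancel₀ hu.ne', one_smul, _root_.map_smul, traceForm_eq_zero hN] at e
  rw [e, prod_mk_smul_zero, _root_.map_smul, _root_.map_smul, _root_.smul_apply] at h
  simp only [smul_eq_mul] at h
  linarith

/-- The functional equation satisfied by a conjugate symmetric `g`, for a pair of eigenvalues. -/
theorem rotationCoeff_deriv_sub (hsymm : ConjugateSymmetric n g) (hij : i ≠ j)
    (hd : ∀ k, 0 < d k) {p q : ℝ} (hp : HasDerivAt (rotationCoeff g (d i) (d j)) p 1)
    (hq : HasDerivAt (rotationCoeff (hat g) (d i) (d j)) q 1) :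
    q - p = -(2 * deriv (deriv (deriv g)) 1 + 3) * rotationCoeff g (d i) (d j) 1 := by
  have hH := hι.isDivergence hg
  have hdiag : (diagonal fun k => (d k : ℂ)).PosDef :=
    PosDef.diagonal fun k => by exact_mod_cast hd k
  obtain ⟨x, hx⟩ := hι.isHermitian_iff.1 hdiag.1
  have hxΩ : x ∈ posDefCone ι := by rwa [mem_posDefCone, hx]
  obtain ⟨Y, hY⟩ := hι.isHermitian_iff.1
    (show ((d i - d j) • (single i j (1 : ℂ) + single j i 1)).IsHermitian by
      rw [IsHermitian, conjTranspose_smul, conjTranspose_add, conjTranspose_single,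
        conjTranspose_single, star_one, star_trivial, add_comm])
  obtain ⟨N, hN⟩ := hι.isHermitian_iff.1
    (show ((d j - d i) • (single i i (1 : ℂ) - single j j 1)).IsHermitian by
      rw [IsHermitian, conjTranspose_smul, conjTranspose_sub, conjTranspose_single,
        conjTranspose_single, star_one, star_trivial])
  set H := entropyFun g ι
  have hsq : HasDerivAt (fun s : ℝ => (1 + s) ^ 2) 2 0 := by
    refine (((hasDerivAt_id (0 : ℝ)).const_add 1).pow 2).congr_deriv ?_
    simp
  have hshift {f : ℝ → ℝ} {r : ℝ} (hf : HasDerivAt f r 1) :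
      HasDerivAt (fun s => 2 * f (1 + s)) (2 * r) 0 := by
    have h1 : HasDerivAt (fun s : ℝ => 1 + s) 1 0 := (hasDerivAt_id 0).const_add 1
    simpa using (HasDerivAt.comp (0 : ℝ) (by simpa using hf) h1).const_mul 2
  have hpos := eventually_one_add_pos
  have hgram : gram H x Y Y = 2 * rotationCoeff g (d i) (d j) 1 := by
    have h := hι.hess_right_rotation hg hij hd hx hY hN hxΩ one_pos
    rw [one_smul, one_pow, one_mul] at h
    rw [hH.gram_eq_hess_right hxΩ, h]
  -- The product rule at `u = 1 + s` for `hess_right_rotation`; the metric term comes from the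
  -- factor `u²`. The same term occurs in `hL` and cancels in the difference.
  have hR : 2 * gram H x Y Y + third H (x, x) (0, x) (0, Y) (0, Y) = 2 * p := by
    have e := hsq.mul (hH.hasDerivAt_hess hxΩ hxΩ (0, x) (0, Y) (0, Y))
    have h := e.unique ((hshift hp).congr_of_eventuallyEq (by
      filter_upwards [hpos] with s hs
      rw [Pi.mul_apply, add_smul_prod_mk_zero_left,
        hι.hess_right_rotation hg hij hd hx hY hN hxΩ hs]))
    rw [hH.gram_eq_hess_right hxΩ]
    simpa using h
  have hL : 2 * gram H x Y Y + third H (x, x) (x, 0) (Y, 0) (Y, 0) = 2 * q := by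
    have e := hsq.mul (hH.hasDerivAt_hess hxΩ hxΩ (x, 0) (Y, 0) (Y, 0))
    have h := e.unique ((hshift hq).congr_of_eventuallyEq (by
      filter_upwards [hpos] with s hs
      have hz : (x, x) + s • (x, (0 : V)) = ((1 + s) • x, x) := by simp [add_smul]
      rw [Pi.mul_apply, hz, hι.hess_left_rotation hg hij hd hx hY hN hxΩ hs]))
    rw [hH.gram_eq_hess_left hxΩ]
    simpa using h
  have hskew := hι.skew_eq_of_conjugateSymmetric hg hsymm hxΩ Y
  rw [hH.skew_diag hxΩ, hH.third_rev hxΩ hxΩ (Y, 0) (Y, 0) (x, 0),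
    hH.third_rev hxΩ hxΩ (0, Y) (0, Y) (0, x), hgram] at hskew
  linarith

end IsHermitianChart

end Evaluation

end QIG

end

theorem theorem7p1 (n : ℕ) (hn : 2 ≤ n) (g : ℝ → ℝ) (hg : QIG.InG g)
    (hne : ∃ u : ℝ, 0 < u ∧ g u ≠ QIG.hat g u)
    (hsymm : QIG.ConjugateSymmetric n g)
    (gbar gr : ℝ → ℝ) (hgbar : gbar = fun u => g u + QIG.hat g u)
    (hgr : gr = fun u => QIG.hat g u - g u)
    (a α : ℝ) (ha : a = deriv g 1) (hα : α = 2 * iteratedDeriv 3 g 1 + 3) :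
    ∀ u : ℝ, 0 < u →
      -α * gbar u = 2 * u * deriv gr u - gr u + 2 * a * u + 2 * a := by
  intro v hv
  obtain ⟨m, ι, hι⟩ := QIG.exists_isHermitianChart n
  have hderiv (u : ℝ) (hu : 0 < u) : HasDerivAt g (deriv g u) u :=
    ((hg.operatorConvex.contDiffAt hu).differentiableAt (by simp)).hasDerivAt
  have hhat (u : ℝ) (hu : 0 < u) :
      HasDerivAt (QIG.hat g) (g u⁻¹ - deriv g u⁻¹ / u) u :=
    QIG.hasDerivAt_hat hu (hderiv _ (inv_pos.2 hu))
  let i : Fin n := ⟨0, by omega⟩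
  let j : Fin n := ⟨1, by omega⟩
  have hij : i ≠ j := by simp [i, j]
  -- Only the eigenvalues `1` and `v` in the rotated plane matter; the coefficient at `u = 1` is
  -- then `g(v) + ĝ(v)`.
  let d : Fin n → ℝ := fun k => if k = j then v else 1
  have hdi : d i = 1 := if_neg hij
  have hdj : d j = v := if_pos rfl
  have hd (k : Fin n) : 0 < d k := by
    simp only [d]
    split_ifs
    exacts [hv, one_pos]
  have h := hι.rotationCoeff_deriv_sub hg hsymm hij hd
    (QIG.hasDerivAt_rotationCoeff hderiv (hd i) (hd j))
    (QIG.hasDerivAt_rotationCoeff hhat (hd i) (hd j))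
  have h3 : iteratedDeriv 3 g 1 = deriv (deriv (deriv g)) 1 := by
    rw [iteratedDeriv_succ, iteratedDeriv_succ, iteratedDeriv_one]
  have hgr' : deriv gr v = g v⁻¹ - deriv g v⁻¹ / v - deriv g v := by
    rw [hgr]
    exact ((hhat v hv).sub (hderiv v hv)).deriv
  rw [hgr', hα, h3, hgbar, hgr, ha]
  simp only [QIG.rotationCoeff, hdi, hdj, QIG.hat, hg.map_one, one_div, div_one, one_mul, inv_one,
    inv_inv] at h ⊢
  field_simp at h ⊢
  linarith
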